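/- **Setting.** A finite probabilized von Neumann algebra is a unital $\mathbb C$-algebra ${\cal A}$ with an antilinear involution $*$ and a linear form $\tau$ such that $\tau(a^*)=\overline{\tau(a)}$, $\tau(ab)=\tau(ba)$, $\tau(1)=1$, $\tau(a^*a)\ge 0$ with equality iff $a=0$; left multiplications are bounded for the inner product $\langle a,b\rangle=\tau(ab^*)$, the Hilbert space completion ${\cal A}_2$ of ${\cal A}$ is separable, the image of ${\cal A}$ in ${\cal B}({\cal A}_2)$ under left multiplication is closed in the strong operator topology; and $\tau(\sup_n a_n)=\sup_n\tau(a_n)$ for every increasing sequence $(a_n)$ of self-adjoint elements that has a supremum in ${\cal A}$. A projective Hilbert ${\cal A}$-module is a Hilbert space $W$ with an action of ${\cal A}$ such that $(ax,y)=(x,a^*y)$ and which embeds isometrically and ${\cal A}$-equivariantly in ${\cal A}_2\hat\otimes H$ for a Hilbert space $H$; it is of finite type if $H$ can be taken of finite dimension. $P({\cal A})$ is the category of these modules and of bounded ${\cal A}$-linear maps, and $P_f({\cal A})$ its full subcategory of modules of finite type. The category $E_f({\cal A})$ has as objects the morphisms $e:E_1\to E_2$ of $P({\cal A})$ with $E_2$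 of finite type; a morphism from $e:E_1\to E_2$ to $f:F_1\to F_2$ is a class of pairs $(\phi_1,\phi_2)$ with $\phi_2e=f\phi_1$, where $(\phi_1,\phi_2)\sim(\phi_1',\phi_2')$ iff $\phi'_2-\phi_2=fT$ for some bounded ${\cal A}$-linear $T:E_2\to F_1$. One has the functor $P_f({\cal A})\to E_f({\cal A})$, $E\mapsto(0\to E)$. A morphism of $P({\cal A})$ is ${\cal A}$-compact if it is a norm limit of morphisms the closure of whose image is of finite type. A premontelian module $W$ is a family $(W(t))_{0<t\le t_0}$ (for some $t_0>0$) of projective Hilbert ${\cal A}$-modules with bounded ${\cal A}$-linear maps $\rho_t^{t'}:W(t)\to W(t')$ for $0<t'\le t\le t_0$ such that $\rho_t^t=\mathrm{Id}$, $\rho_{t'}^{t''}\rho_t^{t'}=\rho_t^{t''}$, and $\rho_t^{t'}$ is ${\cal A}$-compact for $t'<t$. Montelian modules are germs at $t=0$ of premontelian modules; their morphisms are germs at $t=0$ of families of bounded ${\cal A}$-linear maps $\phi(t):V(t)\to W(t)$ that commute with the $\rho_t^{t'}$. Put $W_*(t)=\varprojlim_{t'<t}W(t')$. For a complex $F^\bullet$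 of montelian modules and small $t>0$ let $H^i_*(t,F^\bullet)$ be the $i$-th (algebraic) cohomology of $F^\bullet_*(t)$. A morphism of complexes $\sigma:F^\bullet\to G^\bullet$ is a qi-morphism of order $q$ if, for all small enough $0<t'\le t$, the induced map $H^i_*(t,F^\bullet)\to H^i_*(t',G^\bullet)$ is bijective for $i>q$ and surjective for $i=q$ (the bound on $t$ may depend on the degree $i$); it is a qi-morphism if it is one of every order $q\in\mathbb Z$. A complex is qhtf if its identity is a qi-morphism. For $i\in\{b,-\}$ and an additive category $B$ let $K^i(B)$ be the homotopy category of bounded ($i=b$), resp. bounded above ($i=-$), complexes of $B$, and for $B$ abelian let $D^i(B)$ be its localization at the quasi-isomorphisms. Let $K^i(MontMod_{\cal A})^{qhtf}$ be the full subcategory of $K^i$ of the category of montelian modules on the qhtf complexes, and $\xi^i:K^i(MontMod_{\cal A})^{qhtf}\to K^i(MontMod_{\cal A})^{qhtf}_{Qi}$ its localization at the qi-morphisms. Let $\nu^i:K^i(P_f({\cal A}))\to K^i(MontMod_{\cal A})^{qhtf}$ be induced by sending a module $L$ to the constant family $W(t)=L$, $\rho_t^{t'}=\mathrm{Id}$,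 and let $\mu^i:K^i(P_f({\cal A}))\to D^i(E_f({\cal A}))$ be the natural functor. **Theorem.** Let ${\cal A}$ be a finite probabilized von Neumann algebra. The category $E_f({\cal A})$ is abelian, and for $i\in\{b,-\}$ the functor $\mu^i$ is an equivalence of categories and the functor $\eta^i=\xi^i\nu^i(\mu^i)^{-1}$ is an equivalence of categories $$\eta^i:\;D^i(E_f({\cal A}))\longrightarrow K^i(MontMod_{\cal A})^{qhtf}_{Qi}.$$ -/

import Mathlib

open CategoryTheory CategoryTheory.Limits

universe u

noncomputable section

namespace Montel

/-! ### Finite probabilized von Neumann algebras -/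

/-- The algebraic part of the structure of a finite probabilized von Neumann algebra on an
involutive unital `ℂ`-algebra `A`: a faithful positive unital trace for which left multiplications
are bounded in the norm `‖b‖² = τ (b b*)`, so that they extend to the completion. -/
structure PreTrace (A : Type u) [Ring A] [Algebra ℂ A] [StarRing A] [StarModule ℂ A] where
  /-- the trace -/
  τ : A →ₗ[ℂ] ℂ
  map_star : ∀ a, τ (star a) = (starRingEnd ℂ) (τ a)
  mul_comm : ∀ a b, τ (a * b) = τ (b * a)
  map_one : τ 1 = 1
  nonneg : ∀ a, 0 ≤ (τ (star a * a)).re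
  faithful : ∀ a, τ (star a * a) = 0 ↔ a = 0
  left_bounded : ∀ a, ∃ C : ℝ, ∀ b,
    (τ ((a * b) * star (a * b))).re ≤ C * (τ (b * star b)).re

section Standard

variable {A : Type u} [Ring A] [Algebra ℂ A] [StarRing A] [StarModule ℂ A]

/-- The algebra `A` regarded as a pre-Hilbert space for `⟨a, b⟩ = τ (a b*)`. -/
def PreL2 (_t : PreTrace A) : Type u := A

namespace PreL2

variable (t : PreTrace A)

instance : AddCommGroup (PreL2 t) := inferInstanceAs (AddCommGroup A)
instance : Module ℂ (PreL2 t) := inferInstanceAs (Module ℂ A)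
instance : Module A (PreL2 t) := inferInstanceAs (Module A A)
instance : IsScalarTower ℂ A (PreL2 t) := inferInstanceAs (IsScalarTower ℂ A A)
instance : SMulCommClass A ℂ (PreL2 t) := inferInstanceAs (SMulCommClass A ℂ A)

/-- An element of `A` seen in the pre-Hilbert space. -/
def of (a : A) : PreL2 t := a

/-- The element of `A` underlying an element of the pre-Hilbert space. -/
def val (x : PreL2 t) : A := x

/-- The inner product `⟨x, y⟩ = τ (x y*)`, linear in `x` and antilinear in `y`; Mathlib's
`inner ℂ x y` is antilinear in its first argument, hence is `τ (y x*)`. -/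
instance core : InnerProductSpace.Core ℂ (PreL2 t) where
  inner x y := t.τ (y.val * star x.val)
  conj_inner_symm x y := by
    rw [← t.map_star]; simp
  re_inner_nonneg x := by
    have := t.nonneg x.val
    rw [t.mul_comm] at this
    exact this
  add_left x y z := by
    change t.τ (z.val * star (x.val + y.val)) = _
    rw [star_add, mul_add, map_add]
  smul_left x y r := by
    change t.τ (y.val * star (r • x.val)) = _
    rw [star_smul, mul_smul_comm, map_smul]
    rfl
  definite x hx := by
    have hx' : t.τ (x.val * star x.val) = 0 := hx
    rw [t.mul_comm] at hx'
    exact (t.faithful _).1 hx'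

instance : NormedAddCommGroup (PreL2 t) := (core t).toNormedAddCommGroup
instance : InnerProductSpace ℂ (PreL2 t) := InnerProductSpace.ofCore (core t).toCore

lemma norm_sq (x : PreL2 t) : ‖x‖ ^ 2 = (t.τ (x.val * star x.val)).re := by
  rw [@norm_sq_eq_re_inner ℂ]; rfl

instance : UniformContinuousConstSMul A (PreL2 t) where
  uniformContinuous_const_smul a := by
    obtain ⟨C, hC⟩ := t.left_bounded a
    have h : ∀ x : PreL2 t, ‖a • x‖ ≤ Real.sqrt (max C 0) * ‖x‖ := by
      intro x
      refine le_of_sq_le_sq ?_ (by positivity)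
      rw [mul_pow, Real.sq_sqrt (le_max_right _ _), norm_sq]
      refine (hC x.val).trans ?_
      rw [← norm_sq]
      exact mul_le_mul_of_nonneg_right (le_max_left _ _) (sq_nonneg _)
    exact (AddMonoidHomClass.lipschitz_of_bound
      (DistribSMul.toAddMonoidHom (PreL2 t) a) _ h).uniformContinuous

end PreL2

/-- The standard module `A₂`: the Hilbert space completion of `A`, on which `A` acts by the
extension of left multiplication. -/
abbrev Standard (t : PreTrace A) : Type u := UniformSpace.Completion (PreL2 t)

/-- The bounded operator of left multiplication by `a` on `A₂`. -/
def leftMul (t : PreTrace A) (a : A) : Standard t →L[ℂ] Standard t where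
  toFun x := a • x
  map_add' := smul_add a
  map_smul' c x := smul_comm a c x
  cont := continuous_const_smul a

/-- The order of the involutive algebra: `a ≤ b` when `b - a` is of the form `c c*`. -/
def starLE (a b : A) : Prop := ∃ c, b - a = c * star c

end Standard

/-- A finite probabilized von Neumann algebra structure on an involutive unital `ℂ`-algebra. -/
structure FiniteVN (A : Type u) [Ring A] [Algebra ℂ A] [StarRing A] [StarModule ℂ A]
    extends PreTrace A where
  /-- `A₂` is separable. -/
  separable : TopologicalSpace.SeparableSpace (Standard toPreTrace)
  /-- The image of `A` in the bounded operators of `A₂` is closed for the strong operator topology,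
  i.e. the topology of pointwise convergence. -/
  strongly_closed : IsClosed (Set.range fun a : A =>
    ContinuousLinearMap.toPointwiseConvergenceCLM ℂ (RingHom.id ℂ) (Standard toPreTrace)
      (Standard toPreTrace) (leftMul toPreTrace a))
  /-- The trace is normal: if `s` is the supremum of an increasing sequence of self-adjoint
  elements, then `τ s` is the supremum of the traces. -/
  normal : ∀ (a : ℕ → A) (s : A), (∀ n, IsSelfAdjoint (a n)) →
    (∀ n, starLE (a n) (a (n + 1))) → (∀ n, starLE (a n) s) →
    (∀ s', (∀ n, starLE (a n) s') → starLE s s') →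
    IsLUB (Set.range fun n => (τ (a n)).re) (τ s).re

variable {A : Type u} [Ring A] [Algebra ℂ A] [StarRing A] [StarModule ℂ A]

/-! ### Projective Hilbert modules -/

/-- `W` embeds isometrically and `A`-equivariantly in `A₂ ⊗̂ ℓ²(ι)`, which is the Hilbert sum
`ℓ²(ι, A₂)` with the coordinatewise action of `A`. -/
def EmbedsIn (N : FiniteVN A) (W : Type u) [NormedAddCommGroup W] [InnerProductSpace ℂ W]
    [Module A W] (ι : Type u) : Prop :=
  ∃ j : W →ₗᵢ[ℂ] lp (fun _ : ι => Standard N.toPreTrace) 2,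
    ∀ (a : A) (x : W) (k : ι), j (a • x) k = a • j x k

/-- A projective Hilbert module over `A`. As every Hilbert space `H` is isomorphic to some `ℓ²(ι)`,
the last condition is an embedding in some `A₂ ⊗̂ H`. -/
structure HilbMod (N : FiniteVN A) : Type (u + 1) where
  /-- the underlying space -/
  carrier : Type u
  [normed : NormedAddCommGroup carrier]
  [inner : InnerProductSpace ℂ carrier]
  [complete : CompleteSpace carrier]
  [module : Module A carrier]
  [tower : IsScalarTower ℂ A carrier]
  smul_inner : ∀ (a : A) (x y : carrier), Inner.inner ℂ (a • x) y = Inner.inner ℂ x (star a • y)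
  embeds : ∃ ι : Type u, EmbedsIn N carrier ι

namespace HilbMod

variable {N : FiniteVN A}

instance : CoeSort (HilbMod N) (Type u) := ⟨carrier⟩

attribute [instance] normed inner complete module tower

/-- `W` is of finite type: it embeds in `A₂ ⊗ H` with `H` of finite dimension. -/
def FiniteType (W : HilbMod N) : Prop := ∃ ι : Type u, Finite ι ∧ EmbedsIn N W ι

/-- The bounded operators that commute with the action of `A`. -/
def homs (V W : HilbMod N) : AddSubgroup (V →L[ℂ] W) where
  carrier := {f | ∀ (a : A) (x : V), f (a • x) = a • f x}
  zero_mem' a x := by simp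
  add_mem' {f g} hf hg a x := by simp [hf a x, hg a x]
  neg_mem' {f} hf a x := by simp [hf a x]

/-- The category `P(A)`. -/
instance : Category (HilbMod N) where
  Hom V W := homs V W
  id V := ⟨ContinuousLinearMap.id ℂ V, fun _ _ => rfl⟩
  comp f g := ⟨g.1.comp f.1, fun a x => by
    rw [ContinuousLinearMap.comp_apply, f.2, g.2]; rfl⟩

instance : Preadditive (HilbMod N) where
  homGroup V W := inferInstanceAs (AddCommGroup (homs V W))
  add_comp _ _ _ f f' g := Subtype.ext (ContinuousLinearMap.comp_add g.1 f.1 f'.1)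
  comp_add _ _ _ f g g' := Subtype.ext (ContinuousLinearMap.add_comp g.1 g'.1 f.1)

/-- The bounded operator underlying a morphism. -/
def toCLM {V W : HilbMod N} (f : V ⟶ W) : V →L[ℂ] W := f.1

/-- The `A`-linear map underlying a morphism. -/
def toLin {V W : HilbMod N} (f : V ⟶ W) : V →ₗ[A] W where
  toFun x := toCLM f x
  map_add' := map_add (toCLM f)
  map_smul' := f.2

/-- The zero module. -/
def zero (N : FiniteVN A) : HilbMod N where
  carrier := PUnit.{u + 1}
  tower := ⟨fun _ _ _ => rfl⟩
  smul_inner _ _ _ := rfl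
  embeds := ⟨PUnit, ⟨0, fun x => by
    rw [Subsingleton.elim x 0]; simp⟩, fun a x k => by
    simp⟩

/-- The operator `φ` is `A`-compact: it is a limit in operator norm of morphisms `ψ n` such that the
closure of the image of `ψ n` is a projective Hilbert submodule of finite type. -/
def IsACompact {V W : HilbMod N} (φ : V ⟶ W) : Prop :=
  ∃ ψ : ℕ → (V ⟶ W),
    (∀ n, ∃ (M : HilbMod N) (k : M ⟶ W), M.FiniteType ∧ Isometry (toCLM k) ∧
      Set.range (toCLM k) = closure (Set.range (toCLM (ψ n)))) ∧
    Filter.Tendsto (fun n => toCLM (ψ n)) Filter.atTop (nhds (toCLM φ))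

lemma isACompact_of_finiteType {V W : HilbMod N} (hW : W.FiniteType) (φ : V ⟶ W)
    (hφ : Function.Surjective (toCLM φ)) : IsACompact φ :=
  ⟨fun _ => φ, fun _ => ⟨W, 𝟙 W, hW, isometry_id, by
    rw [hφ.range_eq, closure_univ]; exact Set.range_id⟩, tendsto_const_nhds⟩

end HilbMod

/-- The category `P_f(A)` of projective Hilbert modules of finite type. -/
abbrev Pf (N : FiniteVN A) := ObjectProperty.FullSubcategory (C := HilbMod N) HilbMod.FiniteType

/-! ### The category of Hilbert modules -/

/-- Two commutative squares from `e : E₁ ⟶ E₂` to `f : F₁ ⟶ F₂` are equivalent when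
`φ'₂ - φ₂ = f T` for some `T : E₂ ⟶ F₁`. -/
def eRel (N : FiniteVN A) : HomRel (Arrow (HilbMod N)) := fun X Y φ φ' =>
  ∃ T : X.right ⟶ Y.left, φ'.right - φ.right = T ≫ Y.hom

instance (N : FiniteVN A) : Congruence (eRel N) where
  equivalence :=
    { refl := fun φ => ⟨0, by simp⟩
      symm := by
        rintro φ φ' ⟨T, hT⟩
        exact ⟨-T, by rw [Preadditive.neg_comp, ← hT, neg_sub]⟩
      trans := by
        rintro φ φ' φ'' ⟨T, hT⟩ ⟨T', hT'⟩
        exact ⟨T + T', by rw [Preadditive.add_comp, ← hT, ← hT']; abel⟩ }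
  comp_left := by
    rintro X Y Z f g g' ⟨T, hT⟩
    exact ⟨f.right ≫ T, by
      rw [Category.assoc, ← hT, Preadditive.comp_sub]; rfl⟩
  comp_right := by
    rintro X Y Z f f' g ⟨T, hT⟩
    refine ⟨T ≫ g.left, ?_⟩
    have hg : g.left ≫ Z.hom = Y.hom ≫ g.right := g.w
    rw [Category.assoc, hg, ← Category.assoc, ← hT, Preadditive.sub_comp]; rfl

lemma eRel_add (N : FiniteVN A) ⦃X Y : Arrow (HilbMod N)⦄ (f₁ f₂ g₁ g₂ : X ⟶ Y)
    (hf : eRel N f₁ f₂) (hg : eRel N g₁ g₂) : eRel N (f₁ + g₁) (f₂ + g₂) := by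
  obtain ⟨T, hT⟩ := hf
  obtain ⟨S, hS⟩ := hg
  exact ⟨T + S, by rw [Preadditive.add_comp, ← hT, ← hS]; simp only [Arrow.Hom.add_right]; abel⟩

/-- The category `E(A)`: objects are the morphisms `e : E₁ ⟶ E₂` of `P(A)`, morphisms are the
equivalence classes of commutative squares. -/
abbrev EMod (N : FiniteVN A) := Quotient (eRel N)

instance (N : FiniteVN A) : Preadditive (EMod N) := Quotient.preadditive _ (eRel_add N)

instance (N : FiniteVN A) : (Quotient.functor (eRel N)).Additive :=
  Quotient.functor_additive _ (eRel_add N)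

/-- The full subcategory `E_f(A)` of the objects `e : E₁ ⟶ E₂` with `E₂` of finite type. -/
abbrev Ef (N : FiniteVN A) :=
  ObjectProperty.FullSubcategory (C := EMod N) (fun X => X.as.right.FiniteType)

/-- The functor `E ↦ (0 ⟶ E)` from `P(A)` to the category of arrows. -/
def arrowOfHilb (N : FiniteVN A) : HilbMod N ⥤ Arrow (HilbMod N) where
  obj E := Arrow.mk (0 : HilbMod.zero N ⟶ E)
  map f := Arrow.homMk 0 f (by simp)

instance (N : FiniteVN A) : (arrowOfHilb N).Additive where
  map_add {X Y f g} := by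
    ext
    · exact (add_zero _).symm
    · rfl

/-- The functor `P_f(A) ⥤ E_f(A)`, `E ↦ (0 ⟶ E)`. -/
def pfToEf (N : FiniteVN A) : Pf N ⥤ Ef N :=
  ObjectProperty.lift _
    (ObjectProperty.ι _ ⋙ arrowOfHilb N ⋙ Quotient.functor (eRel N)) (fun E => E.property)

/-! ### Montelian modules -/

/-- A premontelian module: projective Hilbert modules `W(t)`, `0 < t ≤ t₀`, with transition maps
`W(t) ⟶ W(t')` for `t' ≤ t`, which are `A`-compact for `t' < t`. The values outside of
`0 < t' ≤ t ≤ t₀` are irrelevant, as only germs at `0` are considered below. -/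
structure PreMont (N : FiniteVN A) : Type (u + 1) where
  /-- the bound of the interval of definition -/
  t₀ : ℝ
  t₀_pos : 0 < t₀
  /-- the modules -/
  obj : ℝ → HilbMod N
  /-- the transition maps -/
  ρ : ∀ t t' : ℝ, obj t ⟶ obj t'
  ρ_self : ∀ t, 0 < t → t ≤ t₀ → ρ t t = 𝟙 (obj t)
  ρ_comp : ∀ t t' t'', 0 < t'' → t'' ≤ t' → t' ≤ t → t ≤ t₀ → ρ t t' ≫ ρ t' t'' = ρ t t''
  ρ_compact : ∀ t t', 0 < t' → t' < t → t ≤ t₀ → HilbMod.IsACompact (ρ t t')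

namespace PreMont

variable {N : FiniteVN A}

/-- Families of morphisms `φ(t) : V(t) ⟶ W(t)` that commute with the transition maps for small
parameters. -/
def homs (V W : PreMont N) : AddSubgroup (∀ t, V.obj t ⟶ W.obj t) where
  carrier := {φ | ∃ ε > 0, ∀ t t', 0 < t' → t' ≤ t → t < ε →
    φ t ≫ W.ρ t t' = V.ρ t t' ≫ φ t'}
  zero_mem' := ⟨1, one_pos, fun t t' _ _ _ => by simp⟩
  add_mem' := by
    rintro φ ψ ⟨ε, hε, h⟩ ⟨δ, hδ, k⟩
    refine ⟨min ε δ, lt_min hε hδ, fun t t' h0 h1 h2 => ?_⟩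
    rw [Pi.add_apply, Pi.add_apply, Preadditive.add_comp, Preadditive.comp_add,
      h t t' h0 h1 (h2.trans_le (min_le_left _ _)), k t t' h0 h1 (h2.trans_le (min_le_right _ _))]
  neg_mem' := by
    rintro φ ⟨ε, hε, h⟩
    refine ⟨ε, hε, fun t t' h0 h1 h2 => ?_⟩
    rw [Pi.neg_apply, Pi.neg_apply, Preadditive.neg_comp, Preadditive.comp_neg, h t t' h0 h1 h2]

instance : Category (PreMont N) where
  Hom V W := homs V W
  id V := ⟨fun t => 𝟙 (V.obj t), 1, one_pos, fun t t' _ _ _ => by simp⟩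
  comp {U V W} φ ψ := ⟨fun t => φ.1 t ≫ ψ.1 t, by
    obtain ⟨ε, hε, h⟩ := φ.2
    obtain ⟨δ, hδ, k⟩ := ψ.2
    refine ⟨min ε δ, lt_min hε hδ, fun t t' h0 h1 h2 => ?_⟩
    rw [Category.assoc, k t t' h0 h1 (h2.trans_le (min_le_right _ _)), ← Category.assoc,
      h t t' h0 h1 (h2.trans_le (min_le_left _ _)), Category.assoc]⟩
  id_comp φ := Subtype.ext (funext fun t => Category.id_comp (φ.1 t))
  comp_id φ := Subtype.ext (funext fun t => Category.comp_id (φ.1 t))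
  assoc φ ψ χ := Subtype.ext (funext fun t => Category.assoc (φ.1 t) (ψ.1 t) (χ.1 t))

instance : Preadditive (PreMont N) where
  homGroup V W := inferInstanceAs (AddCommGroup (homs V W))
  add_comp _ _ _ φ φ' ψ :=
    Subtype.ext (funext fun t => Preadditive.add_comp _ _ _ (φ.1 t) (φ'.1 t) (ψ.1 t))
  comp_add _ _ _ φ ψ ψ' :=
    Subtype.ext (funext fun t => Preadditive.comp_add _ _ _ (φ.1 t) (ψ.1 t) (ψ'.1 t))

/-- The component `φ(t) : V(t) ⟶ W(t)` of a morphism. -/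
def app {V W : PreMont N} (φ : V ⟶ W) (t : ℝ) : V.obj t ⟶ W.obj t := φ.1 t

end PreMont

/-- Two morphisms of premontelian modules are equivalent if they agree for small `t > 0`. -/
def germRel (N : FiniteVN A) : HomRel (PreMont N) := fun _ _ φ ψ =>
  ∃ ε : ℝ, 0 < ε ∧ ∀ t, 0 < t → t < ε → PreMont.app φ t = PreMont.app ψ t

instance (N : FiniteVN A) : Congruence (germRel N) where
  equivalence :=
    { refl := fun φ => ⟨1, one_pos, fun _ _ _ => rfl⟩
      symm := by
        rintro φ ψ ⟨ε, hε, h⟩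
        exact ⟨ε, hε, fun t h0 h1 => (h t h0 h1).symm⟩
      trans := by
        rintro φ ψ χ ⟨ε, hε, h⟩ ⟨δ, hδ, k⟩
        exact ⟨min ε δ, lt_min hε hδ, fun t h0 h1 =>
          (h t h0 (h1.trans_le (min_le_left _ _))).trans
            (k t h0 (h1.trans_le (min_le_right _ _)))⟩ }
  comp_left := by
    rintro U V W φ ψ ψ' ⟨ε, hε, h⟩
    exact ⟨ε, hε, fun t h0 h1 => congrArg (fun z => PreMont.app φ t ≫ z) (h t h0 h1)⟩
  comp_right := by
    rintro U V W φ φ' ψ ⟨ε, hε, h⟩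
    exact ⟨ε, hε, fun t h0 h1 => congrArg (fun z => z ≫ PreMont.app ψ t) (h t h0 h1)⟩

lemma germRel_add (N : FiniteVN A) ⦃V W : PreMont N⦄ (φ₁ φ₂ ψ₁ ψ₂ : V ⟶ W)
    (hφ : germRel N φ₁ φ₂) (hψ : germRel N ψ₁ ψ₂) : germRel N (φ₁ + ψ₁) (φ₂ + ψ₂) := by
  obtain ⟨ε, hε, h⟩ := hφ
  obtain ⟨δ, hδ, k⟩ := hψ
  exact ⟨min ε δ, lt_min hε hδ, fun t h0 h1 => congrArg₂ (· + ·)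
    (h t h0 (h1.trans_le (min_le_left _ _))) (k t h0 (h1.trans_le (min_le_right _ _)))⟩

/-- The category of montelian modules: morphisms are germs at `0` of morphisms of premontelian
modules. Premontelian modules with the same germ at `0` are canonically isomorphic in it. -/
abbrev Mont (N : FiniteVN A) := Quotient (germRel N)

instance (N : FiniteVN A) : Preadditive (Mont N) := Quotient.preadditive _ (germRel_add N)

instance (N : FiniteVN A) : (Quotient.functor (germRel N)).Additive :=
  Quotient.functor_additive _ (germRel_add N)

/-- A representative of a germ of morphisms. -/
def rep {N : FiniteVN A} {V W : Mont N} (φ : V ⟶ W) : V.as ⟶ W.as :=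
  (Quotient.functor (germRel N)).preimage φ

lemma rep_map {N : FiniteVN A} {V W : PreMont N} (φ : V ⟶ W) :
    germRel N (rep ((Quotient.functor (germRel N)).map φ)) φ :=
  (Quotient.functor_map_eq_iff (germRel N) _ _).1 ((Quotient.functor (germRel N)).map_preimage _)

/-- The premontelian module with constant value a module of finite type. -/
def constObj {N : FiniteVN A} (L : Pf N) : PreMont N where
  t₀ := 1
  t₀_pos := one_pos
  obj _ := L.obj
  ρ _ _ := 𝟙 L.obj
  ρ_self _ _ _ := rfl
  ρ_comp _ _ _ _ _ _ _ := Category.id_comp _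
  ρ_compact _ _ _ _ _ := HilbMod.isACompact_of_finiteType L.property _ fun x => ⟨x, rfl⟩

/-- The functor from `P_f(A)` to premontelian modules given by constant families. -/
def constFunctor (N : FiniteVN A) : Pf N ⥤ PreMont N where
  obj L := constObj L
  map f := ⟨fun _ => f.hom, 1, one_pos, fun _ _ _ _ _ =>
    (Category.comp_id f.hom).trans (Category.id_comp f.hom).symm⟩

/-- The functor from `P_f(A)` to montelian modules given by constant families. -/
def pfToMont (N : FiniteVN A) : Pf N ⥤ Mont N :=
  constFunctor N ⋙ Quotient.functor (germRel N)

instance (N : FiniteVN A) : (constFunctor N).Additive where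
  map_add := rfl

instance (N : FiniteVN A) : (pfToMont N).Additive :=
  inferInstanceAs (constFunctor N ⋙ Quotient.functor (germRel N)).Additive

instance (N : FiniteVN A) : (pfToEf N).Additive where
  map_add {X Y f g} := by
    apply ObjectProperty.hom_ext
    exact (ObjectProperty.ι _ ⋙ arrowOfHilb N ⋙ Quotient.functor (eRel N)).map_add

/-! ### Cohomology of complexes of montelian modules and qi-morphisms -/

section Cohomology

variable {N : FiniteVN A}

/-- The product of the `W(s)` for `0 < s < t`. -/
abbrev Below (W : Mont N) (t : ℝ) : Type u := ∀ s : Set.Ioo (0 : ℝ) t, W.as.obj s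

/-- `W_*(t)`, the projective limit of the `W(s)` for `0 < s < t`. -/
def projLim (W : Mont N) (t : ℝ) : Submodule A (Below W t) where
  carrier := {x | ∀ s s' : Set.Ioo (0 : ℝ) t, s' ≤ s → HilbMod.toLin (W.as.ρ s s') (x s) = x s'}
  zero_mem' s s' _ := by simp
  add_mem' {x y} hx hy s s' h := by simp [hx s s' h, hy s s' h]
  smul_mem' a x hx s s' h := by simp [hx s s' h]

/-- The map `(x_s)_{s < t} ↦ (φ(s) x_s)_{s < t'}` between products given by a germ `φ` and
`t' ≤ t`. For small `t` it does not depend on the representative of the germ, and its restriction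
to `V_*(t)` is the map `V_*(t) → W_*(t')` induced by `φ`. -/
def prodMap {V W : Mont N} (φ : V ⟶ W) {t t' : ℝ} (h : t' ≤ t) : Below V t →ₗ[A] Below W t' :=
  LinearMap.pi fun s => HilbMod.toLin (PreMont.app (rep φ) s) ∘ₗ
    LinearMap.proj (φ := fun s : Set.Ioo (0 : ℝ) t => (V.as.obj s : Type u))
      ⟨s.1, s.2.1, s.2.2.trans_le h⟩

/-- The cocycles `Z_*^i(t, F)`. -/
def cocycles (F : CochainComplex (Mont N) ℤ) (i : ℤ) (t : ℝ) : Submodule A (Below (F.X i) t) :=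
  projLim (F.X i) t ⊓ LinearMap.ker (prodMap (F.d i (i + 1)) (le_refl t))

/-- The coboundaries `B_*^i(t, F)`. -/
def coboundaries (F : CochainComplex (Mont N) ℤ) (i : ℤ) (t : ℝ) : Submodule A (Below (F.X i) t) :=
  (projLim (F.X (i - 1)) t).map (prodMap (F.d (i - 1) i) (le_refl t))

/-- The cohomology `H_*^i(t, F)` (significant for small `t`, in which case the coboundaries are
contained in the cocycles). -/
abbrev Coh (F : CochainComplex (Mont N) ℤ) (i : ℤ) (t : ℝ) : Type u :=
  cocycles F i t ⧸ (coboundaries F i t).submoduleOf (cocycles F i t)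

/-- The morphism of complexes `σ` maps cocycles to cocycles and coboundaries to coboundaries at the
parameters `t' ≤ t`; this is automatic for small `t`. -/
structure Induces {F G : CochainComplex (Mont N) ℤ} (σ : F ⟶ G) (i : ℤ) (t t' : ℝ) : Prop where
  le : t' ≤ t
  cocycles : cocycles F i t ≤ (cocycles G i t').comap (prodMap (σ.f i) le)
  coboundaries : coboundaries F i t ≤ (coboundaries G i t').comap (prodMap (σ.f i) le)

/-- The map `H_*^i(t, F) → H_*^i(t', G)` induced by `σ`. -/
def cohMap {F G : CochainComplex (Mont N) ℤ} (σ : F ⟶ G) (i : ℤ) (t t' : ℝ)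
    (h : Induces σ i t t') : Coh F i t →ₗ[A] Coh G i t' :=
  Submodule.mapQ _ _ ((prodMap (σ.f i) h.le).restrict h.cocycles)
    (fun x hx => h.coboundaries (show (x : Below (F.X i) t) ∈ Montel.coboundaries F i t from hx))

/-- `P t t'` holds for all small enough `0 < t' ≤ t`. -/
def ForSmall (P : ℝ → ℝ → Prop) : Prop :=
  ∃ ε : ℝ, 0 < ε ∧ ∀ t t', 0 < t' → t' ≤ t → t < ε → P t t'

/-- `σ` is a qi-morphism of order `q`: for all small `t' ≤ t` the induced map
`H_*^i(t, F) → H_*^i(t', G)` is an isomorphism in degrees `i > q` and is surjective for `i = q`. -/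
def IsQiOfOrder {F G : CochainComplex (Mont N) ℤ} (σ : F ⟶ G) (q : ℤ) : Prop :=
  (∀ i, q < i → ForSmall fun t t' =>
    ∃ h : Induces σ i t t', Function.Bijective (cohMap σ i t t' h)) ∧
  ForSmall fun t t' => ∃ h : Induces σ q t t', Function.Surjective (cohMap σ q t t' h)

/-- `σ` is a qi-morphism. -/
def IsQi {F G : CochainComplex (Mont N) ℤ} (σ : F ⟶ G) : Prop := ∀ q, IsQiOfOrder σ q

/-- The complex `F` is qhtf: its identity is a qi-morphism. -/
def IsQhtf (F : CochainComplex (Mont N) ℤ) : Prop := IsQi (𝟙 F)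

end Cohomology

/-! ### Bounded and bounded above homotopy categories -/

/-- The symbols `b` and `-`. -/
inductive Bound
  | b
  | minus

/-- A complex is bounded (for `b`), resp. bounded above (for `-`). -/
def IsBounded {C : Type*} [Category C] [Preadditive C] :
    Bound → CochainComplex C ℤ → Prop
  | .b, F => ∃ m n : ℤ, ∀ k, k < m ∨ n < k → IsZero (F.X k)
  | .minus, F => ∃ n : ℤ, ∀ k, n < k → IsZero (F.X k)

/-- The homotopy category `K^i(C)` of bounded, resp. bounded above, complexes. -/
abbrev K (C : Type*) [Category C] [Preadditive C] (i : Bound) :=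
  ObjectProperty.FullSubcategory (C := HomotopyCategory C (ComplexShape.up ℤ))
    (fun F => IsBounded i F.as)

lemma IsBounded.map {C D : Type*} [Category C] [Preadditive C] [Category D] [Preadditive D]
    (Φ : C ⥤ D) [Φ.Additive] (i : Bound) (F : CochainComplex C ℤ) (h : IsBounded i F) :
    IsBounded i ((Φ.mapHomologicalComplex (ComplexShape.up ℤ)).obj F) := by
  cases i with
  | b => obtain ⟨m, n, h⟩ := h; exact ⟨m, n, fun k hk => Φ.map_isZero (h k hk)⟩
  | minus => obtain ⟨n, h⟩ := h; exact ⟨n, fun k hk => Φ.map_isZero (h k hk)⟩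

/-- The functor `K^i(C) ⥤ K^i(D)` induced by an additive functor. -/
def mapK {C D : Type*} [Category C] [Preadditive C] [Category D] [Preadditive D]
    (Φ : C ⥤ D) [Φ.Additive] (i : Bound) : K C i ⥤ K D i :=
  ObjectProperty.lift _ (ObjectProperty.ι _ ⋙ Φ.mapHomotopyCategory (ComplexShape.up ℤ))
    (fun F => IsBounded.map Φ i F.obj.as F.property)

/-- A preadditive category is abelian. -/
class IsAbelian (C : Type*) [Category C] [Preadditive C] : Prop
    extends IsNormalMonoCategory C, IsNormalEpiCategory C where
  has_finite_products : HasFiniteProducts C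
  has_kernels : HasKernels C
  has_cokernels : HasCokernels C

/-- The corresponding structure of Mathlib. -/
@[reducible]
def IsAbelian.abelian (C : Type*) [Category C] [Preadditive C] [h : IsAbelian C] : Abelian C where
  has_finite_products := h.has_finite_products
  has_kernels := h.has_kernels
  has_cokernels := h.has_cokernels

instance (C : Type*) [Category C] [Preadditive C] [IsAbelian C] : CategoryWithHomology C :=
  letI := IsAbelian.abelian C
  inferInstance

/-- The quasi-isomorphisms of `K^i(C)`, for `C` abelian. -/
def quasiIsos (C : Type*) [Category C] [Preadditive C] [IsAbelian C] (i : Bound) :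
    MorphismProperty (K C i) :=
  (HomotopyCategory.quasiIso C (ComplexShape.up ℤ)).inverseImage (ObjectProperty.ι _)

/-- The derived category `D^i(C)`: the localization of `K^i(C)` at the quasi-isomorphisms. -/
abbrev D (C : Type*) [Category C] [Preadditive C] [IsAbelian C] (i : Bound) :=
  (quasiIsos C i).Localization

section Functors

variable (N : FiniteVN A) (i : Bound)

/-- The natural functor `μ^i : K^i(P_f(A)) ⥤ D^i(E_f(A))`. -/
def mu [IsAbelian (Ef N)] : K (Pf N) i ⥤ D (Ef N) i :=
  mapK (pfToEf N) i ⋙ (quasiIsos (Ef N) i).Q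

/-- The full subcategory of `K^i` of montelian modules on the qhtf complexes. -/
abbrev KQhtf := ObjectProperty.FullSubcategory (C := K (Mont N) i) (fun F => IsQhtf F.obj.as)

variable {N} in
lemma isQhtf_const (L : CochainComplex (Pf N) ℤ) :
    IsQhtf (((pfToMont N).mapHomologicalComplex (ComplexShape.up ℤ)).obj L) := by
  set F := ((pfToMont N).mapHomologicalComplex (ComplexShape.up ℤ)).obj L with hF
  have key : ∀ k, ForSmall fun t t' => ∃ h : Induces (𝟙 F) k t t',
      Function.Bijective (cohMap (𝟙 F) k t t' h) := by
    intro k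
    obtain ⟨ε₁, h₁, H₁⟩ := rep_map ((constFunctor N).map (L.d k (k + 1)))
    obtain ⟨ε₂, h₂, H₂⟩ := rep_map ((constFunctor N).map (L.d (k - 1) k))
    obtain ⟨ε₃, h₃, H₃⟩ := rep_map (𝟙 (constObj (L.X k)))
    refine ⟨min ε₁ (min ε₂ ε₃), by positivity, fun t t' h0 hle hlt => ?_⟩
    have l₁ : t < ε₁ := hlt.trans_le (min_le_left _ _)
    have l₂ : t < ε₂ := hlt.trans_le ((min_le_right _ _).trans (min_le_left _ _))
    have l₃ : t < ε₃ := hlt.trans_le ((min_le_right _ _).trans (min_le_right _ _))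
    have P₁ : ∀ r (_ : r ≤ t) (x : Below (F.X k) r) (s : Set.Ioo (0 : ℝ) r),
        prodMap (F.d k (k + 1)) (le_refl r) x s = HilbMod.toLin (L.d k (k + 1)).hom (x s) :=
      fun r hr x s => congrArg (fun f => HilbMod.toLin f (x s))
        (H₁ s s.2.1 (s.2.2.trans_le (hr.trans l₁.le)))
    have P₂ : ∀ r (_ : r ≤ t) (x : Below (F.X (k - 1)) r) (s : Set.Ioo (0 : ℝ) r),
        prodMap (F.d (k - 1) k) (le_refl r) x s = HilbMod.toLin (L.d (k - 1) k).hom (x s) :=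
      fun r hr x s => congrArg (fun f => HilbMod.toLin f (x s))
        (H₂ s s.2.1 (s.2.2.trans_le (hr.trans l₂.le)))
    have P₃ : ∀ (x : Below (F.X k) t) (s : Set.Ioo (0 : ℝ) t'),
        prodMap ((𝟙 F : F ⟶ F).f k) hle x s = x ⟨s.1, s.2.1, s.2.2.trans_le hle⟩ :=
      fun x s => congrArg (fun f => HilbMod.toLin f (x ⟨s.1, s.2.1, s.2.2.trans_le hle⟩))
        (H₃ s s.2.1 (s.2.2.trans_le (hle.trans l₃.le)))
    have C : ∀ (j : ℤ) (r : ℝ) (x : Below (F.X j) r), x ∈ projLim (F.X j) r →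
        ∀ s s' : Set.Ioo (0 : ℝ) r, (show (L.X j).obj from x s) = (show (L.X j).obj from x s') := by
      intro j r x hx s s'
      rcases le_total s' s with h | h
      · exact hx s s' h
      · exact (hx s' s h).symm
    let m : Set.Ioo (0 : ℝ) t' := ⟨t' / 2, by constructor <;> linarith⟩
    have hInd : Induces (𝟙 F) k t t' := by
      refine ⟨hle, fun x hx => ⟨?_, ?_⟩, ?_⟩
      · intro s s' _
        rw [P₃, P₃]
        exact C k t x hx.1 _ _
      · refine LinearMap.mem_ker.2 (funext fun s => ?_)
        rw [P₁ t' hle, P₃, ← P₁ t le_rfl, LinearMap.mem_ker.1 hx.2]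
        rfl
      · rintro _ ⟨y, hy, rfl⟩
        refine ⟨fun s => y ⟨s.1, s.2.1, s.2.2.trans_le hle⟩, ?_, ?_⟩
        · intro s s' h
          exact C (k - 1) t y hy _ _
        · funext s
          rw [P₂ t' hle, P₃, P₂ t le_rfl]
    refine ⟨hInd, (injective_iff_map_eq_zero _).2 ?_, ?_⟩
    · intro z hz
      obtain ⟨z, rfl⟩ := Submodule.Quotient.mk_surjective _ z
      rw [Submodule.Quotient.mk_eq_zero]
      have hz' := (Submodule.Quotient.mk_eq_zero _).1 hz
      obtain ⟨y, hy, hyz⟩ := hz'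
      have hyz' : ∀ s, prodMap (F.d (k - 1) k) (le_refl t') y s =
          prodMap ((𝟙 F : F ⟶ F).f k) hle z.1 s := fun s => congrFun hyz s
      refine ⟨fun _ => y m, fun s s' h => rfl, funext fun s => ?_⟩
      refine (P₂ t le_rfl _ s).trans ?_
      have := hyz' m
      rw [P₂ t' hle, P₃] at this
      exact this.trans (C k t z.1 z.2.1 _ _)
    · intro w
      obtain ⟨w, rfl⟩ := Submodule.Quotient.mk_surjective _ w
      refine ⟨Submodule.Quotient.mk ⟨fun _ => w.1 m, fun s s' h => rfl, ?_⟩, ?_⟩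
      · refine LinearMap.mem_ker.2 (funext fun s => ?_)
        refine (P₁ t le_rfl _ s).trans ?_
        have := congrFun (LinearMap.mem_ker.1 w.2.2) m
        rw [P₁ t' hle] at this
        exact this
      · refine congrArg Submodule.Quotient.mk (Subtype.ext (funext fun s => ?_))
        exact (P₃ _ s).trans (C k t' w.1 w.2.1 _ _)
  intro q
  refine ⟨fun k _ => key k, ?_⟩
  obtain ⟨ε, hε, h⟩ := key q
  exact ⟨ε, hε, fun t t' h0 h1 h2 => (h t t' h0 h1 h2).imp fun _ hb => hb.2⟩

/-- The functor `ν^i` from `K^i(P_f(A))` to the homotopy category of qhtf complexes. -/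
def nu : K (Pf N) i ⥤ KQhtf N i :=
  ObjectProperty.lift _ (mapK (pfToMont N) i) (fun L => isQhtf_const L.obj.as)

/-- The homotopy classes of qi-morphisms. -/
def qiMorphisms : MorphismProperty (KQhtf N i) := fun F G f =>
  ∃ σ : F.obj.obj.as ⟶ G.obj.obj.as, IsQi σ ∧
    (HomotopyCategory.quotient (Mont N) (ComplexShape.up ℤ)).map σ = f.hom.hom

/-- The localization of the homotopy category of qhtf complexes at the qi-morphisms. -/
abbrev KQhtfLoc := (qiMorphisms N i).Localization

/-- The localization functor `ξ^i`. -/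
def xi : KQhtf N i ⥤ KQhtfLoc N i := (qiMorphisms N i).Q

/-- The functor `η^i = ξ^i ν^i (μ^i)⁻¹`, where `(μ^i)⁻¹` is a quasi-inverse of the equivalence
`μ^i`. -/
def eta [IsAbelian (Ef N)] [(mu N i).IsEquivalence] : D (Ef N) i ⥤ KQhtfLoc N i :=
  (mu N i).inv ⋙ nu N i ⋙ xi N i

end Functors

end Montel

end

/-!
The functors `μ` and `ξν` from `K(P_f(A))` are both shown to be equivalences; then so is
`η = μ⁻¹ ξν`. In each case a fully faithful functor `Φ` from `P_f(A)` to an additive category `C`,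
which is `E_f(A)` or the category of montelian modules, induces a fully faithful functor between the
homotopy categories, and the target of the latter is localized at some class of morphisms. A
coreflection argument (`isEquivalence_comp_Q`) reduces the equivalence to two statements:

* a morphism of the class induces bijections on morphisms from complexes of `P_f(A)`. As the
  complexes are bounded above this holds as soon as morphisms from objects `Φ L` to the cocycles of
  the mapping cone factor through the differential (`comp_quotient_map_bijective`);
* every complex of `C` (qhtf, in the montelian case) receives a morphism of the class from a complex
  of `P_f(A)`. This is built by descending recursion on the degree (`exists_resolution`); over a
  bounded complex the recursion is stopped at the kernel of a differential, since `P_f(A)` has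
  kernels.

*The category `E_f(A)`.* Every object of it is the cokernel of a morphism of `P_f(A)`: the source of
`e : E₁ ⟶ E₂` may be replaced by the orthogonal complement of the kernel of `e`, which is of finite
type by polar decomposition (`HilbMod.FiniteType.of_injective`). Since `P_f(A)` has kernels,
`E_f(A)` is its category of finitely presented functors: it is abelian and the objects of `P_f(A)`
are projective in it (`IsFreyd.isAbelian`, `IsFreyd.projective`). So both statements are the usual
facts on projective resolutions.

*Montelian modules.* The role of cohomology is played by the cohomology of the germs at `0` of
sections. Between qhtf complexes the qi-morphisms are the morphisms that are isomorphisms for it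
(`IsQi.isCohIso`, `IsCohIso.isQi`), because a qhtf complex has over a small interval `]0, t[` the
same cohomology as its germs (`IsQhtf.eventually`). Two arguments of functional analysis replace
projectivity and finiteness.

* If every vector of a module `E` solves one of countably many lifting problems, one of these
  problems is solved by a morphism on `E` (`HilbMod.exists_lift_of_forall`): by the Baire category
  theorem one of countably many morphisms whose images cover `E` has an adjoint that is bounded
  below, hence a section. Applied to the levels `s n → 0` this lifts morphisms from constant modules
  (`liftsIn_const`).
* Let `Z(s)` be the kernel, at the level `s`, of the differential of the cone of the part of the
  resolution that is already built. Every vector of `Z(s)` is congruent to one of `Z(t)`, for some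
  `t > s`, modulo coboundaries on smaller intervals; as `Z(t) ⟶ Z(s)` is compact, a module of finite
  type suffices to generate `Z(s)` modulo coboundaries (`HilbMod.exists_finiteType_generators`), by
  inversion of `1 - T` for an operator `T` of norm `< 1`.
-/


noncomputable section

namespace Montel

variable {A : Type u} [Ring A] [Algebra ℂ A] [StarRing A] [StarModule ℂ A] {N : FiniteVN A}

namespace HilbMod

/-! ### Operators commuting with the action -/

lemma hom_ext {V W : HilbMod N} {f g : V ⟶ W} (h : ∀ x, toCLM f x = toCLM g x) : f = g :=
  Subtype.ext (ContinuousLinearMap.ext h)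

/-- A morphism from an equivariant bounded operator. -/
def mkHom {V W : HilbMod N} (f : V →L[ℂ] W) (h : ∀ (a : A) (x : V), f (a • x) = a • f x) :
    V ⟶ W := ⟨f, h⟩

@[simp] lemma toCLM_mkHom {V W : HilbMod N} (f : V →L[ℂ] W) (h) : toCLM (mkHom f h) = f := rfl
@[simp] lemma toCLM_comp {U V W : HilbMod N} (f : U ⟶ V) (g : V ⟶ W) (x : U) :
    toCLM (f ≫ g) x = toCLM g (toCLM f x) := rfl
@[simp] lemma toCLM_id {V : HilbMod N} (x : V) : toCLM (𝟙 V) x = x := rfl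
@[simp] lemma toCLM_sub {V W : HilbMod N} (f g : V ⟶ W) (x : V) :
    toCLM (f - g) x = toCLM f x - toCLM g x := by
  rw [sub_eq_add_neg, sub_eq_add_neg]; rfl

lemma toCLM_smul {V W : HilbMod N} (f : V ⟶ W) (a : A) (x : V) :
    toCLM f (a • x) = a • toCLM f x := f.2 a x

lemma smul_comm' (W : HilbMod N) (a : A) (c : ℂ) (x : W) : a • c • x = c • a • x := by
  have h : ∀ y : W, c • y = (c • (1 : A)) • y := fun y => by rw [smul_assoc, one_smul]
  rw [h x, h (a • x), smul_smul, smul_smul, mul_smul_comm, smul_mul_assoc, mul_one, one_mul]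

/-- An element of the algebra acts by a bounded operator, by the closed graph theorem. -/
def actL (W : HilbMod N) (a : A) : W →L[ℂ] W where
  toFun x := a • x
  map_add' := smul_add a
  map_smul' c x := smul_comm' W a c x
  cont := by
    let f : W →ₗ[ℂ] W :=
      { toFun := fun x => a • x
        map_add' := smul_add a
        map_smul' := fun c x => smul_comm' W a c x }
    refine LinearMap.continuous_of_seq_closed_graph (g := f) fun v x y hv hy => ?_
    refine ext_inner_right ℂ fun z => ?_
    have h₁ := hy.inner (tendsto_const_nhds (x := z)) (𝕜 := ℂ)
    have h₂ := hv.inner (tendsto_const_nhds (x := star a • z)) (𝕜 := ℂ)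
    refine tendsto_nhds_unique h₁ ?_
    have : (fun n => Inner.inner ℂ ((f ∘ v) n) z) = fun n => Inner.inner ℂ (v n) (star a • z) :=
      funext fun n => W.smul_inner a (v n) z
    rw [this]
    exact (W.smul_inner a x z).symm ▸ h₂

/-- The adjoint morphism. -/
def adj {V W : HilbMod N} (f : V ⟶ W) : W ⟶ V :=
  mkHom (ContinuousLinearMap.adjoint (toCLM f)) fun a x => by
    refine ext_inner_right ℂ fun z => ?_
    rw [ContinuousLinearMap.adjoint_inner_left, W.smul_inner, V.smul_inner,
      ContinuousLinearMap.adjoint_inner_left, toCLM_smul]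

lemma adj_inner {V W : HilbMod N} (f : V ⟶ W) (x : W) (y : V) :
    Inner.inner ℂ (toCLM (adj f) x) y = Inner.inner ℂ x (toCLM f y) :=
  ContinuousLinearMap.adjoint_inner_left _ _ _

lemma comp_adj_of_isometry {V W : HilbMod N} (f : V ⟶ W) (hf : ∀ x, ‖toCLM f x‖ = ‖x‖) :
    f ≫ adj f = 𝟙 V := by
  refine hom_ext fun x => ext_inner_right ℂ fun y => ?_
  rw [toCLM_comp, adj_inner]
  exact (LinearIsometry.mk (toCLM f).toLinearMap hf).inner_map_map x y

/-! ### Isometric embeddings, submodules and direct sums -/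

lemma _root_.Montel.EmbedsIn.of_isometry {V W : HilbMod N} (f : V ⟶ W)
    (hf : ∀ x, ‖toCLM f x‖ = ‖x‖) {ι : Type u} (h : EmbedsIn N W ι) : EmbedsIn N V ι := by
  obtain ⟨j, hj⟩ := h
  refine ⟨j.comp (LinearIsometry.mk (toCLM f).toLinearMap hf), fun a x k => ?_⟩
  have := hj a (toCLM f x) k
  rw [← toCLM_smul] at this
  exact this

lemma FiniteType.of_isometry {V W : HilbMod N} (f : V ⟶ W) (hf : ∀ x, ‖toCLM f x‖ = ‖x‖)
    (h : W.FiniteType) : V.FiniteType := by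
  obtain ⟨ι, hι, h⟩ := h
  exact ⟨ι, hι, h.of_isometry f hf⟩

/-- A closed submodule of a projective Hilbert module. -/
def sub (W : HilbMod N) (S : Submodule A W) (hS : IsClosed (S : Set W)) : HilbMod N :=
  haveI hc : CompleteSpace (S.restrictScalars ℂ) :=
    (show IsClosed ((S.restrictScalars ℂ : Submodule ℂ W) : Set W) from hS).completeSpace_coe
  letI : Module A (S.restrictScalars ℂ) := inferInstanceAs (Module A S)
  { carrier := S.restrictScalars ℂ
    complete := hc
    module := inferInstanceAs (Module A S)
    tower := ⟨fun c a x => Subtype.ext (smul_assoc c a (x : W))⟩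
    smul_inner := fun a x y => W.smul_inner a x y
    embeds := by
      obtain ⟨ι, j, hj⟩ := W.embeds
      exact ⟨ι, j.comp (S.restrictScalars ℂ).subtypeₗᵢ, fun a x k => hj a x k⟩ }

/-- The inclusion of a closed submodule. -/
def subι (W : HilbMod N) (S : Submodule A W) (hS : IsClosed (S : Set W)) : sub W S hS ⟶ W :=
  mkHom (V := sub W S hS) (S.restrictScalars ℂ).subtypeL fun _ _ => rfl

lemma subι_mem {W : HilbMod N} {S : Submodule A W} {hS : IsClosed (S : Set W)}
    (x : sub W S hS) : toCLM (subι W S hS) x ∈ S := x.2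

lemma subι_injective {W : HilbMod N} {S : Submodule A W} (hS : IsClosed (S : Set W)) :
    Function.Injective (toCLM (subι W S hS)) := Subtype.val_injective

/-- The corestriction of a morphism to a closed submodule. -/
def subLift {V W : HilbMod N} (S : Submodule A W) (hS : IsClosed (S : Set W)) (f : V ⟶ W)
    (h : ∀ x, toCLM f x ∈ S) : V ⟶ sub W S hS :=
  mkHom (W := sub W S hS) ((toCLM f).codRestrict (S.restrictScalars ℂ) h)
    fun a x => Subtype.ext (toCLM_smul f a x)

/-- The kernel of a morphism as a closed submodule. -/
def ker {V W : HilbMod N} (f : V ⟶ W) : HilbMod N :=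
  sub V (LinearMap.ker (toLin f)) ((toCLM f).isClosed_ker)

/-- The inclusion of the kernel. -/
def kerι {V W : HilbMod N} (f : V ⟶ W) : ker f ⟶ V := subι _ _ _

@[simp] lemma kerι_comp {V W : HilbMod N} (f : V ⟶ W) : kerι f ≫ f = 0 :=
  hom_ext fun x => subι_mem x

/-- The factorization through the kernel. -/
def kerLift {U V W : HilbMod N} (f : V ⟶ W) (g : U ⟶ V) (h : g ≫ f = 0) : U ⟶ ker f :=
  subLift _ _ g fun x => congrArg (fun k => toCLM k x) h

@[simp] lemma kerLift_kerι {U V W : HilbMod N} (f : V ⟶ W) (g : U ⟶ V) (h : g ≫ f = 0) :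
    kerLift f g h ≫ kerι f = g := rfl

lemma kerι_injective {V W : HilbMod N} (f : V ⟶ W) : Function.Injective (toCLM (kerι f)) :=
  Subtype.val_injective

lemma exists_kerι {V W : HilbMod N} (f : V ⟶ W) {x : V} (hx : toCLM f x = 0) :
    ∃ y, toCLM (kerι f) y = x := ⟨⟨x, hx⟩, rfl⟩

lemma FiniteType.ker {V W : HilbMod N} (f : V ⟶ W) (h : V.FiniteType) : (ker f).FiniteType :=
  h.of_isometry (kerι f) fun _ => rfl

end HilbMod

lemma hasSum_norm_sq {ι : Type u} {t : PreTrace A} (x : lp (fun _ : ι => Standard t) 2) :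
    HasSum (fun k => ‖x k‖ ^ 2) (‖x‖ ^ 2) := by
  have := lp.hasSum_norm (p := 2) (by simp) x
  simpa using this

lemma EmbedsIn.prod {V W : HilbMod N} {ι κ : Type u} (hV : EmbedsIn N V ι)
    (hW : EmbedsIn N W κ) :
    ∃ j : WithLp 2 (V × W) →ₗᵢ[ℂ] lp (fun _ : ι ⊕ κ => Standard N.toPreTrace) 2,
    ∀ (a : A) (x : WithLp 2 (V × W)) (k : ι ⊕ κ),
      j (WithLp.toLp 2 (a • x.fst, a • x.snd)) k = a • j x k := by
  obtain ⟨j, hj⟩ := hV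
  obtain ⟨j', hj'⟩ := hW
  let F : WithLp 2 (V × W) → ι ⊕ κ → Standard N.toPreTrace :=
    fun x => Sum.elim (fun k => j x.fst k) (fun k => j' x.snd k)
  have hF : ∀ x, HasSum (fun k => ‖F x k‖ ^ 2) (‖x.fst‖ ^ 2 + ‖x.snd‖ ^ 2) := by
    intro x
    have h₁ := hasSum_norm_sq (j x.fst)
    have h₂ := hasSum_norm_sq (j' x.snd)
    rw [LinearIsometry.norm_map] at h₁ h₂
    exact HasSum.add_isCompl (f := fun k => ‖F x k‖ ^ 2) Set.isCompl_range_inl_range_inr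
      ((Function.Injective.hasSum_range_iff (f := fun k => ‖F x k‖ ^ 2) Sum.inl_injective).2 h₁)
      ((Function.Injective.hasSum_range_iff (f := fun k => ‖F x k‖ ^ 2) Sum.inr_injective).2 h₂)
  have hm : ∀ x, Memℓp (F x) 2 := fun x => memℓp_gen (by simpa using (hF x).summable)
  let J : WithLp 2 (V × W) →ₗ[ℂ] lp (fun _ : ι ⊕ κ => Standard N.toPreTrace) 2 :=
    { toFun := fun x => ⟨F x, hm x⟩
      map_add' := fun x y => by
        ext k; rcases k with k | k <;> simp [F] <;> rfl
      map_smul' := fun c x => by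
        ext k; rcases k with k | k <;> simp [F] }
  refine ⟨⟨J, fun x => ?_⟩, fun a x k => ?_⟩
  · have h := (hasSum_norm_sq (J x)).unique (hF x)
    rw [← WithLp.prod_norm_sq_eq_of_L2] at h
    exact (sq_eq_sq₀ (norm_nonneg _) (norm_nonneg _)).1 h
  · rcases k with k | k
    · exact hj a x.fst k
    · exact hj' a x.snd k

namespace HilbMod

/-- The Hilbert direct sum. -/
def prod (V W : HilbMod N) : HilbMod N where
  carrier := WithLp 2 (V × W)
  module := Module.compHom (WithLp 2 (V × W)) (RingHom.id A)
  tower := ⟨fun c a x => by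
    refine WithLp.ofLp_injective 2 (Prod.ext ?_ ?_)
    · exact smul_assoc c a x.fst
    · exact smul_assoc c a x.snd⟩
  smul_inner a x y := by
    rw [WithLp.prod_inner_apply, WithLp.prod_inner_apply]
    exact congrArg₂ (· + ·) (V.smul_inner a x.fst y.fst) (W.smul_inner a x.snd y.snd)
  embeds := by
    obtain ⟨ι, hV⟩ := V.embeds
    obtain ⟨κ, hW⟩ := W.embeds
    obtain ⟨j, hj⟩ := EmbedsIn.prod hV hW
    exact ⟨ι ⊕ κ, j, hj⟩

lemma FiniteType.prod {V W : HilbMod N} (hV : V.FiniteType) (hW : W.FiniteType) :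
    (prod V W).FiniteType := by
  obtain ⟨ι, hι, hV⟩ := hV
  obtain ⟨κ, hκ, hW⟩ := hW
  obtain ⟨j, hj⟩ := EmbedsIn.prod hV hW
  exact ⟨ι ⊕ κ, inferInstance, j, hj⟩

/-- The first projection of a direct sum. -/
def fst (V W : HilbMod N) : prod V W ⟶ V :=
  mkHom (V := prod V W) (WithLp.fstL 2 ℂ V W) fun _ _ => rfl

/-- The second projection of a direct sum. -/
def snd (V W : HilbMod N) : prod V W ⟶ W :=
  mkHom (V := prod V W) (WithLp.sndL 2 ℂ V W) fun _ _ => rfl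

/-- The morphism to a direct sum with given components. -/
def pair {U V W : HilbMod N} (f : U ⟶ V) (g : U ⟶ W) : U ⟶ prod V W :=
  mkHom (W := prod V W)
    ((WithLp.prodContinuousLinearEquiv 2 ℂ V W).symm.toContinuousLinearMap.comp
      ((toCLM f).prod (toCLM g)))
    fun a x => by
      refine WithLp.ofLp_injective 2 (Prod.ext ?_ ?_)
      · exact toCLM_smul f a x
      · exact toCLM_smul g a x

@[simp] lemma pair_fst {U V W : HilbMod N} (f : U ⟶ V) (g : U ⟶ W) : pair f g ≫ fst V W = f := rfl
@[simp] lemma pair_snd {U V W : HilbMod N} (f : U ⟶ V) (g : U ⟶ W) : pair f g ≫ snd V W = g := rfl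

lemma prod_ext {V W : HilbMod N} {x y : prod V W} (h₁ : toCLM (fst V W) x = toCLM (fst V W) y)
    (h₂ : toCLM (snd V W) x = toCLM (snd V W) y) : x = y :=
  WithLp.ofLp_injective 2 (Prod.ext h₁ h₂)

lemma hom_prod_ext {U V W : HilbMod N} {f g : U ⟶ prod V W} (h₁ : f ≫ fst V W = g ≫ fst V W)
    (h₂ : f ≫ snd V W = g ≫ snd V W) : f = g :=
  hom_ext fun x => prod_ext (congrArg (fun k => toCLM k x) h₁) (congrArg (fun k => toCLM k x) h₂)

lemma exists_prod {V W : HilbMod N} (x : V) (y : W) :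
    ∃ z : prod V W, toCLM (fst V W) z = x ∧ toCLM (snd V W) z = y :=
  ⟨WithLp.toLp 2 (x, y), rfl, rfl⟩

lemma prod_total (V W : HilbMod N) :
    fst V W ≫ pair (𝟙 V) 0 + snd V W ≫ pair 0 (𝟙 W) = 𝟙 _ := by
  refine hom_prod_ext ?_ ?_ <;> rw [Preadditive.add_comp] <;> simp

lemma isZero_zero : IsZero (zero N) := by
  rw [IsZero.iff_id_eq_zero]
  exact hom_ext fun x => rfl

lemma finiteType_zero : (zero N).FiniteType :=
  ⟨PEmpty, inferInstance, ⟨0, fun _ => (norm_zero (E := lp _ _))⟩, fun _ _ k => k.elim⟩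

/-! ### Polar decomposition -/

/-- Half of the polar decomposition: if `g : V ⟶ W` is injective then `|g|` has dense range, and
the map `|g| x ↦ g x` extends to an isometric embedding of `V` in `W`. -/
lemma exists_isometry_of_injective {V W : HilbMod N} (g : V ⟶ W)
    (hg : Function.Injective (toCLM g)) : ∃ f : V ⟶ W, ∀ x, ‖toCLM f x‖ = ‖x‖ := by
  let P : V →L[ℂ] V := (ContinuousLinearMap.adjoint (toCLM g)).comp (toCLM g)
  have hP : 0 ≤ P := (ContinuousLinearMap.nonneg_iff_isPositive _).2
    (ContinuousLinearMap.isPositive_adjoint_comp_self (toCLM g))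
  let S : V →L[ℂ] V := CFC.sqrt P
  have hS : S * S = P := CFC.sqrt_mul_sqrt_self P hP
  have hSs : IsSelfAdjoint S := IsSelfAdjoint.of_nonneg (CFC.sqrt_nonneg P)
  have hsym : ∀ x y, Inner.inner ℂ (S x) y = Inner.inner ℂ x (S y) := by
    intro x y
    rw [← ContinuousLinearMap.adjoint_inner_left, ContinuousLinearMap.isSelfAdjoint_iff'.1 hSs]
  have hcomm : ∀ (a : A) (x : V), S (a • x) = a • S x := by
    intro a x
    have h : Commute P (actL V a) := by
      refine ContinuousLinearMap.ext fun x => ?_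
      change toCLM (g ≫ adj g) (a • (x : V)) = a • toCLM (g ≫ adj g) x
      exact toCLM_smul _ _ _
    exact congrArg (fun T : V →L[ℂ] V => T x) (h.cfcₙ_nnreal NNReal.sqrt)
  have hnorm : ∀ x, ‖toCLM g x‖ = ‖S x‖ := by
    intro x
    refine (sq_eq_sq₀ (norm_nonneg _) (norm_nonneg _)).1 ?_
    rw [@norm_sq_eq_re_inner ℂ, @norm_sq_eq_re_inner ℂ]
    congr 1
    rw [hsym]
    change _ = Inner.inner ℂ x ((S * S) x)
    rw [hS]
    exact (ContinuousLinearMap.adjoint_inner_right _ _ _).symm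
  have hdense : DenseRange S := by
    have hinj : LinearMap.ker S.toLinearMap = ⊥ := by
      refine (Submodule.eq_bot_iff _).2 fun x hx => hg ?_
      have : ‖toCLM g x‖ = 0 := by
        rw [hnorm, show S x = 0 from hx, norm_zero]
      rw [norm_eq_zero.1 this, map_zero]
    have h := S.orthogonal_range
    rw [ContinuousLinearMap.isSelfAdjoint_iff'.1 hSs] at h
    have h' : (LinearMap.range S.toLinearMap)ᗮ = ⊥ := h.trans hinj
    have := (Submodule.topologicalClosure_eq_top_iff).2 h'
    intro x
    have hx : x ∈ (LinearMap.range S.toLinearMap).topologicalClosure := this ▸ Submodule.mem_top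
    exact hx
  let U : V →L[ℂ] W := (toCLM g).toLinearMap.extendOfNorm S.toLinearMap
  have hb : ∃ C, ∀ x, ‖(toCLM g).toLinearMap x‖ ≤ C * ‖S.toLinearMap x‖ :=
    ⟨1, fun x => by rw [one_mul]; exact (hnorm x).le⟩
  have hU : ∀ x, U (S x) = toCLM g x := fun x => LinearMap.extendOfNorm_eq hdense hb x
  have hUa : ∀ (a : A) (x : V), U (a • x) = a • U x := by
    intro a
    have h : U.comp (actL V a) = (actL W a).comp U := by
      refine ContinuousLinearMap.ext fun x => ?_
      refine hdense.induction_on x (isClosed_eq (by fun_prop) (by fun_prop)) fun y => ?_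
      change U (a • S y) = a • U (S y)
      rw [← hcomm, hU, hU, toCLM_smul]
    exact fun x => congrArg (fun T : V →L[ℂ] W => T x) h
  refine ⟨mkHom U hUa, fun x => ?_⟩
  refine hdense.induction_on x (isClosed_eq (by fun_prop) (by fun_prop)) fun y => ?_
  rw [toCLM_mkHom, hU, hnorm]

lemma FiniteType.of_injective {V W : HilbMod N} (g : V ⟶ W)
    (hg : Function.Injective (toCLM g)) (h : W.FiniteType) : V.FiniteType := by
  obtain ⟨f, hf⟩ := exists_isometry_of_injective g hg
  exact h.of_isometry f hf

/-! ### Splittings and the category argument -/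

/-- A morphism whose adjoint is bounded below has the section `T* (T T*)⁻¹`. -/
lemma exists_section {P E : HilbMod N} (T : P ⟶ E) (c : ℝ) (hc : 0 < c)
    (h : ∀ y, c * ‖y‖ ≤ ‖toCLM (adj T) y‖) : ∃ s : E ⟶ P, s ≫ T = 𝟙 E := by
  let S : E →L[ℂ] E := toCLM (adj T ≫ T)
  have hS : ∀ x y, Inner.inner ℂ (S x) y = Inner.inner ℂ (toCLM (adj T) x) (toCLM (adj T) y) :=
    fun x y => by
      rw [← inner_conj_symm, ← inner_conj_symm (toCLM (adj T) x), adj_inner]; rfl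
  have hb : ∀ y, c ^ 2 * ‖y‖ ≤ ‖S y‖ := by
    intro y
    rcases (norm_nonneg y).eq_or_lt with h0 | h0
    · rw [← h0, mul_zero]; exact norm_nonneg _
    have h₁ : ‖toCLM (adj T) y‖ ^ 2 ≤ ‖S y‖ * ‖y‖ := by
      rw [@norm_sq_eq_re_inner ℂ, ← hS]
      exact (RCLike.re_le_norm _).trans (norm_inner_le_norm _ _)
    have h₂ : (c * ‖y‖) ^ 2 ≤ ‖toCLM (adj T) y‖ ^ 2 :=
      pow_le_pow_left₀ (by positivity) (h y) 2
    refine le_of_mul_le_mul_right ?_ h0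
    calc c ^ 2 * ‖y‖ * ‖y‖ = (c * ‖y‖) ^ 2 := by ring
      _ ≤ _ := h₂.trans h₁
  have hanti : AntilipschitzWith (Real.toNNReal (c ^ 2)⁻¹) S := by
    refine AddMonoidHomClass.antilipschitz_of_bound S fun y => ?_
    rw [Real.coe_toNNReal _ (by positivity), ← div_eq_inv_mul, le_div_iff₀ (by positivity),
      mul_comm]
    exact hb y
  have hadj : ContinuousLinearMap.adjoint S = S := by
    refine (ContinuousLinearMap.eq_adjoint_iff S S).2 (fun x y => ?_) |>.symm
    rw [hS, ← inner_conj_symm, ← inner_conj_symm x, hS]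
  have hdense : (LinearMap.range S.toLinearMap).topologicalClosure = ⊤ := by
    have := S.orthogonal_range
    rw [hadj] at this
    exact Submodule.topologicalClosure_eq_top_iff.2
      (this.trans (LinearMap.ker_eq_bot.2 hanti.injective))
  have hbij : Function.Bijective S :=
    (ContinuousLinearMap.bijective_iff_dense_range_and_antilipschitz S).2 ⟨hdense, _, hanti⟩
  obtain ⟨R, hR⟩ := (ContinuousLinearMap.isUnit_iff_bijective.2 hbij).exists_right_inv
  have he : ∀ x, S (R x) = x := fun x => congrArg (fun F : E →L[ℂ] E => F x) hR
  have hRa : ∀ (a : A) (x : E), R (a • x) = a • R x := fun a x => hbij.1 (by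
    rw [he, show S (a • R x) = a • S (R x) from toCLM_smul (adj T ≫ T) a _, he])
  exact ⟨mkHom R hRa ≫ adj T, hom_ext he⟩

/-- If a projective Hilbert module is covered by the images of countably many morphisms, one of them
is a split surjection: the sets of the vectors `x` such that `|⟨x, y⟩| ≤ m ‖Tₙ* y‖` for all `y` are
closed and cover the module. -/
lemma exists_section_of_iUnion_range {E : HilbMod N} {P : ℕ → HilbMod N} (T : ∀ n, P n ⟶ E)
    (h : ∀ x, ∃ n, x ∈ Set.range (toCLM (T n))) : ∃ n, ∃ s : E ⟶ P n, s ≫ T n = 𝟙 E := by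
  let C : ℕ × ℕ → Set E := fun p =>
    {x | ∀ y, ‖(Inner.inner ℂ x y : ℂ)‖ ≤ p.2 * ‖toCLM (adj (T p.1)) y‖}
  have hC : ∀ p, IsClosed (C p) := by
    intro p
    simp only [C, Set.ofPred_forall]
    exact isClosed_iInter fun y => isClosed_le (by fun_prop) continuous_const
  have hU : ⋃ p, C p = Set.univ := by
    refine Set.eq_univ_of_forall fun x => Set.mem_iUnion.2 ?_
    obtain ⟨n, v, rfl⟩ := h x
    refine ⟨(n, ⌈‖v‖⌉₊), fun y => ?_⟩
    rw [← inner_conj_symm, ← adj_inner, RCLike.norm_conj, norm_inner_symm]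
    exact (norm_inner_le_norm _ _).trans
      (mul_le_mul_of_nonneg_right (Nat.le_ceil _) (norm_nonneg _))
  obtain ⟨⟨n, m⟩, x₀, hx₀⟩ := nonempty_interior_of_iUnion_of_closed hC hU
  obtain ⟨r, hr, hball⟩ := Metric.isOpen_iff.1 isOpen_interior x₀ hx₀
  have hin : ∀ z : E, ‖z‖ < r → x₀ + z ∈ C (n, m) := fun z hz =>
    interior_subset (hball (by simpa using hz))
  refine ⟨n, exists_section (T n) (r / (4 * (m + 1))) (by positivity) fun y => ?_⟩
  rcases (norm_nonneg y).eq_or_lt with h0 | h0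
  · rw [← h0, mul_zero]; exact norm_nonneg _
  -- test against the vector of norm `r / 2` in the direction of `y`
  let z : E := ((r / (2 * ‖y‖) : ℝ) : ℂ) • y
  have hz : ‖z‖ = r / 2 := by
    rw [norm_smul, Complex.norm_real, Real.norm_of_nonneg (by positivity)]
    field_simp
  have h₁ := hin z (by rw [hz]; linarith) y
  have h₂ := hin 0 (by simpa using hr) y
  rw [add_zero] at h₂
  have h₃ : ‖(Inner.inner ℂ z y : ℂ)‖ ≤ 2 * m * ‖toCLM (adj (T n)) y‖ := by
    have : (Inner.inner ℂ z y : ℂ) = Inner.inner ℂ (x₀ + z) y - Inner.inner ℂ x₀ y := by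
      rw [inner_add_left]; ring
    rw [this]
    refine (norm_sub_le _ _).trans ?_
    dsimp only at h₁ h₂
    linarith
  have h₄ : ‖(Inner.inner ℂ z y : ℂ)‖ = r / 2 * ‖y‖ := by
    rw [inner_smul_left, norm_mul, RCLike.norm_conj, Complex.norm_real,
      Real.norm_of_nonneg (by positivity), inner_self_eq_norm_sq_to_K]
    simp only [norm_pow, Complex.coe_algebraMap, Complex.norm_real, norm_norm]
    field_simp
  rw [h₄] at h₃
  rw [div_mul_eq_mul_div, div_le_iff₀ (by positivity)]
  nlinarith [norm_nonneg (toCLM (adj (T n)) y)]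

/-- Countably many lifting problems, of which every vector solves one, have a simultaneous
solution: one of them is solved by a morphism. -/
lemma exists_lift_of_forall {E : HilbMod N} {V W : ℕ → HilbMod N} (u : ∀ n, V n ⟶ W n)
    (ψ : ∀ n, E ⟶ W n) (h : ∀ x, ∃ n v, toCLM (u n) v = toCLM (ψ n) x) :
    ∃ n, ∃ g : E ⟶ V n, g ≫ u n = ψ n := by
  let c : ∀ n, prod E (V n) ⟶ W n := fun n => fst _ _ ≫ ψ n - snd _ _ ≫ u n
  obtain ⟨n, s, hs⟩ := exists_section_of_iUnion_range (fun n => kerι (c n) ≫ fst _ _) fun x => by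
    obtain ⟨n, v, hv⟩ := h x
    obtain ⟨z, rfl, rfl⟩ := exists_prod x v
    obtain ⟨y, rfl⟩ := exists_kerι (c n) (x := z) (by
      simp only [c, toCLM_sub, toCLM_comp, hv, sub_self])
    exact ⟨n, y, rfl⟩
  refine ⟨n, s ≫ kerι (c n) ≫ snd _ _, ?_⟩
  have h0 : kerι (c n) ≫ fst _ _ ≫ ψ n - kerι (c n) ≫ snd _ _ ≫ u n = 0 := by
    rw [← Preadditive.comp_sub]; exact kerι_comp _
  rw [Category.assoc, Category.assoc, ← sub_eq_zero.1 h0, ← Category.assoc, ← Category.assoc,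
    Category.assoc s, hs, Category.id_comp]

/-! ### Approximation by morphisms of finite type -/

/-- The morphism `φ` is a norm limit of morphisms that factor through modules of finite type. -/
def IsApprox {V W : HilbMod N} (φ : V ⟶ W) : Prop :=
  ∀ ε > 0, ∃ (M : HilbMod N) (h : V ⟶ M) (k : M ⟶ W), M.FiniteType ∧
    ‖toCLM φ - toCLM (h ≫ k)‖ < ε

lemma IsACompact.isApprox {V W : HilbMod N} {φ : V ⟶ W} (hφ : IsACompact φ) : IsApprox φ := by
  intro ε hε
  obtain ⟨ψ, h₁, h₂⟩ := hφ
  obtain ⟨n, hn⟩ := ((Metric.tendsto_nhds.1 h₂) ε hε).exists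
  obtain ⟨M, k, hM, hk, hr⟩ := h₁ n
  have hk' : ∀ x, ‖toCLM k x‖ = ‖x‖ := fun x => by
    simpa using hk.norm_map_of_map_zero (map_zero _) x
  refine ⟨M, ψ n ≫ adj k, k, hM, ?_⟩
  have : (ψ n ≫ adj k) ≫ k = ψ n := by
    refine hom_ext fun x => ?_
    obtain ⟨m, hm⟩ : toCLM (ψ n) x ∈ Set.range (toCLM k) := hr ▸ subset_closure ⟨x, rfl⟩
    rw [toCLM_comp, toCLM_comp, ← hm, ← toCLM_comp k, comp_adj_of_isometry k hk', toCLM_id]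
  rwa [this, ← dist_eq_norm, dist_comm]

lemma IsApprox.precomp {U V W : HilbMod N} (f : U ⟶ V) {φ : V ⟶ W} (hφ : IsApprox φ) :
    IsApprox (f ≫ φ) := by
  intro ε hε
  obtain ⟨M, h, k, hM, hlt⟩ := hφ (ε / (‖toCLM f‖ + 1)) (by positivity)
  refine ⟨M, f ≫ h, k, hM, ?_⟩
  have : toCLM (f ≫ φ) - toCLM ((f ≫ h) ≫ k) = (toCLM φ - toCLM (h ≫ k)).comp (toCLM f) := rfl
  rw [this]
  refine (ContinuousLinearMap.opNorm_comp_le _ _).trans_lt ?_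
  rw [lt_div_iff₀ (by positivity)] at hlt
  nlinarith [norm_nonneg (toCLM φ - toCLM (h ≫ k))]

lemma IsApprox.postcomp {U V W : HilbMod N} {φ : U ⟶ V} (f : V ⟶ W) (hφ : IsApprox φ) :
    IsApprox (φ ≫ f) := by
  intro ε hε
  obtain ⟨M, h, k, hM, hlt⟩ := hφ (ε / (‖toCLM f‖ + 1)) (by positivity)
  refine ⟨M, h, k ≫ f, hM, ?_⟩
  have : toCLM (φ ≫ f) - toCLM (h ≫ k ≫ f) = (toCLM f).comp (toCLM φ - toCLM (h ≫ k)) := by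
    rw [ContinuousLinearMap.comp_sub]; rfl
  rw [this]
  refine (ContinuousLinearMap.opNorm_comp_le _ _).trans_lt ?_
  rw [lt_div_iff₀ (by positivity)] at hlt
  nlinarith [norm_nonneg (toCLM φ - toCLM (h ≫ k))]

lemma IsApprox.add {V W : HilbMod N} {φ ψ : V ⟶ W} (hφ : IsApprox φ) (hψ : IsApprox ψ) :
    IsApprox (φ + ψ) := by
  intro ε hε
  obtain ⟨M, h, k, hM, hlt⟩ := hφ (ε / 2) (by positivity)
  obtain ⟨M', h', k', hM', hlt'⟩ := hψ (ε / 2) (by positivity)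
  refine ⟨prod M M', pair h h', fst _ _ ≫ k + snd _ _ ≫ k', hM.prod hM', ?_⟩
  have : toCLM (φ + ψ) - toCLM (pair h h' ≫ (fst _ _ ≫ k + snd _ _ ≫ k')) =
      (toCLM φ - toCLM (h ≫ k)) + (toCLM ψ - toCLM (h' ≫ k')) := by
    rw [Preadditive.comp_add, ← Category.assoc, ← Category.assoc, pair_fst, pair_snd]
    exact add_sub_add_comm _ _ _ _
  rw [this]
  exact (norm_add_le _ _).trans_lt (by linarith)

lemma IsApprox.pair {U V W : HilbMod N} {f : U ⟶ V} {g : U ⟶ W} (hf : IsApprox f)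
    (hg : IsApprox g) : IsApprox (HilbMod.pair f g) := by
  have : HilbMod.pair f g = f ≫ HilbMod.pair (𝟙 _) 0 + g ≫ HilbMod.pair 0 (𝟙 _) :=
    hom_prod_ext (by rw [Preadditive.add_comp]; simp) (by rw [Preadditive.add_comp]; simp)
  rw [this]
  exact (hf.postcomp _).add (hg.postcomp _)

lemma isApprox_of_finiteType {V W : HilbMod N} (hW : W.FiniteType) (φ : V ⟶ W) : IsApprox φ :=
  fun ε hε => ⟨W, φ, 𝟙 W, hW, by rw [Category.comp_id, sub_self, norm_zero]; exact hε⟩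

/-- A norm limit of morphisms that factor through modules of finite type is `A`-compact. If `f`
factors as `h ≫ k` through `M`, the adjoint of `k` is injective on the closure of the image of `f`,
which is therefore of finite type if `M` is. -/
lemma IsApprox.isACompact {V W : HilbMod N} {φ : V ⟶ W} (hφ : IsApprox φ) : IsACompact φ := by
  have hpos : ∀ n : ℕ, (0 : ℝ) < 1 / (n + 1) := fun n => by positivity
  choose M h k hM hlt using fun n : ℕ => hφ (1 / (n + 1)) (hpos n)
  refine ⟨fun n => h n ≫ k n, fun n => ?_, ?_⟩
  · let f := h n ≫ k n
    let R : Submodule ℂ W := (LinearMap.range (toCLM f).toLinearMap).topologicalClosure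
    let S : Submodule A W :=
      { carrier := R
        zero_mem' := R.zero_mem
        add_mem' := R.add_mem
        smul_mem' := fun a x hx => by
          refine map_mem_closure (actL W a).continuous hx ?_
          rintro _ ⟨v, rfl⟩
          exact ⟨a • v, toCLM_smul f a v⟩ }
    have hS : IsClosed (S : Set W) := isClosed_closure
    refine ⟨sub W S hS, subι W S hS, ?_, isometry_subtype_coe, Subtype.range_coe⟩
    refine (hM n).of_injective (subι W S hS ≫ adj (k n)) ?_
    refine (injective_iff_map_eq_zero (toCLM (subι W S hS ≫ adj (k n)))).2 fun x hx => ?_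
    have hx' : ∀ w ∈ closure (Set.range (toCLM f)),
        (Inner.inner ℂ (toCLM (subι W S hS) x) w : ℂ) = 0 := by
      intro w hw
      refine closure_minimal ?_ (isClosed_eq (by fun_prop) continuous_const) hw
      rintro _ ⟨v, rfl⟩
      change Inner.inner ℂ (toCLM (subι W S hS) x) (toCLM (k n) (toCLM (h n) v)) = 0
      rw [← adj_inner]
      have : toCLM (adj (k n)) (toCLM (subι W S hS) x) = 0 := hx
      rw [this, inner_zero_left]
    have := hx' _ (subι_mem x)
    exact subι_injective hS ((inner_self_eq_zero.1 this).trans (map_zero _).symm)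
  · rw [tendsto_iff_norm_sub_tendsto_zero]
    refine squeeze_zero (fun _ => norm_nonneg _) (fun n => ?_)
      tendsto_one_div_add_atTop_nhds_zero_nat
    rw [norm_sub_rev]
    exact (hlt n).le

/-! ### The finiteness lemma -/

/-- The finiteness argument of Cartan, Serre and Schwartz. If every vector of `E` is congruent to
the image of a vector of `D`, modulo the images of countably many morphisms, and `r : D ⟶ E` is a
norm limit of morphisms that factor through modules of finite type, then every vector of `E` is
congruent to a vector coming from a module of finite type. -/
lemma exists_finiteType_generators {E D : HilbMod N} (r : D ⟶ E) (hr : IsApprox r)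
    {V W : ℕ → HilbMod N} (u : ∀ n, V n ⟶ W n) (ψ : ∀ n, E ⟶ W n)
    (h : ∀ x, ∃ n z v, toCLM (ψ n) x = toCLM (ψ n) (toCLM r z) + toCLM (u n) v) :
    ∃ (M : HilbMod N) (k : M ⟶ E) (n : ℕ), M.FiniteType ∧
      ∀ x, ∃ m v, toCLM (ψ n) x = toCLM (ψ n) (toCLM k m) + toCLM (u n) v := by
  obtain ⟨n, g, hg⟩ := exists_lift_of_forall
    (fun n => fst D (V n) ≫ r ≫ ψ n + snd D (V n) ≫ u n) ψ fun x => by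
      obtain ⟨n, z, v, hx⟩ := h x
      obtain ⟨p, rfl, rfl⟩ := exists_prod z v
      exact ⟨n, p, hx.symm⟩
  obtain ⟨M, i, k, hM, hlt⟩ := (hr.precomp (g ≫ fst _ _)) 1 one_pos
  refine ⟨M, k, n, hM, fun x => ?_⟩
  -- write `x = w - K₂ w`, where `K₂` is the error, of norm `< 1`, of the approximation
  obtain ⟨w, hw⟩ := (ContinuousLinearMap.isUnit_iff_bijective.1
    (isUnit_one_sub_of_norm_lt_one hlt)).2 x
  have hw' : x = w - toCLM r (toCLM (fst _ _) (toCLM g w)) + toCLM k (toCLM i w) := by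
    rw [← hw]
    change w - (toCLM r (toCLM (fst _ _) (toCLM g w)) - toCLM k (toCLM i w)) = _
    abel
  have hgw : toCLM (ψ n) w = toCLM (ψ n) (toCLM r (toCLM (fst _ _) (toCLM g w))) +
      toCLM (u n) (toCLM (snd _ _) (toCLM g w)) := (congrArg (fun f => toCLM f w) hg).symm
  refine ⟨toCLM i w, toCLM (snd _ _) (toCLM g w), ?_⟩
  rw [hw', map_add, map_sub, hgw]
  abel

end HilbMod

/-! ### Localizations with a coreflection -/

section Localization

variable {P K : Type*} [Category P] [Category K]

/-- A fully faithful functor `F : P ⥤ K` induces an equivalence of `P` with a localization of `K`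
when every object of `K` receives a morphism of the class from an object of `P` and the objects of
`P` are colocal for the class: the functor `F` then has a right adjoint, which inverts the class,
and whose counit belongs to the class. -/
lemma isEquivalence_comp_Q (F : P ⥤ K) [F.Full] [F.Faithful] (W : MorphismProperty K)
    (h₁ : ∀ (L : P) {X Y : K} (w : X ⟶ Y), W w →
      Function.Bijective fun f : F.obj L ⟶ X => f ≫ w)
    (h₂ : ∀ X : K, ∃ (L : P) (w : F.obj L ⟶ X), W w) : (F ⋙ W.Q).IsEquivalence := by
  choose G w hw using h₂
  let e : ∀ (L : P) (X : K), (F.obj L ⟶ X) ≃ (L ⟶ G X) := fun L X =>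
    ((Functor.FullyFaithful.ofFullyFaithful F).homEquiv.trans
      (Equiv.ofBijective _ (h₁ L (w X) (hw X)))).symm
  have he : ∀ L' L X f g, e L' X (F.map f ≫ g) = f ≫ e L X g := by
    intro L' L X f g
    rw [Equiv.symm_apply_eq]
    obtain ⟨g, rfl⟩ := (e L X).symm.surjective g
    simp [e, Functor.FullyFaithful.homEquiv]
  let R : K ⥤ P := Adjunction.rightAdjointOfEquiv e he
  let adj : F ⊣ R := Adjunction.adjunctionOfEquivRight e he
  have hcounit : ∀ X, adj.counit.app X = w X := by
    intro X
    change (e (G X) X).symm (𝟙 _) = w X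
    simp [e, Functor.FullyFaithful.homEquiv]
  have hR : W.IsInvertedBy R := by
    intro X Y f hf
    have hbij : ∀ L, Function.Bijective fun g : L ⟶ R.obj X => g ≫ R.map f := by
      intro L
      have : (fun g : L ⟶ R.obj X => g ≫ R.map f) =
          (adj.homEquiv L Y) ∘ (fun g => g ≫ f) ∘ (adj.homEquiv L X).symm := by
        funext g
        simp [Adjunction.homEquiv_naturality_right]
      rw [this]
      exact (Equiv.bijective _).comp ((h₁ L f hf).comp (Equiv.bijective _))
    obtain ⟨g, hg⟩ := (hbij (R.obj Y)).2 (𝟙 _)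
    dsimp only at hg
    refine ⟨g, (hbij (R.obj X)).1 ?_, hg⟩
    dsimp only
    rw [Category.assoc, hg, Category.comp_id, Category.id_comp]
  let R' : W.Localization ⥤ P := Localization.lift R hR W.Q
  have : ∀ X, IsIso ((Functor.whiskerRight adj.counit W.Q).app X) := fun X => by
    rw [Functor.whiskerRight_app, hcounit]
    exact Localization.inverts W.Q W _ (hw X)
  have : IsIso (Functor.whiskerRight adj.counit W.Q) := NatIso.isIso_of_isIso_app _
  let η : 𝟭 P ≅ (F ⋙ W.Q) ⋙ R' :=
    asIso adj.unit ≪≫ (Functor.isoWhiskerLeft F (Localization.fac R hR W.Q)).symm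
  let _ : Localization.Lifting W.Q W (R ⋙ F ⋙ W.Q) (R' ⋙ F ⋙ W.Q) :=
    ⟨Functor.isoWhiskerRight (Localization.fac R hR W.Q) (F ⋙ W.Q)⟩
  let _ : Localization.Lifting W.Q W W.Q (𝟭 W.Localization) := ⟨Iso.refl _⟩
  let ε : R' ⋙ F ⋙ W.Q ≅ 𝟭 _ := Localization.liftNatIso W.Q W (R ⋙ F ⋙ W.Q) W.Q _ _
    (asIso (Functor.whiskerRight adj.counit W.Q))
  exact (CategoryTheory.Equivalence.mk (F ⋙ W.Q) R' η ε).isEquivalence_functor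

end Localization

/-! ### Descending recursion on the integers -/

section Descending

/-- The family that is given in degrees `≥ n`, and chosen by descending recursion below. -/
def descend {P : ℤ → Type*} (R : ∀ k, P (k + 1) → P k → Prop) (n : ℤ) (x₀ : ∀ k, n ≤ k → P k)
    (step : ∀ k, k < n → ∀ x : P (k + 1), ∃ y : P k, R k x y) (k : ℤ) : P k :=
  if h : n ≤ k then x₀ k h else (step k (not_le.1 h) (descend R n x₀ step (k + 1))).choose
termination_by (n - k).toNat
decreasing_by omega

lemma exists_descending {P : ℤ → Type*} (R : ∀ k, P (k + 1) → P k → Prop) (n : ℤ)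
    (x₀ : ∀ k, n ≤ k → P k) (step : ∀ k, k < n → ∀ x : P (k + 1), ∃ y : P k, R k x y)
    (h₀ : ∀ k (hk : n ≤ k), R k (x₀ (k + 1) (by omega)) (x₀ k hk)) :
    ∃ s : ∀ k, P k, (∀ k, R k (s (k + 1)) (s k)) ∧ ∀ k (hk : n ≤ k), s k = x₀ k hk := by
  have h : ∀ k (hk : n ≤ k), descend R n x₀ step k = x₀ k hk := fun k hk => by
    rw [descend, dif_pos hk]
  have h' : ∀ k (hk : ¬n ≤ k), descend R n x₀ step k =
      (step k (not_le.1 hk) (descend R n x₀ step (k + 1))).choose := fun k hk => by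
    rw [descend, dif_neg hk]
  refine ⟨descend R n x₀ step, fun k => ?_, h⟩
  by_cases hk : n ≤ k
  · rw [h k hk, h (k + 1) (by omega)]; exact h₀ k hk
  · rw [h' k hk]
    exact (step k (not_le.1 hk) (descend R n x₀ step (k + 1))).choose_spec

end Descending

/-! ### Morphisms from complexes of relatively projective objects -/

section Orthogonal

variable {C : Type*} [Category C] [Preadditive C]

/-- The object `T` lifts in `X`: morphisms from `T` to the cocycles of the complex `X` factor
through the differential. -/
def LiftsIn (T : C) (X : CochainComplex C ℤ) : Prop :=
  ∀ (k : ℤ) (f : T ⟶ X.X (k + 1)), f ≫ X.d (k + 1) (k + 1 + 1) = 0 →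
    ∃ g : T ⟶ X.X k, g ≫ X.d k (k + 1) = f

lemma nonempty_homotopy_zero {M X : CochainComplex C ℤ} (n : ℤ)
    (hM : ∀ k, n < k → IsZero (M.X k)) (hX : ∀ k, LiftsIn (M.X k) X) (φ : M ⟶ X) :
    Nonempty (Homotopy φ 0) := by
  let P : ℤ → Type _ := fun k => {h : M.X (k + 1) ⟶ X.X k //
    M.d k (k + 1) ≫ (φ.f (k + 1) - h ≫ X.d k (k + 1)) = 0}
  let R : ∀ k, P (k + 1) → P k → Prop := fun k x y =>
    φ.f (k + 1) = M.d (k + 1) (k + 1 + 1) ≫ x.1 + y.1 ≫ X.d k (k + 1)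
  have hz : ∀ k, n ≤ k → ∀ {Y} (f g : M.X (k + 1) ⟶ Y), f = g :=
    fun k hk Y f g => (hM _ (by omega)).eq_of_src f g
  obtain ⟨s, hs, -⟩ := exists_descending R n
    (fun k hk => ⟨0, by rw [hz k hk (φ.f (k + 1) - 0 ≫ X.d k (k + 1)) 0, comp_zero]⟩)
    (by
      rintro k - ⟨x, hx⟩
      obtain ⟨y, hy⟩ := hX (k + 1) k (φ.f (k + 1) - M.d (k + 1) (k + 1 + 1) ≫ x) (by
        rw [Preadditive.sub_comp, φ.comm, Category.assoc, ← Preadditive.comp_sub]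
        exact hx)
      have hy' : φ.f (k + 1) - y ≫ X.d k (k + 1) = M.d (k + 1) (k + 1 + 1) ≫ x := by
        rw [hy, sub_sub_cancel]
      refine ⟨⟨y, by rw [hy', ← Category.assoc, M.d_comp_d, zero_comp]⟩, ?_⟩
      exact (sub_eq_iff_eq_add.1 hy'))
    (fun k hk => hz k hk _ _)
  let h : ∀ i j, (ComplexShape.up ℤ).Rel j i → (M.X i ⟶ X.X j) := fun i j r =>
    (M.XIsoOfEq (show i = j + 1 from Eq.symm r)).hom ≫ (s j).1
  have hφ : φ = Homotopy.nullHomotopicMap' h := by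
    ext k
    obtain ⟨k, rfl⟩ : ∃ j, k = j + 1 := ⟨k - 1, by omega⟩
    rw [Homotopy.nullHomotopicMap'_f (k₂ := k) (k₁ := k + 1) (k₀ := k + 1 + 1) rfl rfl]
    simpa [h] using hs k
  exact ⟨(Homotopy.ofEq hφ).trans (Homotopy.nullHomotopy' h)⟩

variable [HasZeroObject C] [HasBinaryBiproducts C]

lemma comp_quotient_map_bijective {M F G : CochainComplex C ℤ} (σ : F ⟶ G) (n : ℤ)
    (hM : ∀ k, n < k → IsZero (M.X k))
    (hσ : ∀ k, LiftsIn (M.X k) (CochainComplex.mappingCone σ)) :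
    Function.Bijective fun f : (HomotopyCategory.quotient C (ComplexShape.up ℤ)).obj M ⟶
      (HomotopyCategory.quotient C (ComplexShape.up ℤ)).obj F =>
        f ≫ (HomotopyCategory.quotient C (ComplexShape.up ℤ)).map σ := by
  let Q := HomotopyCategory.quotient C (ComplexShape.up ℤ)
  let T := CochainComplex.mappingCone.triangleh σ
  have hT := HomotopyCategory.mappingCone_triangleh_distinguished σ
  have key : ∀ M' : CochainComplex C ℤ, (∃ m, ∀ k, m < k → IsZero (M'.X k)) →
      (∀ k, LiftsIn (M'.X k) (CochainComplex.mappingCone σ)) →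
      ∀ f : Q.obj M' ⟶ T.obj₃, f = 0 := by
    rintro M' ⟨m, hm⟩ hM' f
    obtain ⟨f, rfl⟩ := Q.map_surjective f
    obtain ⟨h⟩ := nonempty_homotopy_zero m hm hM' f
    exact (HomotopyCategory.eq_of_homotopy _ _ h).trans (Functor.map_zero _ _ _)
  constructor
  · refine (injective_iff_map_eq_zero
      (AddMonoidHom.mk' (fun f : Q.obj M ⟶ Q.obj F => f ≫ Q.map σ)
        fun f g => Preadditive.add_comp _ _ _ _ _ _)).2 fun f hf => ?_
    have hf' : f ≫ Q.map σ = 0 := hf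
    obtain ⟨g, hg⟩ := Pretriangulated.Triangle.coyoneda_exact₁ T hT (f⟦(1 : ℤ)⟧') (by
      change f⟦(1 : ℤ)⟧' ≫ (Q.map σ)⟦(1 : ℤ)⟧' = 0
      rw [← Functor.map_comp, hf', Functor.map_zero])
    let e := (Q.commShiftIso (1 : ℤ)).app M
    have hg0 : e.hom ≫ g = 0 := key (M⟦(1 : ℤ)⟧) ⟨n - 1, fun k hk => hM (k + 1) (by omega)⟩
      (fun k => hσ (k + 1)) _
    have hg1 : g = 0 := by rw [← cancel_epi e.hom, hg0, comp_zero]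
    rw [hg1, zero_comp] at hg
    exact (shiftFunctor (HomotopyCategory C (ComplexShape.up ℤ)) (1 : ℤ)).map_injective
      (hg.trans (Functor.map_zero _ _ _).symm)
  · intro f
    obtain ⟨g, hg⟩ := Pretriangulated.Triangle.coyoneda_exact₂ T hT f (key M ⟨n, hM⟩ hσ _)
    exact ⟨g, hg.symm⟩

end Orthogonal

open scoped ZeroObject

/-! ### Resolutions by descending recursion -/

section Resolution

variable {P C : Type*} [Category P] [Category C] [Preadditive P] [Preadditive C]
  (Φ : P ⥤ C) [Φ.Additive]

/-- The part in two consecutive degrees of a complex over `δ : Y ⟶ Y'`: a morphism `d : L ⟶ L'`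
and a morphism `Φ L ⟶ Y` that extends to a commutative square. -/
structure Stage {Y Y' : C} (δ : Y ⟶ Y') where
  /-- the term in the current degree -/
  L : P
  /-- the term in the next degree -/
  L' : P
  /-- the differential -/
  d : L ⟶ L'
  /-- the morphism to `Y` -/
  φ : Φ.obj L ⟶ Y
  w : ∃ φ' : Φ.obj L' ⟶ Y', φ ≫ δ = Φ.map d ≫ φ'

/-- A complex `L` with a morphism `Φ L ⟶ F` can be constructed by descending recursion, the term in
degree `k` being subject to a condition `Q` on the degrees `k`, `k + 1` and `k + 2`. -/
lemma exists_complex_over [HasZeroObject P] (F : CochainComplex C ℤ) (n : ℤ)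
    (Q : ∀ (k : ℤ) {L'' L L' : P}, (L'' ⟶ L) → (L ⟶ L') → (Φ.obj L'' ⟶ F.X k) →
      (Φ.obj L ⟶ F.X (k + 1)) → Prop)
    (h₀ : ∀ k, n ≤ k → Q k (0 : (0 : P) ⟶ 0) (0 : (0 : P) ⟶ 0) 0 0)
    (step : ∀ k, k < n → ∀ {L L' : P} (d : L ⟶ L') (φ : Φ.obj L ⟶ F.X (k + 1)),
      (∃ φ', φ ≫ F.d (k + 1) (k + 1 + 1) = Φ.map d ≫ φ') →
      ∃ (L'' : P) (d'' : L'' ⟶ L) (φ'' : Φ.obj L'' ⟶ F.X k), d'' ≫ d = 0 ∧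
        φ'' ≫ F.d k (k + 1) = Φ.map d'' ≫ φ ∧ Q k d'' d φ'' φ) :
    ∃ (L : CochainComplex P ℤ) (φ : (Φ.mapHomologicalComplex (ComplexShape.up ℤ)).obj L ⟶ F),
      (∀ k, n ≤ k → IsZero (L.X k)) ∧
      ∀ k, Q k (L.d k (k + 1)) (L.d (k + 1) (k + 1 + 1)) (φ.f k) (φ.f (k + 1)) := by
  let S : ℤ → Type _ := fun k => Stage Φ (F.d k (k + 1))
  let R : ∀ k, S (k + 1) → S k → Prop := fun k S S' =>
    ∃ h : S'.L' = S.L, (S'.d ≫ eqToHom h) ≫ S.d = 0 ∧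
      S'.φ ≫ F.d k (k + 1) = Φ.map (S'.d ≫ eqToHom h) ≫ S.φ ∧
      Q k (S'.d ≫ eqToHom h) S.d S'.φ S.φ
  obtain ⟨s, hs, hs₀⟩ := exists_descending R n (fun k _ => (⟨0, 0, 0, 0, 0, by simp⟩ : S k))
    (by
      rintro k hk ⟨L, L', d, φ, w⟩
      obtain ⟨L'', d'', φ'', h₁, h₂, h₃⟩ := step k hk d φ w
      refine ⟨⟨L'', L, d'', φ'', φ, h₂⟩, rfl, ?_⟩
      simpa using And.intro h₁ (And.intro h₂ h₃))
    (fun k hk => ⟨rfl, by simp, by simp, by simpa using h₀ k hk⟩)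
  choose h h₁ h₂ h₃ using hs
  let d : ∀ k, (s k).L ⟶ (s (k + 1)).L := fun k => (s k).d ≫ eqToHom (h k)
  have hd : ∀ k, d k ≫ d (k + 1) = 0 := fun k => by
    dsimp only [d]
    rw [← Category.assoc, h₁, zero_comp]
  let L : CochainComplex P ℤ := CochainComplex.of (fun k => (s k).L) d hd
  have hL : ∀ k, L.d k (k + 1) = d k := fun k => CochainComplex.of_d (fun k => (s k).L) d k
  let φ : (Φ.mapHomologicalComplex (ComplexShape.up ℤ)).obj L ⟶ F :=
    { f := fun k => (s k).φ
      comm' := by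
        rintro i _ rfl
        change _ = Φ.map (L.d i (i + 1)) ≫ _
        rw [hL]
        exact h₂ i }
  refine ⟨L, φ, fun k hk => ?_, fun k => ?_⟩
  · change IsZero (s k).L
    rw [hs₀ k hk]
    exact isZero_zero P
  · rw [hL, hL]
    have key : ∀ (S : S (k + 1)) (Z : P) (e : S.L' = Z) {L'' : P} (d'' : L'' ⟶ S.L)
        (φ'' : Φ.obj L'' ⟶ F.X k), Q k d'' S.d φ'' S.φ → Q k d'' (S.d ≫ eqToHom e) φ'' S.φ := by
      rintro ⟨L, L', d, φ, w⟩ _ rfl L'' d'' φ'' hQ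
      simpa using hQ
    exact key _ _ (h (k + 1)) _ _ (h₃ k)

end Resolution

/-! ### Isomorphisms in cohomology, on elements -/

section Elements

variable {C : Type*} [Category C]

lemma map_comp_apply (H : C ⥤ AddCommGrpCat.{u}) {X Y Z : C} (f : X ⟶ Y) (g : Y ⟶ Z)
    (x : H.obj X) : H.map (f ≫ g) x = H.map g (H.map f x) := by
  rw [H.map_comp]; rfl

variable [Preadditive C]

/-- The morphism of complexes `σ` becomes an isomorphism in cohomology after application of the
additive functor `H` to abelian groups. -/
structure IsCohIso (H : C ⥤ AddCommGrpCat.{u}) {F G : CochainComplex C ℤ} (σ : F ⟶ G) : Prop where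
  inj : ∀ i j, i + 1 = j → ∀ x : H.obj (F.X j), H.map (F.d j (j + 1)) x = 0 →
    ∀ y : H.obj (G.X i), H.map (σ.f j) x = H.map (G.d i j) y → ∃ z, H.map (F.d i j) z = x
  surj : ∀ i j, i + 1 = j → ∀ y : H.obj (G.X j), H.map (G.d j (j + 1)) y = 0 →
    ∃ x, H.map (F.d j (j + 1)) x = 0 ∧ ∃ z, y = H.map (σ.f j) x + H.map (G.d i j) z

variable (H : C ⥤ AddCommGrpCat.{u}) [H.Additive]

lemma map_add_apply {X Y : C} (f g : X ⟶ Y) (x : H.obj X) :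
    H.map (f + g) x = H.map f x + H.map g x := by
  rw [H.map_add]; rfl

lemma map_neg_apply {X Y : C} (f : X ⟶ Y) (x : H.obj X) : H.map (-f) x = -H.map f x := by
  rw [H.map_neg]; rfl

lemma map_sub_apply {X Y : C} (f g : X ⟶ Y) (x : H.obj X) :
    H.map (f - g) x = H.map f x - H.map g x := by
  rw [H.map_sub]; rfl

lemma map_zero_apply {X Y : C} (x : H.obj X) : H.map (0 : X ⟶ Y) x = 0 := by
  rw [H.map_zero]; rfl

lemma eq_zero_of_isZero {X : C} (hX : IsZero X) (x : H.obj X) : x = 0 := by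
  have : H.map (𝟙 X) x = x := by rw [H.map_id]; rfl
  rw [← this, hX.eq_of_src (𝟙 X) 0, map_zero_apply]

/-- A morphism that is an isomorphism in cohomology has an acyclic mapping cone. -/
lemma IsCohIso.exact_mappingCone [HasBinaryBiproducts C] {F G : CochainComplex C ℤ} {σ : F ⟶ G}
    (h : IsCohIso H σ) (k : ℤ) (x : H.obj ((CochainComplex.mappingCone σ).X (k + 1)))
    (hx : H.map ((CochainComplex.mappingCone σ).d (k + 1) (k + 1 + 1)) x = 0) :
    ∃ y, H.map ((CochainComplex.mappingCone σ).d k (k + 1)) y = x := by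
  have e₁ := CochainComplex.mappingCone.d_fst_v σ (k + 1) (k + 1 + 1) (k + 1 + 1 + 1) rfl rfl
  have e₂ := CochainComplex.mappingCone.d_snd_v σ (k + 1) (k + 1 + 1) rfl
  have e₃ := CochainComplex.mappingCone.inl_v_d σ (k + 1) k (k + 1 + 1) (by omega) (by omega)
  have e₄ := CochainComplex.mappingCone.inr_f_d σ k (k + 1)
  have e₅ := CochainComplex.mappingCone.id_X σ (k + 1) (k + 1 + 1) rfl
  generalize (CochainComplex.mappingCone.fst σ).1.v (k + 1) (k + 1 + 1) rfl = p at e₁ e₂ e₅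
  generalize (CochainComplex.mappingCone.fst σ).1.v (k + 1 + 1) (k + 1 + 1 + 1) rfl = p' at e₁
  generalize (CochainComplex.mappingCone.snd σ).v (k + 1) (k + 1) (add_zero _) = q at e₂ e₅
  generalize (CochainComplex.mappingCone.snd σ).v (k + 1 + 1) (k + 1 + 1) (add_zero _) = q' at e₂
  generalize (CochainComplex.mappingCone.inl σ).v (k + 1) k (by omega) = l at e₃
  generalize (CochainComplex.mappingCone.inl σ).v (k + 1 + 1) (k + 1) (by omega) = l' at e₃ e₅
  generalize (CochainComplex.mappingCone.inr σ).f (k + 1) = r' at e₃ e₄ e₅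
  generalize (CochainComplex.mappingCone.inr σ).f k = r at e₄
  have h₁ := congrArg (fun f => H.map f x) e₁
  have h₂ := congrArg (fun f => H.map f x) e₂
  have h₅ := congrArg (fun f => H.map f x) e₅
  simp only [map_comp_apply, map_neg_apply, map_add_apply, hx, map_zero] at h₁ h₂ h₅
  obtain ⟨z, hz⟩ := h.inj (k + 1) (k + 1 + 1) rfl (H.map p x) (neg_eq_zero.1 h₁.symm)
    (-H.map q x) (by rw [map_neg]; exact eq_neg_of_add_eq_zero_left h₂.symm)
  obtain ⟨x', hx', z', hz'⟩ := h.surj k (k + 1) rfl (H.map q x + H.map (σ.f (k + 1)) z) (by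
    rw [map_add, ← map_comp_apply, ← map_comp_apply, σ.comm, map_comp_apply, map_comp_apply, hz]
    exact (add_comm _ _).trans h₂.symm)
  refine ⟨H.map l (x' - z) + H.map r z', ?_⟩
  have h₃ := congrArg (fun f => H.map f (x' - z)) e₃
  have h₄ := congrArg (fun f => H.map f z') e₄
  simp only [map_comp_apply, map_sub_apply, hx', hz, map_sub, map_zero] at h₃ h₄
  have h₆ : H.map (σ.f (k + 1)) x' - H.map (σ.f (k + 1)) z + H.map (G.d k (k + 1)) z' =
      H.map q x := by
    rw [sub_add_eq_add_sub, ← hz', add_sub_cancel_right]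
  have h₇ : H.map (𝟙 ((CochainComplex.mappingCone σ).X (k + 1))) x = x := by
    rw [H.map_id]; rfl
  rw [← h₆, h₇, map_add, map_sub] at h₅
  rw [map_add, map_sub, map_sub, h₃, h₄]
  refine Eq.trans ?_ h₅
  abel

end Elements

/-! ### Resolutions that are isomorphisms in cohomology -/

section CohResolution

variable {P C : Type*} [Category P] [Category C] [Preadditive P] [Preadditive C]
  (Φ : P ⥤ C) [Φ.Additive] {J : Type*} (H : J → C ⥤ AddCommGrpCat.{u})

/-- The condition, on the term `L''` of degree `k` of a complex over `F`, that
`L'' ⊕ F.X (k - 1) ⟶ L ⊕ F.X k ⟶ L' ⊕ F.X (k + 1)` is exact after application of the functors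
`H`. -/
def IsGoodStep (F : CochainComplex C ℤ) (k : ℤ) {L'' L L' : P} (d'' : L'' ⟶ L) (d : L ⟶ L')
    (φ'' : Φ.obj L'' ⟶ F.X k) (φ : Φ.obj L ⟶ F.X (k + 1)) : Prop :=
  ∀ j i, i + 1 = k → ∀ (x : (H j).obj (Φ.obj L)) (y : (H j).obj (F.X k)),
    (H j).map (Φ.map d) x = 0 → (H j).map φ x = (H j).map (F.d k (k + 1)) y →
      ∃ l v, (H j).map (Φ.map d'') l = x ∧ y = (H j).map φ'' l + (H j).map (F.d i k) v

lemma isCohIso_of_isGoodStep {F : CochainComplex C ℤ} {L : CochainComplex P ℤ}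
    (φ : (Φ.mapHomologicalComplex (ComplexShape.up ℤ)).obj L ⟶ F)
    (h : ∀ k, IsGoodStep Φ H F k (L.d k (k + 1)) (L.d (k + 1) (k + 1 + 1)) (φ.f k) (φ.f (k + 1)))
    (j : J) : IsCohIso (H j) φ where
  inj := by
    rintro i _ rfl x hx y hy
    obtain ⟨l, -, hl, -⟩ := h i j (i - 1) (by omega) x y hx hy
    exact ⟨l, hl⟩
  surj := by
    rintro i _ rfl y hy
    obtain ⟨l, v, hl, hv⟩ := h (i + 1) j i rfl 0 y (map_zero _) (by rw [map_zero, hy])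
    exact ⟨l, hl, v, hv⟩

/-- Resolutions exist as soon as single steps do. For a bounded complex the resolution can be
stopped at the kernel of a differential. -/
lemma exists_resolution [∀ j, (H j).Additive] [HasZeroObject P]
    (hker : ∀ {L L' : P} (d : L ⟶ L'), ∃ (K : P) (i : K ⟶ L), Mono i ∧ i ≫ d = 0 ∧
      ∀ j (x : (H j).obj (Φ.obj L)), (H j).map (Φ.map d) x = 0 →
        ∃ z, (H j).map (Φ.map i) z = x)
    (F : CochainComplex C ℤ) (β : Bound) (hF : IsBounded β F)
    (step : ∀ k {L L' : P} (d : L ⟶ L') (φ : Φ.obj L ⟶ F.X (k + 1)),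
      (∃ φ', φ ≫ F.d (k + 1) (k + 1 + 1) = Φ.map d ≫ φ') → ∃ (L'' : P) (d'' : L'' ⟶ L)
        (φ'' : Φ.obj L'' ⟶ F.X k), d'' ≫ d = 0 ∧ φ'' ≫ F.d k (k + 1) = Φ.map d'' ≫ φ ∧
          IsGoodStep Φ H F k d'' d φ'' φ) :
    ∃ L : CochainComplex P ℤ, IsBounded β L ∧
      ∃ φ : (Φ.mapHomologicalComplex (ComplexShape.up ℤ)).obj L ⟶ F, ∀ j, IsCohIso (H j) φ := by
  obtain ⟨n, hn⟩ : ∃ n, ∀ k, n ≤ k → IsZero (F.X k) := by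
    cases β with
    | b => obtain ⟨m, n, h⟩ := hF; exact ⟨n + 1, fun k hk => h k (Or.inr (by omega))⟩
    | minus => obtain ⟨n, h⟩ := hF; exact ⟨n + 1, fun k hk => h k (by omega)⟩
  have hz : ∀ {X : P}, IsZero X → ∀ j (x : (H j).obj (Φ.obj X)), x = 0 := fun hX j x =>
    eq_zero_of_isZero (H j) (Φ.map_isZero hX) x
  have hmono : ∀ {L L' : P} (d : L ⟶ L'), Mono d → ∀ j (x : (H j).obj (Φ.obj L)),
      (H j).map (Φ.map d) x = 0 → x = 0 := by
    intro L L' d hd j x hx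
    obtain ⟨K, i, hi, hid, h⟩ := hker d
    obtain ⟨z, rfl⟩ := h j x hx
    have : i = 0 := by rw [← cancel_mono d, hid, zero_comp]
    rw [this, Φ.map_zero, map_zero_apply]
  -- the differential of `L` is a monomorphism where `F` vanishes in two consecutive degrees, and
  -- `L` is zero below such a monomorphism
  obtain ⟨L, φ, hL, hφ⟩ := exists_complex_over Φ F n
    (fun k {L'' L L'} d'' d φ'' φ => IsGoodStep Φ H F k d'' d φ'' φ ∧
      (IsZero (F.X k) → IsZero (F.X (k + 1)) → Mono d'') ∧
      (IsZero (F.X k) → Mono d → IsZero L''))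
    (fun k hk => by
      refine ⟨fun j i _ x y _ _ => ⟨0, 0, ?_, ?_⟩, fun _ _ => ?_, fun _ _ => isZero_zero P⟩
      · rw [map_zero, hz (isZero_zero P) j x]
      · rw [map_zero, map_zero, add_zero, eq_zero_of_isZero (H j) (hn k hk) y]
      · exact ⟨fun _ _ _ => (isZero_zero P).eq_of_tgt _ _⟩)
    (by
      intro k _ L L' d φ w
      by_cases hk : IsZero (F.X k)
      · by_cases hd : Mono d
        · refine ⟨0, 0, 0, zero_comp, by simp, fun j i _ x y hx _ => ⟨0, 0, ?_, ?_⟩,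
            fun _ _ => ⟨fun _ _ _ => (isZero_zero P).eq_of_tgt _ _⟩, fun _ _ => isZero_zero P⟩
          · rw [map_zero, hmono d hd j x hx]
          · rw [map_zero, map_zero, add_zero, eq_zero_of_isZero (H j) hk y]
        · by_cases hk' : IsZero (F.X (k + 1))
          · obtain ⟨K, i, hi, hid, h⟩ := hker d
            refine ⟨K, i, 0, hid, hk'.eq_of_tgt _ _, fun j i _ x y hx _ => ?_,
              fun _ _ => hi, fun _ h => absurd h hd⟩
            obtain ⟨z, hz⟩ := h j x hx
            exact ⟨z, 0, hz, eq_zero_of_isZero (H j) hk _ |>.trans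
              (eq_zero_of_isZero (H j) hk _).symm⟩
          · obtain ⟨L'', d'', φ'', h₁, h₂, h₃⟩ := step k d φ w
            exact ⟨L'', d'', φ'', h₁, h₂, h₃, fun _ h => absurd h hk', fun _ h => absurd h hd⟩
      · obtain ⟨L'', d'', φ'', h₁, h₂, h₃⟩ := step k d φ w
        exact ⟨L'', d'', φ'', h₁, h₂, h₃, fun h => absurd h hk, fun h => absurd h hk⟩)
  refine ⟨L, ?_, φ, isCohIso_of_isGoodStep Φ H φ fun k => (hφ k).1⟩
  cases β with
  | minus => exact ⟨n, fun k hk => hL k hk.le⟩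
  | b =>
    obtain ⟨m, n', h⟩ := hF
    refine ⟨m - 2, n, fun k hk => ?_⟩
    rcases hk with hk | hk
    · exact (hφ k).2.2 (h k (Or.inl (by omega)))
        ((hφ (k + 1)).2.1 (h _ (Or.inl (by omega))) (h _ (Or.inl (by omega))))
    · exact hL k hk.le

end CohResolution

/-! ### Categories of finitely presented objects are abelian -/

section Freyd

variable {P E : Type*} [Category P] [Category E] [Preadditive E] {Φ : P ⥤ E}

variable (Φ) in
/-- The morphism `π` exhibits `X` as the cokernel of `Φ y` in such a way that objects of the image
of `Φ` are projective relatively to `π`. -/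
structure IsPres {Y₁ Y₂ : P} (y : Y₁ ⟶ Y₂) {X : E} (π : Φ.obj Y₂ ⟶ X) : Prop where
  w : Φ.map y ≫ π = 0
  lift : ∀ {T : P} (f : Φ.obj T ⟶ X), ∃ g : T ⟶ Y₂, Φ.map g ≫ π = f
  exact : ∀ {T : P} (g : T ⟶ Y₂), Φ.map g ≫ π = 0 → ∃ h : T ⟶ Y₁, h ≫ y = g
  desc : ∀ {Z : E} (f : Φ.obj Y₂ ⟶ Z), Φ.map y ≫ f = 0 → ∃ g : X ⟶ Z, π ≫ g = f
  epi : Epi π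

variable (Φ) in
/-- Every object of `E` is presented by a morphism of `P`, and every morphism of `P` presents
an object. -/
structure IsFreyd : Prop where
  pres : ∀ X : E, ∃ (Y₁ Y₂ : P) (y : Y₁ ⟶ Y₂) (π : Φ.obj Y₂ ⟶ X), IsPres Φ y π
  coker : ∀ {Y₁ Y₂ : P} (y : Y₁ ⟶ Y₂), ∃ (X : E) (π : Φ.obj Y₂ ⟶ X), IsPres Φ y π

namespace IsFreyd

variable (hΦ : IsFreyd Φ)
include hΦ

/-- Morphisms of `E` are determined by their effect on points with values in objects of `P`. -/
lemma hom_ext {X Z : E} {f g : X ⟶ Z}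
    (h : ∀ (T : P) (x : Φ.obj T ⟶ X), x ≫ f = x ≫ g) : f = g := by
  obtain ⟨_, Y, _, π, hπ⟩ := hΦ.pres X
  have := hπ.epi
  exact (cancel_epi π).1 (h Y π)

lemma mono_of_points {K X : E} (k : K ⟶ X)
    (h : ∀ (T : P) (x : Φ.obj T ⟶ K), x ≫ k = 0 → x = 0) : Mono k := by
  refine Preadditive.mono_of_cancel_zero k fun g hg => hΦ.hom_ext fun T x => ?_
  rw [comp_zero]
  exact h T _ (by rw [Category.assoc, hg, comp_zero])

lemma exists_lift {S K X : E} (k : K ⟶ X) [Mono k] (g : S ⟶ X)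
    (h : ∀ (T : P) (x : Φ.obj T ⟶ S), ∃ z, z ≫ k = x ≫ g) : ∃ l : S ⟶ K, l ≫ k = g := by
  obtain ⟨S₁, S₂, s, π, hπ⟩ := hΦ.pres S
  obtain ⟨z, hz⟩ := h S₂ π
  obtain ⟨l, hl⟩ := hπ.desc z (by
    rw [← cancel_mono k, Category.assoc, hz, ← Category.assoc, hπ.w, zero_comp, zero_comp])
  have := hπ.epi
  exact ⟨l, by rw [← cancel_epi π, ← Category.assoc, hl, hz]⟩

variable [Preadditive P] [HasBinaryBiproducts P]

/-- The kernel of a morphism `φ` that lifts to `φ₂ : Y₂ ⟶ Y₂'` is generated by the weak kernel of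
`Y₂ ⟶ X'`, that is by the kernel of `Y₂ ⊞ Y₁' ⟶ Y₂'`, and its relations are those that hold in
`X`. -/
lemma exists_kernel [HasKernels P] {X X' : E} (φ : X ⟶ X') :
    ∃ (K : E) (k : K ⟶ X), k ≫ φ = 0 ∧ Mono k ∧
      ∀ (T : P) (x : Φ.obj T ⟶ X), x ≫ φ = 0 → ∃ z, z ≫ k = x := by
  obtain ⟨Y₁, Y₂, y, π, hπ⟩ := hΦ.pres X
  obtain ⟨Y₁', Y₂', y', π', hπ'⟩ := hΦ.pres X'
  obtain ⟨φ₂, hφ₂⟩ := hπ'.lift (π ≫ φ)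
  let c : Y₂ ⊞ Y₁' ⟶ Y₂' := biprod.desc φ₂ (-y')
  let q : kernel c ⟶ Y₂ := kernel.ι c ≫ biprod.fst
  have hq : q ≫ φ₂ = (kernel.ι c ≫ biprod.snd) ≫ y' := by
    have : kernel.ι c ≫ biprod.desc φ₂ (-y') = 0 := kernel.condition c
    rw [biprod.desc_eq, Preadditive.comp_add, Preadditive.comp_neg, Preadditive.comp_neg,
      ← sub_eq_add_neg, sub_eq_zero] at this
    simpa [q] using this
  let d : kernel c ⊞ Y₁ ⟶ Y₂ := biprod.desc q (-y)
  let a : kernel d ⟶ kernel c := kernel.ι d ≫ biprod.fst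
  have ha : a ≫ q = (kernel.ι d ≫ biprod.snd) ≫ y := by
    have : kernel.ι d ≫ biprod.desc q (-y) = 0 := kernel.condition d
    rw [biprod.desc_eq, Preadditive.comp_add, Preadditive.comp_neg, Preadditive.comp_neg,
      ← sub_eq_add_neg, sub_eq_zero] at this
    simpa [a] using this
  obtain ⟨K, πK, hK⟩ := hΦ.coker a
  obtain ⟨k, hk⟩ := hK.desc (Φ.map q ≫ π) (by
    rw [← Category.assoc, ← Φ.map_comp, ha, Φ.map_comp, Category.assoc, hπ.w, comp_zero])
  have := hK.epi
  refine ⟨K, k, ?_, hΦ.mono_of_points k fun T x hx => ?_, fun T x hx => ?_⟩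
  · rw [← cancel_epi πK, ← Category.assoc, hk, Category.assoc, ← hφ₂, ← Category.assoc,
      ← Φ.map_comp, hq, Φ.map_comp, Category.assoc, hπ'.w, comp_zero, comp_zero]
  · obtain ⟨g, rfl⟩ := hK.lift x
    rw [Category.assoc, hk, ← Category.assoc, ← Φ.map_comp] at hx
    obtain ⟨h, hh⟩ := hπ.exact _ hx
    have hga : kernel.lift d (biprod.lift g h) (by simp [d, hh]) ≫ a = g := by simp [a]
    rw [← hga, Φ.map_comp, Category.assoc, hK.w, comp_zero]
  · obtain ⟨g, rfl⟩ := hπ.lift x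
    rw [Category.assoc, ← hφ₂, ← Category.assoc, ← Φ.map_comp] at hx
    obtain ⟨h, hh⟩ := hπ'.exact _ hx
    refine ⟨Φ.map (kernel.lift c (biprod.lift g h) (by simp [c, hh])) ≫ πK, ?_⟩
    rw [Category.assoc, hk, ← Category.assoc, ← Φ.map_comp]
    simp [q]

variable [Φ.Additive]

/-- The cokernel of a morphism with lift `φ₂ : Y₂ ⟶ Y₂'` is presented by `Y₂ ⊞ Y₁' ⟶ Y₂'`. -/
lemma exists_cokernel {X X' : E} (φ : X ⟶ X') :
    ∃ (Q : E) (c : X' ⟶ Q), φ ≫ c = 0 ∧ Epi c ∧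
      (∀ (Z : E) (g : X' ⟶ Z), φ ≫ g = 0 → ∃ l, c ≫ l = g) ∧
      ∀ (T : P) (x : Φ.obj T ⟶ X'), x ≫ c = 0 → ∃ z, z ≫ φ = x := by
  obtain ⟨Y₁, Y₂, y, π, hπ⟩ := hΦ.pres X
  obtain ⟨Y₁', Y₂', y', π', hπ'⟩ := hΦ.pres X'
  obtain ⟨φ₂, hφ₂⟩ := hπ'.lift (π ≫ φ)
  let r : Y₂ ⊞ Y₁' ⟶ Y₂' := biprod.desc φ₂ y'
  obtain ⟨Q, πQ, hQ⟩ := hΦ.coker r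
  have h₁ : Φ.map φ₂ ≫ πQ = 0 := by
    rw [show φ₂ = biprod.inl ≫ r by simp [r], Φ.map_comp, Category.assoc, hQ.w, comp_zero]
  have h₂ : Φ.map y' ≫ πQ = 0 := by
    rw [show y' = biprod.inr ≫ r by simp [r], Φ.map_comp, Category.assoc, hQ.w, comp_zero]
  obtain ⟨c, hc⟩ := hπ'.desc πQ h₂
  have := hπ.epi
  have := hπ'.epi
  have := hQ.epi
  have hcepi : Epi c := epi_of_epi_fac hc
  refine ⟨Q, c, ?_, hcepi, fun Z g hg => ?_, fun T x hx => ?_⟩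
  · rw [← cancel_epi π, ← Category.assoc, ← hφ₂, Category.assoc, hc, h₁, comp_zero]
  · obtain ⟨l, hl⟩ := hQ.desc (π' ≫ g) (by
      change Φ.map (biprod.desc φ₂ y') ≫ π' ≫ g = 0
      rw [biprod.desc_eq, Φ.map_add, Φ.map_comp, Φ.map_comp, Preadditive.add_comp, Category.assoc,
        Category.assoc, ← Category.assoc _ π' g, ← Category.assoc _ π' g, hφ₂, hπ'.w,
        Category.assoc, hg, zero_comp, comp_zero, comp_zero, comp_zero, add_zero])
    exact ⟨l, by rw [← cancel_epi π', ← Category.assoc, hc, hl]⟩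
  · obtain ⟨g, rfl⟩ := hπ'.lift x
    rw [Category.assoc, hc] at hx
    obtain ⟨h, rfl⟩ := hQ.exact _ hx
    refine ⟨Φ.map (h ≫ biprod.fst) ≫ π, ?_⟩
    rw [Category.assoc, ← hφ₂, ← Category.assoc, ← Φ.map_comp,
      show r = _ from biprod.desc_eq, Preadditive.comp_add, Φ.map_add, Preadditive.add_comp]
    simp [hπ'.w]

lemma projective (T : P) : Projective (Φ.obj T) where
  factors {X X'} f p hp := by
    obtain ⟨Q, c, hpc, -, -, h⟩ := hΦ.exists_cokernel p
    have hc : c = 0 := by rw [← cancel_epi p, hpc, comp_zero]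
    exact h T f (by rw [hc, comp_zero])

lemma hasBinaryBiproducts : HasBinaryBiproducts E where
  has_binary_biproduct X X' := by
    obtain ⟨Y₁, Y₂, y, π, hπ⟩ := hΦ.pres X
    obtain ⟨Y₁', Y₂', y', π', hπ'⟩ := hΦ.pres X'
    obtain ⟨Q, q, hq⟩ := hΦ.coker (biprod.map y y')
    have e := hπ.epi
    have e' := hπ'.epi
    have eq := hq.epi
    obtain ⟨i, hi⟩ := hπ.desc (Φ.map biprod.inl ≫ q) (by
      rw [← Category.assoc, ← Φ.map_comp, ← biprod.inl_map, Φ.map_comp, Category.assoc, hq.w,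
        comp_zero])
    obtain ⟨i', hi'⟩ := hπ'.desc (Φ.map biprod.inr ≫ q) (by
      rw [← Category.assoc, ← Φ.map_comp, ← biprod.inr_map, Φ.map_comp, Category.assoc, hq.w,
        comp_zero])
    obtain ⟨p, hp⟩ := hq.desc (Φ.map biprod.fst ≫ π) (by
      rw [← Category.assoc, ← Φ.map_comp, biprod.map_fst, Φ.map_comp, Category.assoc, hπ.w,
        comp_zero])
    obtain ⟨p', hp'⟩ := hq.desc (Φ.map biprod.snd ≫ π') (by
      rw [← Category.assoc, ← Φ.map_comp, biprod.map_snd, Φ.map_comp, Category.assoc, hπ'.w,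
        comp_zero])
    let b : BinaryBicone X X' :=
      { pt := Q, fst := p, snd := p', inl := i, inr := i'
        inl_fst := by
          rw [← cancel_epi π, ← Category.assoc, hi, Category.assoc, hp, ← Category.assoc,
            ← Φ.map_comp, biprod.inl_fst, Φ.map_id, Category.id_comp, Category.comp_id]
        inl_snd := by
          rw [← cancel_epi π, ← Category.assoc, hi, Category.assoc, hp', ← Category.assoc,
            ← Φ.map_comp, biprod.inl_snd, Φ.map_zero, zero_comp, comp_zero]
        inr_fst := by
          rw [← cancel_epi π', ← Category.assoc, hi', Category.assoc, hp, ← Category.assoc,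
            ← Φ.map_comp, biprod.inr_fst, Φ.map_zero, zero_comp, comp_zero]
        inr_snd := by
          rw [← cancel_epi π', ← Category.assoc, hi', Category.assoc, hp', ← Category.assoc,
            ← Φ.map_comp, biprod.inr_snd, Φ.map_id, Category.id_comp, Category.comp_id] }
    refine hasBinaryBiproduct_of_total b ?_
    change p ≫ i + p' ≫ i' = 𝟙 Q
    rw [← cancel_epi q, Preadditive.comp_add, ← Category.assoc, hp, ← Category.assoc, hp',
      Category.assoc, hi, Category.assoc, hi', ← Category.assoc, ← Category.assoc, ← Φ.map_comp,
      ← Φ.map_comp, ← Preadditive.add_comp, ← Φ.map_add, biprod.total, Φ.map_id, Category.id_comp,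
      Category.comp_id]

lemma isAbelian [HasKernels P] [HasZeroObject P] : IsAbelian E where
  has_finite_products := by
    have := hΦ.hasBinaryBiproducts
    have : HasZeroObject E := ⟨_, Φ.map_isZero (isZero_zero P)⟩
    exact hasFiniteProducts_of_has_binary_and_terminal
  has_kernels := ⟨fun {X X'} φ => by
    obtain ⟨K, k, hk, hmono, h⟩ := hΦ.exists_kernel φ
    exact ⟨⟨⟨_, KernelFork.IsLimit.ofι' k hk fun {S} g hg => by
      have := hΦ.exists_lift k g fun T x => h T _ (by rw [Category.assoc, hg, comp_zero])
      exact ⟨this.choose, this.choose_spec⟩⟩⟩⟩⟩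
  has_cokernels := ⟨fun {X X'} φ => by
    obtain ⟨Q, c, hc, hepi, h, -⟩ := hΦ.exists_cokernel φ
    exact ⟨⟨⟨_, CokernelCofork.IsColimit.ofπ' c hc fun {Z} g hg =>
      ⟨(h Z g hg).choose, (h Z g hg).choose_spec⟩⟩⟩⟩⟩
  normalMonoOfMono {X X'} i hi := by
    obtain ⟨Q, c, hc, -, -, h⟩ := hΦ.exists_cokernel i
    exact ⟨⟨Q, c, hc, KernelFork.IsLimit.ofι' i hc fun {S} g hg => by
      have := hΦ.exists_lift i g fun T x => h T _ (by rw [Category.assoc, hg, comp_zero])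
      exact ⟨this.choose, this.choose_spec⟩⟩⟩
  normalEpiOfEpi {X X'} p hp := by
    obtain ⟨K, k, hk, -, h⟩ := hΦ.exists_kernel p
    obtain ⟨Y₁', Y₂', y', π', hπ'⟩ := hΦ.pres X'
    have key : ∀ {Z : E} (g : X ⟶ Z), k ≫ g = 0 → ∃ l, p ≫ l = g := by
      intro Z g hg
      -- morphisms from points that are killed by `p` are killed by `g`
      have h0 : ∀ (T : P) (x : Φ.obj T ⟶ X), x ≫ p = 0 → x ≫ g = 0 := by
        intro T x hx
        obtain ⟨z, rfl⟩ := h T x hx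
        rw [Category.assoc, hg, comp_zero]
      obtain ⟨s, hs⟩ := (hΦ.projective Y₂').factors π' p
      obtain ⟨l, hl⟩ := hπ'.desc (s ≫ g) (by
        rw [← Category.assoc]
        exact h0 _ _ (by rw [Category.assoc, hs, hπ'.w]))
      refine ⟨l, hΦ.hom_ext fun T x => ?_⟩
      obtain ⟨r, hr⟩ := hπ'.lift (x ≫ p)
      have := h0 T (Φ.map r ≫ s - x) (by
        rw [Preadditive.sub_comp, Category.assoc, hs, hr, sub_self])
      rw [Preadditive.sub_comp, sub_eq_zero, Category.assoc, ← hl, ← Category.assoc, hr,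
        Category.assoc] at this
      exact this
    exact ⟨⟨K, k, hk, CokernelCofork.IsColimit.ofπ' p hk fun {Z} g hg =>
      ⟨(key g hg).choose, (key g hg).choose_spec⟩⟩⟩

end IsFreyd

end Freyd

/-! ### Modules of finite type -/

instance : HasKernels (Pf N) where
  has_limit {X Y} f := by
    let K : Pf N := ⟨HilbMod.ker f.hom, X.property.ker f.hom⟩
    let ι : K ⟶ X := ObjectProperty.homMk (HilbMod.kerι f.hom)
    have hι : ι ≫ f = 0 := ObjectProperty.hom_ext _ (HilbMod.kerι_comp f.hom)
    have : Mono ι := ⟨fun g h e => ObjectProperty.hom_ext _ (HilbMod.hom_ext fun x =>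
      HilbMod.kerι_injective f.hom (congrArg (fun k => HilbMod.toCLM k.hom x) e))⟩
    exact ⟨⟨⟨_, KernelFork.IsLimit.ofι' ι hι fun {S} g hg =>
      ⟨ObjectProperty.homMk (HilbMod.kerLift f.hom g.hom (congrArg (fun k => k.hom) hg)), rfl⟩⟩⟩⟩

instance : HasBinaryBiproducts (Pf N) where
  has_binary_biproduct V W := by
    let Q : Pf N := ⟨HilbMod.prod V.obj W.obj, V.property.prod W.property⟩
    let b : BinaryBicone V W :=
      { pt := Q
        fst := ObjectProperty.homMk (HilbMod.fst V.obj W.obj)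
        snd := ObjectProperty.homMk (HilbMod.snd V.obj W.obj)
        inl := ObjectProperty.homMk (HilbMod.pair (𝟙 V.obj) 0)
        inr := ObjectProperty.homMk (HilbMod.pair 0 (𝟙 W.obj)) }
    exact hasBinaryBiproduct_of_total b
      (ObjectProperty.hom_ext _ (HilbMod.prod_total V.obj W.obj))

instance : HasZeroObject (Pf N) :=
  ⟨⟨HilbMod.zero N, HilbMod.finiteType_zero⟩, by
    rw [IsZero.iff_id_eq_zero]
    exact ObjectProperty.hom_ext _ (HilbMod.isZero_zero.eq_of_src _ _)⟩

/-! ### The category `E_f(A)` is abelian -/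

/-- The morphism of `E_f(A)` represented by a commutative square. -/
def efHom {X Y : Ef N} (f : X.obj.as ⟶ Y.obj.as) : X ⟶ Y :=
  ObjectProperty.homMk ((Quotient.functor (eRel N)).map f)

lemma efHom_surjective {X Y : Ef N} (f : X ⟶ Y) : ∃ g, efHom g = f := by
  obtain ⟨g, hg⟩ := (Quotient.functor (eRel N)).map_surjective f.hom
  exact ⟨g, ObjectProperty.hom_ext _ hg⟩

lemma efHom_eq_iff {X Y : Ef N} (f g : X.obj.as ⟶ Y.obj.as) :
    efHom f = efHom g ↔
      ∃ T : X.obj.as.right ⟶ Y.obj.as.left, g.right - f.right = T ≫ Y.obj.as.hom :=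
  ⟨fun h => (Quotient.functor_map_eq_iff (eRel N) f g).1 (congrArg (fun k => k.hom) h),
    fun h => ObjectProperty.hom_ext _ ((Quotient.functor_map_eq_iff (eRel N) f g).2 h)⟩

lemma efHom_eq_zero_iff {X Y : Ef N} (f : X.obj.as ⟶ Y.obj.as) :
    efHom f = 0 ↔ ∃ T : X.obj.as.right ⟶ Y.obj.as.left, f.right = T ≫ Y.obj.as.hom := by
  have h : (efHom 0 : X ⟶ Y) = 0 :=
    ObjectProperty.hom_ext _ ((Quotient.functor (eRel N)).map_zero _ _)
  rw [← h, eq_comm, efHom_eq_iff]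
  exact ⟨fun ⟨T, hT⟩ => ⟨T, (sub_zero f.right).symm.trans hT⟩,
    fun ⟨T, hT⟩ => ⟨T, (sub_zero f.right).trans hT⟩⟩

/-- The object of `E_f(A)` given by a morphism with target of finite type. -/
def efObj {E₁ E₂ : HilbMod N} (e : E₁ ⟶ E₂) (h : E₂.FiniteType) : Ef N :=
  ⟨(Quotient.functor (eRel N)).obj (Arrow.mk e), h⟩

/-- A square from an object `0 ⟶ E`. -/
def fromZero {E : HilbMod N} {Y : Arrow (HilbMod N)} (f : E ⟶ Y.right) :
    (arrowOfHilb N).obj E ⟶ Y :=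
  Arrow.homMk (u := 0) (v := f)
    (HilbMod.isZero_zero.eq_of_src (Y := Y.right) _ _)

/-- An object `e : E₁ ⟶ E₂` of `E_f(A)` is presented by `Y ⟶ E₁ ⟶ E₂` as soon as `e` factors through
this morphism. -/
lemma isPres_efObj {E₁ : HilbMod N} (E₂ : Pf N) (e : E₁ ⟶ E₂.obj) (Y : Pf N) (i : Y.obj ⟶ E₁)
    (p : E₁ ⟶ Y.obj) (hp : p ≫ i ≫ e = e) :
    IsPres (pfToEf N) (X := efObj e E₂.property) (ObjectProperty.homMk (i ≫ e) : Y ⟶ E₂)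
      (efHom (fromZero (𝟙 E₂.obj))) where
  w := by
    refine (efHom_eq_zero_iff (X := (pfToEf N).obj Y) (Y := efObj e E₂.property)
      ((arrowOfHilb N).map (i ≫ e) ≫ fromZero (𝟙 E₂.obj))).2 ⟨i, ?_⟩
    exact Category.comp_id (i ≫ e)
  lift {T} f := by
    obtain ⟨f, rfl⟩ := efHom_surjective f
    refine ⟨ObjectProperty.homMk f.right, ?_⟩
    refine (efHom_eq_iff (X := (pfToEf N).obj T) (Y := efObj e E₂.property)
      ((arrowOfHilb N).map f.right ≫ fromZero (𝟙 E₂.obj)) f).2 ⟨0, ?_⟩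
    rw [zero_comp, sub_eq_zero]
    exact (Category.comp_id f.right).symm
  exact {T} g hg := by
    obtain ⟨h, hh⟩ : ∃ h : T.obj ⟶ E₁, g.hom ≫ 𝟙 E₂.obj = h ≫ e :=
      (efHom_eq_zero_iff (X := (pfToEf N).obj T) (Y := efObj e E₂.property)
        ((arrowOfHilb N).map g.hom ≫ fromZero (𝟙 E₂.obj))).1 hg
    refine ⟨ObjectProperty.homMk (h ≫ p), ObjectProperty.hom_ext _ ?_⟩
    change (h ≫ p) ≫ i ≫ e = g.hom
    rw [Category.assoc, hp, ← hh, Category.comp_id]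
  desc {Z} f hf := by
    obtain ⟨f, rfl⟩ := efHom_surjective f
    let v : E₂.obj ⟶ Z.obj.as.right := f.right
    obtain ⟨T, hT⟩ : ∃ T : Y.obj ⟶ Z.obj.as.left, (i ≫ e) ≫ v = T ≫ Z.obj.as.hom :=
      (efHom_eq_zero_iff (X := (pfToEf N).obj Y) (Y := Z) ((arrowOfHilb N).map (i ≫ e) ≫ f)).1 hf
    have hw : (p ≫ T) ≫ Z.obj.as.hom = e ≫ v := by
      rw [Category.assoc, ← hT, ← Category.assoc, hp]
    refine ⟨efHom (X := efObj e E₂.property)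
      (Arrow.homMk (f := Arrow.mk e) (u := p ≫ T) (v := v) hw), ?_⟩
    · refine (efHom_eq_iff (X := (pfToEf N).obj E₂) (Y := Z) _ f).2 ⟨0, ?_⟩
      rw [zero_comp, sub_eq_zero]
      exact (Category.id_comp v).symm
  epi := by
    refine Preadditive.epi_of_cancel_zero _ fun {Z} g hg => ?_
    obtain ⟨g, rfl⟩ := efHom_surjective g
    obtain ⟨T, hT⟩ := (efHom_eq_zero_iff (X := (pfToEf N).obj E₂) (Y := Z)
      (fromZero (Y := Arrow.mk e) (𝟙 E₂.obj) ≫ g)).1 hg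
    exact (efHom_eq_zero_iff (X := efObj e E₂.property) (Y := Z) g).2
      ⟨T, (Category.id_comp g.right).symm.trans hT⟩

/-- Every object of `E_f(A)` is the cokernel of a morphism of finite type: the source of
`e : E₁ ⟶ E₂` can be replaced by the orthogonal complement of the kernel of `e`, which is of
finite type as it embeds in `E₂`. -/
lemma isFreyd_pfToEf : IsFreyd (pfToEf N) where
  pres X := by
    let e := X.obj.as.hom
    let ι := HilbMod.kerι e
    have hι : ι ≫ HilbMod.adj ι = 𝟙 _ := HilbMod.comp_adj_of_isometry ι fun _ => rfl
    let i := HilbMod.kerι (HilbMod.adj ι)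
    let p := HilbMod.kerLift (HilbMod.adj ι) (𝟙 _ - HilbMod.adj ι ≫ ι) (by
      rw [Preadditive.sub_comp, Category.id_comp, Category.assoc, hι, Category.comp_id, sub_self])
    have hp : p ≫ i ≫ e = e := by
      rw [← Category.assoc, HilbMod.kerLift_kerι, Preadditive.sub_comp, Category.id_comp,
        Category.assoc, HilbMod.kerι_comp, comp_zero, sub_zero]
    have hinj : Function.Injective (HilbMod.toCLM (i ≫ e)) := by
      refine (injective_iff_map_eq_zero (HilbMod.toCLM (i ≫ e))).2 fun x hx => ?_
      obtain ⟨k, hk⟩ := HilbMod.exists_kerι e hx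
      have h₁ : HilbMod.toCLM (HilbMod.adj ι) (HilbMod.toCLM i x) = 0 :=
        congrArg (fun f => HilbMod.toCLM f x) (HilbMod.kerι_comp (HilbMod.adj ι))
      have h₂ : k = 0 := (congrArg (fun f => HilbMod.toCLM f k) hι).symm.trans
        ((congrArg (HilbMod.toCLM (HilbMod.adj ι)) hk).trans h₁)
      have h₃ : HilbMod.toCLM i x = 0 :=
        hk.symm.trans ((congrArg (HilbMod.toCLM ι) h₂).trans (map_zero _))
      exact HilbMod.kerι_injective _ (h₃.trans (map_zero _).symm)
    exact ⟨⟨_, X.property.of_injective _ hinj⟩, ⟨_, X.property⟩, _, _,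
      isPres_efObj ⟨_, X.property⟩ e ⟨_, X.property.of_injective _ hinj⟩ i p hp⟩
  coker {Y₁ Y₂} y := ⟨_, _, isPres_efObj Y₂ y.hom Y₁ (𝟙 _) (𝟙 _) (by simp)⟩

lemma isAbelian_ef : IsAbelian (Ef N) := isFreyd_pfToEf.isAbelian

instance : (pfToEf N).Faithful where
  map_injective {X Y f g} h := by
    obtain ⟨T, hT⟩ : ∃ T : X.obj ⟶ HilbMod.zero N, g.hom - f.hom = T ≫ 0 :=
      (efHom_eq_iff (X := (pfToEf N).obj X) (Y := (pfToEf N).obj Y)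
        ((arrowOfHilb N).map f.hom) ((arrowOfHilb N).map g.hom)).1 h
    rw [comp_zero, sub_eq_zero] at hT
    exact ObjectProperty.hom_ext _ hT.symm

instance : (pfToEf N).Full where
  map_surjective {X Y} f := by
    obtain ⟨f, rfl⟩ := efHom_surjective f
    refine ⟨ObjectProperty.homMk f.right, ?_⟩
    refine (efHom_eq_iff (X := (pfToEf N).obj X) (Y := (pfToEf N).obj Y)
      ((arrowOfHilb N).map f.right) f).2 ⟨0, ?_⟩
    rw [zero_comp, sub_eq_zero]
    rfl

/-! ### The functor `μ` is an equivalence -/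

section QuasiIso

variable {C : Type*} [Category C] [Preadditive C]

lemma quasiIso_iff_acyclic [IsAbelian C] [HasBinaryBiproducts C] {F G : CochainComplex C ℤ}
    (σ : F ⟶ G) :
    HomotopyCategory.quasiIso C (ComplexShape.up ℤ)
      ((HomotopyCategory.quotient C (ComplexShape.up ℤ)).map σ) ↔
      (CochainComplex.mappingCone σ).Acyclic := by
  let _ := IsAbelian.abelian C
  have h := (HomotopyCategory.subcategoryAcyclic C).trW_iff_of_distinguished _
    (HomotopyCategory.mappingCone_triangleh_distinguished σ)
  rw [← HomotopyCategory.quasiIso_eq_trW_subcategoryAcyclic] at h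
  exact h.trans (HomotopyCategory.quotient_obj_mem_subcategoryAcyclic_iff_acyclic _)

lemma liftsIn_of_acyclic [IsAbelian C] {X : CochainComplex C ℤ} (hX : X.Acyclic) (T : C)
    [Projective T] : LiftsIn T X := by
  let _ := IsAbelian.abelian C
  intro k f hf
  have h := (HomologicalComplex.exactAt_iff' X k (k + 1) (k + 1 + 1) (by simp) (by simp)).1
    (hX (k + 1))
  exact ⟨h.liftFromProjective f hf, h.liftFromProjective_comp f hf⟩

end QuasiIso

section Freyd

variable {P E : Type*} [Category.{u} P] [Category.{u} E] [Preadditive E] {Φ : P ⥤ E}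

/-- Exactness can be tested on morphisms from objects of `P`, since every object is covered by
them. -/
lemma IsFreyd.acyclic [IsAbelian E] (hΦ : IsFreyd Φ) {X : CochainComplex E ℤ}
    (hX : ∀ T, LiftsIn (Φ.obj T) X) : X.Acyclic := by
  let _ := IsAbelian.abelian E
  intro j
  obtain ⟨k, rfl⟩ : ∃ k, j = k + 1 := ⟨j - 1, by omega⟩
  rw [HomologicalComplex.exactAt_iff' X k (k + 1) (k + 1 + 1) (by simp) (by simp),
    ShortComplex.exact_iff_exact_up_to_refinements]
  intro S (x : S ⟶ X.X (k + 1)) (hx : x ≫ X.d (k + 1) (k + 1 + 1) = 0)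
  obtain ⟨_, T, _, π, hπ⟩ := hΦ.pres S
  obtain ⟨g, hg⟩ := hX T k (π ≫ x) (by rw [Category.assoc, hx, comp_zero])
  exact ⟨Φ.obj T, π, hπ.epi, g, hg.symm⟩

variable [Preadditive P] [Φ.Additive] [Φ.Full] [Φ.Faithful] [HasKernels P] [HasZeroObject P]

/-- The functor represented by `Φ T`, on whose values exactness in `E` is tested. -/
abbrev points (Φ : P ⥤ E) (T : P) : E ⥤ AddCommGrpCat.{u} :=
  preadditiveCoyoneda.obj (Opposite.op (Φ.obj T))

/-- Every bounded or bounded above complex of `E` has a resolution by objects of `P`. -/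
lemma IsFreyd.exists_resolution [IsAbelian E] (hΦ : IsFreyd Φ) (F : CochainComplex E ℤ) (β : Bound)
    (hF : IsBounded β F) :
    ∃ L : CochainComplex P ℤ, IsBounded β L ∧
      ∃ φ : (Φ.mapHomologicalComplex (ComplexShape.up ℤ)).obj L ⟶ F,
        ∀ T, IsCohIso (points Φ T) φ := by
  let _ := IsAbelian.abelian E
  refine Montel.exists_resolution Φ (points Φ) (fun {L L'} d => ?_) F β hF ?_
  · refine ⟨kernel d, kernel.ι d, inferInstance, kernel.condition d, fun T x hx => ?_⟩
    obtain ⟨x, rfl⟩ := Φ.map_surjective x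
    have hx' : x ≫ d = 0 := Φ.map_injective (by rw [Φ.map_comp, Φ.map_zero]; exact hx)
    exact ⟨Φ.map (kernel.lift d x hx'), by
      change Φ.map _ ≫ Φ.map _ = _
      rw [← Φ.map_comp, kernel.lift_ι]⟩
  · rintro k L L' d φ ⟨φ', hφ'⟩
    let m : Φ.obj L ⊞ F.X k ⟶ Φ.obj L' ⊞ F.X (k + 1) :=
      biprod.lift (biprod.fst ≫ Φ.map d) (biprod.fst ≫ φ - biprod.snd ≫ F.d k (k + 1))
    obtain ⟨_, T, _, π, hπ⟩ := hΦ.pres (kernel m)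
    have h₁ : kernel.ι m ≫ biprod.fst ≫ Φ.map d = 0 := by
      have := congrArg (fun f => f ≫ biprod.fst) (kernel.condition m)
      rwa [Category.assoc, biprod.lift_fst, zero_comp] at this
    have h₂ : kernel.ι m ≫ biprod.snd ≫ F.d k (k + 1) = kernel.ι m ≫ biprod.fst ≫ φ := by
      have := congrArg (fun f => f ≫ biprod.snd) (kernel.condition m)
      simp only [m, Category.assoc, biprod.lift_snd, Preadditive.comp_sub, zero_comp] at this
      exact (sub_eq_zero.1 this).symm
    refine ⟨T, Φ.preimage (π ≫ kernel.ι m ≫ biprod.fst), π ≫ kernel.ι m ≫ biprod.snd, ?_, ?_, ?_⟩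
    · exact Φ.map_injective (by simp [h₁])
    · simp [h₂]
    · intro S i _
      change ∀ (x : Φ.obj S ⟶ Φ.obj L) (y : Φ.obj S ⟶ F.X k), x ≫ Φ.map d = 0 →
        x ≫ φ = y ≫ F.d k (k + 1) → ∃ (l : Φ.obj S ⟶ Φ.obj T) (v : Φ.obj S ⟶ F.X i),
          l ≫ Φ.map _ = x ∧ y = l ≫ π ≫ kernel.ι m ≫ biprod.snd + v ≫ F.d i k
      intro x y hx hy
      obtain ⟨l, hl⟩ := hπ.lift (kernel.lift m (biprod.lift x y) (by
        apply biprod.hom_ext <;> simp [m, hx, hy]))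
      refine ⟨Φ.map l, 0, ?_, ?_⟩
      · rw [Functor.map_preimage, ← Category.assoc, hl]
        simp
      · rw [zero_comp, add_zero, ← Category.assoc, hl]
        simp

end Freyd

lemma IsBounded.exists_isZero {C : Type*} [Category C] [Preadditive C] {i : Bound}
    {F : CochainComplex C ℤ} (h : IsBounded i F) : ∃ n, ∀ k, n < k → IsZero (F.X k) := by
  cases i with
  | b => obtain ⟨_, n, h⟩ := h; exact ⟨n, fun k hk => h k (Or.inr hk)⟩
  | minus => exact h

section MapK

variable {C D : Type*} [Category C] [Preadditive C] [Category D] [Preadditive D]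
  (Φ : C ⥤ D) [Φ.Additive] [Φ.Full] [Φ.Faithful] (i : Bound)

instance : (mapK Φ i).Full where
  map_surjective f := by
    obtain ⟨g, hg⟩ := (Φ.mapHomotopyCategory (ComplexShape.up ℤ)).map_surjective f.hom
    exact ⟨ObjectProperty.homMk g, ObjectProperty.hom_ext _ hg⟩

instance : (mapK Φ i).Faithful where
  map_injective h := ObjectProperty.hom_ext _
    ((Φ.mapHomotopyCategory (ComplexShape.up ℤ)).map_injective (congrArg (fun f => f.hom) h))

end MapK

section Mu

variable {P E : Type*} [Category.{u} P] [Category.{u} E] [Preadditive P] [Preadditive E] {Φ : P ⥤ E}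
  [Φ.Additive] [Φ.Full] [Φ.Faithful] [HasKernels P] [HasZeroObject P] [HasBinaryBiproducts P]

lemma IsFreyd.isEquivalence [IsAbelian E] (hΦ : IsFreyd Φ) (i : Bound) :
    (mapK Φ i ⋙ (quasiIsos E i).Q).IsEquivalence := by
  let _ := IsAbelian.abelian E
  refine isEquivalence_comp_Q _ _ (fun L X Y w hw => ?_) fun X => ?_
  · obtain ⟨σ, hσ⟩ := (HomotopyCategory.quotient E (ComplexShape.up ℤ)).map_surjective
      (X := X.obj.as) (Y := Y.obj.as) w.hom
    have hw' : HomotopyCategory.quasiIso E (ComplexShape.up ℤ) w.hom := hw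
    rw [← hσ] at hw'
    replace hw' := (quasiIso_iff_acyclic σ).1 hw'
    obtain ⟨n, hn⟩ := L.property.exists_isZero
    have h := comp_quotient_map_bijective
      (M := (Φ.mapHomologicalComplex (ComplexShape.up ℤ)).obj L.obj.as) σ n
      (fun k hk => Φ.map_isZero (hn k hk)) (fun k => by
        have := hΦ.projective (L.obj.as.X k)
        exact liftsIn_of_acyclic hw' (Φ.obj (L.obj.as.X k)))
    rw [hσ] at h
    constructor
    · intro f g hfg
      exact ObjectProperty.hom_ext _ (h.1 (congrArg (fun f => f.hom) hfg))
    · intro f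
      obtain ⟨g, hg⟩ := h.2 f.hom
      exact ⟨ObjectProperty.homMk g, ObjectProperty.hom_ext _ hg⟩
  · obtain ⟨L, hL, φ, hφ⟩ := hΦ.exists_resolution X.obj.as i X.property
    refine ⟨⟨(HomotopyCategory.quotient P (ComplexShape.up ℤ)).obj L, hL⟩,
      ObjectProperty.homMk ((HomotopyCategory.quotient E (ComplexShape.up ℤ)).map φ), ?_⟩
    refine (quasiIso_iff_acyclic φ).2 (hΦ.acyclic fun T k f hf => ?_)
    exact (hφ T).exact_mappingCone _ k f hf

end Mu

lemma isEquivalence_mu [IsAbelian (Ef N)] (i : Bound) : (mu N i).IsEquivalence :=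
  isFreyd_pfToEf.isEquivalence i

open Filter Topology

/-! ### Direct sums of montelian modules -/

namespace PreMont

lemma hom_ext {V W : PreMont N} {φ ψ : V ⟶ W} (h : ∀ t, app φ t = app ψ t) : φ = ψ :=
  Subtype.ext (funext h)

/-- The direct sum of two premontelian modules. -/
def prod (V W : PreMont N) : PreMont N where
  t₀ := min V.t₀ W.t₀
  t₀_pos := lt_min V.t₀_pos W.t₀_pos
  obj t := HilbMod.prod (V.obj t) (W.obj t)
  ρ t t' := HilbMod.pair (HilbMod.fst _ _ ≫ V.ρ t t') (HilbMod.snd _ _ ≫ W.ρ t t')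
  ρ_self t h h' := by
    rw [V.ρ_self t h (h'.trans (min_le_left _ _)), W.ρ_self t h (h'.trans (min_le_right _ _))]
    rfl
  ρ_comp t t' t'' h₁ h₂ h₃ h₄ := by
    rw [← V.ρ_comp t t' t'' h₁ h₂ h₃ (h₄.trans (min_le_left _ _)),
      ← W.ρ_comp t t' t'' h₁ h₂ h₃ (h₄.trans (min_le_right _ _))]
    rfl
  ρ_compact t t' h₁ h₂ h₃ :=
    (HilbMod.IsApprox.pair
      ((V.ρ_compact t t' h₁ h₂ (h₃.trans (min_le_left _ _))).isApprox.precomp _)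
      ((W.ρ_compact t t' h₁ h₂ (h₃.trans (min_le_right _ _))).isApprox.precomp _)).isACompact

/-- A family of morphisms that is compatible with the transition maps for small parameters. -/
def mkHom {V W : PreMont N} (φ : ∀ t, V.obj t ⟶ W.obj t) (ε : ℝ) (hε : 0 < ε)
    (h : ∀ t t', 0 < t' → t' ≤ t → t < ε → φ t ≫ W.ρ t t' = V.ρ t t' ≫ φ t') : V ⟶ W :=
  ⟨φ, ε, hε, h⟩

/-- The biproduct diagram of two premontelian modules. -/
def bicone (V W : PreMont N) : BinaryBicone V W where
  pt := prod V W
  fst := mkHom (V := prod V W) (fun t => HilbMod.fst (V.obj t) (W.obj t)) 1 one_pos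
    fun _ _ _ _ _ => rfl
  snd := mkHom (V := prod V W) (fun t => HilbMod.snd (V.obj t) (W.obj t)) 1 one_pos
    fun _ _ _ _ _ => rfl
  inl := mkHom (W := prod V W) (fun t => HilbMod.pair (𝟙 (V.obj t)) 0) 1 one_pos
    fun t t' _ _ _ => HilbMod.hom_ext fun _ => HilbMod.prod_ext rfl
      (map_zero (HilbMod.toCLM (W.ρ t t')))
  inr := mkHom (W := prod V W) (fun t => HilbMod.pair 0 (𝟙 (W.obj t))) 1 one_pos
    fun t t' _ _ _ => HilbMod.hom_ext fun _ => HilbMod.prod_ext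
      (map_zero (HilbMod.toCLM (V.ρ t t'))) rfl
  inl_fst := hom_ext fun _ => HilbMod.pair_fst _ _
  inl_snd := hom_ext fun _ => HilbMod.pair_snd _ _
  inr_fst := hom_ext fun _ => HilbMod.pair_fst _ _
  inr_snd := hom_ext fun _ => HilbMod.pair_snd _ _

lemma total (V W : PreMont N) : (bicone V W).fst ≫ (bicone V W).inl +
    (bicone V W).snd ≫ (bicone V W).inr = 𝟙 (bicone V W).pt :=
  hom_ext fun t => by
    have h₁ : app ((bicone V W).fst ≫ (bicone V W).inl) t =
      HilbMod.fst (V.obj t) (W.obj t) ≫ HilbMod.pair (𝟙 (V.obj t)) 0 := rfl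
    have h₂ : app ((bicone V W).snd ≫ (bicone V W).inr) t =
      HilbMod.snd (V.obj t) (W.obj t) ≫ HilbMod.pair 0 (𝟙 (W.obj t)) := rfl
    have h₃ : app ((bicone V W).fst ≫ (bicone V W).inl + (bicone V W).snd ≫ (bicone V W).inr) t =
      app ((bicone V W).fst ≫ (bicone V W).inl) t +
        app ((bicone V W).snd ≫ (bicone V W).inr) t := rfl
    exact h₃.trans ((congrArg₂ (· + ·) h₁ h₂).trans (HilbMod.prod_total (V.obj t) (W.obj t)))

end PreMont

instance : HasBinaryBiproducts (Mont N) where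
  has_binary_biproduct V W :=
    hasBinaryBiproduct_of_total (X := V) (Y := W)
      ((Quotient.functor (germRel N)).mapBinaryBicone (PreMont.bicone V.as W.as)) (by
        have h := congrArg (Quotient.functor (germRel N)).map (PreMont.total V.as W.as)
        rw [Functor.map_add, Functor.map_comp, Functor.map_comp] at h
        exact h.trans ((Quotient.functor (germRel N)).map_id _))

instance : HasZeroObject (Mont N) := by
  refine ⟨⟨(pfToMont N).obj ⟨HilbMod.zero N, HilbMod.finiteType_zero⟩, ?_⟩⟩
  refine (pfToMont N).map_isZero ?_
  rw [IsZero.iff_id_eq_zero]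
  exact ObjectProperty.hom_ext _ (HilbMod.isZero_zero.eq_of_src _ _)

/-! ### Germs of sections -/

lemma eventually_forall_lt {p : ℝ → Prop} (h : ∀ᶠ s in 𝓝[>] (0 : ℝ), p s) :
    ∀ᶠ t in 𝓝[>] (0 : ℝ), ∀ s, 0 < s → s < t → p s := by
  obtain ⟨ε, hε, h⟩ := mem_nhdsGT_iff_exists_Ioo_subset.1 h
  filter_upwards [Ioo_mem_nhdsGT hε] with t ht s h₀ h₁
  exact h ⟨h₀, h₁.trans ht.2⟩

lemma eventually_pos : ∀ᶠ t in 𝓝[>] (0 : ℝ), 0 < t := eventually_mem_nhdsWithin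

lemma eventually_lt {ε : ℝ} (hε : 0 < ε) : ∀ᶠ t in 𝓝[>] (0 : ℝ), t < ε := by
  filter_upwards [Ioo_mem_nhdsGT hε] with t ht using ht.2

lemma eventually_iff_exists {p : ℝ → Prop} :
    (∀ᶠ t in 𝓝[>] (0 : ℝ), p t) ↔ ∃ ε > 0, ∀ t, 0 < t → t < ε → p t := by
  refine mem_nhdsGT_iff_exists_Ioo_subset.trans ?_
  exact ⟨fun ⟨ε, hε, h⟩ => ⟨ε, hε, fun t h₀ h₁ => h ⟨h₀, h₁⟩⟩,
    fun ⟨ε, hε, h⟩ => ⟨ε, hε, fun t ht => h t ht.1 ht.2⟩⟩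

lemma forSmall_iff {P : ℝ → ℝ → Prop} :
    ForSmall P ↔ ∀ᶠ t in 𝓝[>] (0 : ℝ), ∀ t', 0 < t' → t' ≤ t → P t t' := by
  rw [eventually_iff_exists]
  exact ⟨fun ⟨ε, hε, h⟩ => ⟨ε, hε, fun t _ h₁ t' h₂ h₃ => h t t' h₂ h₃ h₁⟩,
    fun ⟨ε, hε, h⟩ => ⟨ε, hε, fun t t' h₂ h₃ h₁ => h t (h₂.trans_le h₃) h₁ t' h₂ h₃⟩⟩

namespace PreMont

/-- The family `x` is a section over `]0, t[`. -/
def IsFlat (W : PreMont N) (t : ℝ) (x : ∀ s, W.obj s) : Prop :=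
  ∀ s s', 0 < s' → s' ≤ s → s < t → HilbMod.toCLM (W.ρ s s') (x s) = x s'

lemma IsFlat.mono {W : PreMont N} {t t' : ℝ} {x : ∀ s, W.obj s} (h : W.IsFlat t x) (ht : t' ≤ t) :
    W.IsFlat t' x := fun s s' h₁ h₂ h₃ => h s s' h₁ h₂ (h₃.trans_le ht)

/-- The families that are sections for small parameters. -/
def sections (W : PreMont N) : AddSubgroup (∀ s, W.obj s) where
  carrier := {x | ∀ᶠ t in 𝓝[>] (0 : ℝ), W.IsFlat t x}
  zero_mem' := (Eventually.of_forall fun t s s' _ _ _ => map_zero _ :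
    ∀ᶠ t in 𝓝[>] (0 : ℝ), W.IsFlat t 0)
  add_mem' {x y} hx hy := by
    change ∀ᶠ t in 𝓝[>] (0 : ℝ), W.IsFlat t (x + y)
    filter_upwards [show ∀ᶠ t in 𝓝[>] (0 : ℝ), W.IsFlat t x from hx,
      show ∀ᶠ t in 𝓝[>] (0 : ℝ), W.IsFlat t y from hy] with t hx hy s s' h₁ h₂ h₃
    rw [Pi.add_apply, Pi.add_apply, map_add, hx s s' h₁ h₂ h₃, hy s s' h₁ h₂ h₃]
  neg_mem' {x} hx := by
    change ∀ᶠ t in 𝓝[>] (0 : ℝ), W.IsFlat t (-x)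
    filter_upwards [show ∀ᶠ t in 𝓝[>] (0 : ℝ), W.IsFlat t x from hx] with t hx s s' h₁ h₂ h₃
    rw [Pi.neg_apply, Pi.neg_apply, map_neg, hx s s' h₁ h₂ h₃]

/-- The sections that vanish for small parameters. -/
def nullSections (W : PreMont N) : AddSubgroup W.sections where
  carrier := {x | ∀ᶠ s in 𝓝[>] (0 : ℝ), x.1 s = 0}
  zero_mem' := (Eventually.of_forall fun s => rfl :
    ∀ᶠ s in 𝓝[>] (0 : ℝ), (0 : W.sections).1 s = 0)
  add_mem' {x y} hx hy := by
    change ∀ᶠ s in 𝓝[>] (0 : ℝ), x.1 s + y.1 s = 0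
    filter_upwards [show ∀ᶠ s in 𝓝[>] (0 : ℝ), x.1 s = 0 from hx,
      show ∀ᶠ s in 𝓝[>] (0 : ℝ), y.1 s = 0 from hy] with s hx hy
    rw [hx, hy, add_zero]
  neg_mem' {x} hx := by
    change ∀ᶠ s in 𝓝[>] (0 : ℝ), -x.1 s = 0
    filter_upwards [show ∀ᶠ s in 𝓝[>] (0 : ℝ), x.1 s = 0 from hx] with s hx
    rw [hx, neg_zero]

lemma eventually_compat {V W : PreMont N} (φ : V ⟶ W) : ∀ᶠ t in 𝓝[>] (0 : ℝ),
    ∀ s s', 0 < s' → s' ≤ s → s < t → app φ s ≫ W.ρ s s' = V.ρ s s' ≫ app φ s' := by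
  obtain ⟨ε, hε, h⟩ := φ.2
  filter_upwards [eventually_lt hε] with t ht s s' h₁ h₂ h₃ using h s s' h₁ h₂ (h₃.trans ht)

/-- The map on sections induced by a morphism. -/
def mapSections {V W : PreMont N} (φ : V ⟶ W) : V.sections →+ W.sections where
  toFun x := ⟨fun s => HilbMod.toCLM (app φ s) (x.1 s), by
    change ∀ᶠ t in 𝓝[>] (0 : ℝ), W.IsFlat t _
    filter_upwards [show ∀ᶠ t in 𝓝[>] (0 : ℝ), V.IsFlat t x.1 from x.2,
      eventually_compat φ] with t hx hφ s s' h₁ h₂ h₃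
    have := congrArg (fun f => HilbMod.toCLM f (x.1 s)) (hφ s s' h₁ h₂ h₃)
    exact this.trans (congrArg (HilbMod.toCLM (app φ s')) (hx s s' h₁ h₂ h₃))⟩
  map_zero' := Subtype.ext (funext fun s => map_zero (HilbMod.toCLM (app φ s)))
  map_add' x y := Subtype.ext (funext fun s => map_add (HilbMod.toCLM (app φ s)) (x.1 s) (y.1 s))

/-- The functor of germs of sections at `0`, on premontelian modules. -/
def germs (N : FiniteVN A) : PreMont N ⥤ AddCommGrpCat.{u} where
  obj W := AddCommGrpCat.of (W.sections ⧸ W.nullSections)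
  map {V W} φ := AddCommGrpCat.ofHom (QuotientAddGroup.map _ _ (mapSections φ) (by
    intro x hx
    have hx' : ∀ᶠ s in 𝓝[>] (0 : ℝ), x.1 s = 0 := hx
    change ∀ᶠ s in 𝓝[>] (0 : ℝ), HilbMod.toCLM (app φ s) (x.1 s) = 0
    filter_upwards [hx'] with s hs
    rw [hs, map_zero]))
  map_id V := by
    ext x
    rfl
  map_comp φ ψ := by
    ext x
    rfl

end PreMont

/-- The functor of germs of sections at `0`. -/
def germs (N : FiniteVN A) : Mont N ⥤ AddCommGrpCat.{u} :=
  CategoryTheory.Quotient.lift (germRel N) (PreMont.germs N) (by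
    rintro V W φ ψ ⟨ε, hε, h⟩
    refine AddCommGrpCat.hom_ext
      (QuotientAddGroup.addMonoidHom_ext _ (AddMonoidHom.ext fun x => ?_))
    refine (QuotientAddGroup.eq_iff_sub_mem (N := W.nullSections)
      (x := PreMont.mapSections φ x) (y := PreMont.mapSections ψ x)).2 ?_
    change ∀ᶠ s in 𝓝[>] (0 : ℝ),
      HilbMod.toCLM (PreMont.app φ s) (x.1 s) - HilbMod.toCLM (PreMont.app ψ s) (x.1 s) = 0
    filter_upwards [eventually_lt hε, eventually_pos] with s h₁ h₂
    rw [h s h₂ h₁, sub_self])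

instance : (germs N).Additive where
  map_add {V W φ ψ} := by
    obtain ⟨φ, rfl⟩ := (Quotient.functor (germRel N)).map_surjective φ
    obtain ⟨ψ, rfl⟩ := (Quotient.functor (germRel N)).map_surjective ψ
    rw [← Functor.map_add]
    change (PreMont.germs N).map (φ + ψ) = (PreMont.germs N).map φ + (PreMont.germs N).map ψ
    refine AddCommGrpCat.hom_ext
      (QuotientAddGroup.addMonoidHom_ext _ (AddMonoidHom.ext fun x => ?_))
    rfl

/-- The family `x` represents the germ of sections `a`. -/
def Represents {W : Mont N} (x : ∀ s, W.as.obj s) (a : (germs N).obj W) : Prop :=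
  ∃ h : x ∈ W.as.sections, QuotientAddGroup.mk (s := W.as.nullSections) ⟨x, h⟩ = a

namespace Represents

variable {V W : Mont N} {x y : ∀ s, W.as.obj s} {a b : (germs N).obj W}

lemma _root_.Montel.exists_represents (a : (germs N).obj W) : ∃ x, Represents x a := by
  obtain ⟨⟨x, hx⟩, rfl⟩ := QuotientAddGroup.mk_surjective (s := W.as.nullSections) a
  exact ⟨x, hx, rfl⟩

lemma _root_.Montel.exists_germ {t : ℝ} (ht : 0 < t) (h : W.as.IsFlat t x) :
    ∃ a : (germs N).obj W, Represents x a :=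
  ⟨_, show ∀ᶠ t in 𝓝[>] (0 : ℝ), W.as.IsFlat t x by
    filter_upwards [eventually_lt ht] with r hr using h.mono hr.le, rfl⟩

lemma isFlat (h : Represents x a) : ∀ᶠ t in 𝓝[>] (0 : ℝ), W.as.IsFlat t x := h.1

lemma add (hx : Represents x a) (hy : Represents y b) : Represents (x + y) (a + b) := by
  obtain ⟨hx, rfl⟩ := hx
  obtain ⟨hy, rfl⟩ := hy
  exact ⟨add_mem hx hy, rfl⟩

lemma sub (hx : Represents x a) (hy : Represents y b) : Represents (x - y) (a - b) := by
  obtain ⟨hx, rfl⟩ := hx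
  obtain ⟨hy, rfl⟩ := hy
  exact ⟨sub_mem hx hy, rfl⟩

lemma eq_zero_iff (hx : Represents x a) : a = 0 ↔ ∀ᶠ s in 𝓝[>] (0 : ℝ), x s = 0 := by
  obtain ⟨hx, rfl⟩ := hx
  exact QuotientAddGroup.eq_zero_iff _

lemma eq_iff (hx : Represents x a) (hy : Represents y b) :
    a = b ↔ ∀ᶠ s in 𝓝[>] (0 : ℝ), x s = y s := by
  rw [← sub_eq_zero, (hx.sub hy).eq_zero_iff]
  exact eventually_congr (Eventually.of_forall fun s => sub_eq_zero)

lemma map {x : ∀ s, V.as.obj s} {a : (germs N).obj V} (hx : Represents x a) (φ : V ⟶ W) :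
    Represents (fun s => HilbMod.toCLM (PreMont.app (rep φ) s) (x s)) ((germs N).map φ a) := by
  obtain ⟨hx, rfl⟩ := hx
  refine ⟨(PreMont.mapSections (rep φ) ⟨x, hx⟩).2, ?_⟩
  conv_rhs => rw [← (Quotient.functor (germRel N)).map_preimage φ]
  rfl

end Represents

lemma eventually_rep_map {V W : PreMont N} (φ : V ⟶ W) : ∀ᶠ s in 𝓝[>] (0 : ℝ),
    PreMont.app (rep ((Quotient.functor (germRel N)).map φ)) s = PreMont.app φ s :=
  eventually_iff_exists.2 (rep_map φ)

lemma hom_ext_rep {V W : Mont N} {φ ψ : V ⟶ W}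
    (h : ∀ᶠ s in 𝓝[>] (0 : ℝ), PreMont.app (rep φ) s = PreMont.app (rep ψ) s) : φ = ψ := by
  rw [← (Quotient.functor (germRel N)).map_preimage φ,
    ← (Quotient.functor (germRel N)).map_preimage ψ]
  exact (Quotient.functor_map_eq_iff (germRel N) _ _).2 (eventually_iff_exists.1 h)

lemma eventually_rep_comp {U V W : Mont N} (φ : U ⟶ V) (ψ : V ⟶ W) : ∀ᶠ s in 𝓝[>] (0 : ℝ),
    PreMont.app (rep (φ ≫ ψ)) s = PreMont.app (rep φ) s ≫ PreMont.app (rep ψ) s := by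
  have := eventually_rep_map (rep φ ≫ rep ψ)
  have h : (Quotient.functor (germRel N)).map (rep φ ≫ rep ψ) = φ ≫ ψ := by
    rw [Functor.map_comp, rep, rep, Functor.map_preimage, Functor.map_preimage]
  rwa [h] at this

lemma eventually_rep_id (V : Mont N) : ∀ᶠ s in 𝓝[>] (0 : ℝ),
    PreMont.app (rep (𝟙 V)) s = 𝟙 _ := by
  have := eventually_rep_map (𝟙 V.as)
  rw [CategoryTheory.Functor.map_id] at this
  exact this

lemma eventually_rep_const {L L' : Pf N} (f : L ⟶ L') : ∀ᶠ s in 𝓝[>] (0 : ℝ),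
    PreMont.app (rep ((pfToMont N).map f)) s = f.hom :=
  eventually_rep_map ((constFunctor N).map f)

/-! ### Morphisms from constant modules -/

/-- The value at `s` of a representative of a germ of morphisms. -/
abbrev level {V W : Mont N} (φ : V ⟶ W) (s : ℝ) : V.as.obj s ⟶ W.as.obj s :=
  PreMont.app (rep φ) s

lemma eventually_level_comp {V W : Mont N} (φ : V ⟶ W) : ∀ᶠ s in 𝓝[>] (0 : ℝ), ∀ s', 0 < s' →
    s' ≤ s → ∀ x, HilbMod.toCLM (W.as.ρ s s') (HilbMod.toCLM (level φ s) x) =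
      HilbMod.toCLM (level φ s') (HilbMod.toCLM (V.as.ρ s s') x) := by
  obtain ⟨ε, hε, h⟩ := (rep φ).2
  filter_upwards [eventually_lt hε] with s hs s' h₁ h₂ x
  exact congrArg (fun f => HilbMod.toCLM f x) (h s s' h₁ h₂ hs)

lemma isFlat_transition (W : Mont N) {s : ℝ} (hs : s ≤ W.as.t₀) (x : W.as.obj s) :
    W.as.IsFlat s fun r => HilbMod.toCLM (W.as.ρ s r) x := fun r r' h₁ h₂ h₃ =>
  congrArg (fun f => HilbMod.toCLM f x) (W.as.ρ_comp s r r' h₁ h₂ h₃.le hs)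

lemma isFlat_const (L : Pf N) (t : ℝ) (x : L.obj) :
    ((pfToMont N).obj L).as.IsFlat t fun _ => x := fun _ _ _ _ _ => rfl

lemma exists_represents_const {L : Pf N} (a : (germs N).obj ((pfToMont N).obj L)) :
    ∃ x : L.obj, Represents (W := (pfToMont N).obj L) (fun _ => x) a := by
  obtain ⟨y, hy⟩ := exists_represents a
  obtain ⟨t, ht, h⟩ := (hy.isFlat.and eventually_pos).exists
  obtain ⟨b, hb⟩ := exists_germ one_pos (isFlat_const L 1 (y (t / 2)))
  have : a = b := by
    refine (hy.eq_iff hb).2 ?_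
    filter_upwards [eventually_lt h, eventually_pos] with s h₁ h₂
    rcases le_total s (t / 2) with h₃ | h₃
    · exact (ht (t / 2) s h₂ h₃ (by linarith)).symm
    · exact ht s (t / 2) (by linarith) h₃ h₁
  exact ⟨y (t / 2), this ▸ hb⟩

/-- The morphism from a constant module given by a morphism to `W(s)`. -/
def ofLevel {L : Pf N} {W : Mont N} {s : ℝ} (h₀ : 0 < s) (hs : s ≤ W.as.t₀)
    (g : L.obj ⟶ W.as.obj s) : (pfToMont N).obj L ⟶ W :=
  (Quotient.functor (germRel N)).map (PreMont.mkHom (V := constObj L) (W := W.as)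
    (fun r => g ≫ W.as.ρ s r) s h₀ fun t t' h₁ h₂ h₃ =>
      (Category.assoc _ _ _).trans ((congrArg (g ≫ ·) (W.as.ρ_comp s t t' h₁ h₂ h₃.le hs)).trans
        (Category.id_comp _).symm))

lemma eventually_level_ofLevel {L : Pf N} {W : Mont N} {s : ℝ} (h₀ : 0 < s) (hs : s ≤ W.as.t₀)
    (g : L.obj ⟶ W.as.obj s) : ∀ᶠ r in 𝓝[>] (0 : ℝ), ∀ x,
      HilbMod.toCLM (level (ofLevel h₀ hs g) r) x =
        HilbMod.toCLM (W.as.ρ s r) (HilbMod.toCLM g x) := by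
  filter_upwards [eventually_rep_map (PreMont.mkHom (V := constObj L) (W := W.as)
    (fun r => g ≫ W.as.ρ s r) s h₀ fun t t' h₁ h₂ h₃ =>
      (Category.assoc _ _ _).trans ((congrArg (g ≫ ·) (W.as.ρ_comp s t t' h₁ h₂ h₃.le hs)).trans
        (Category.id_comp _).symm))] with r hr x
  exact congrArg (fun f => HilbMod.toCLM f x) hr

lemma exists_radii {q : ℝ → Prop} (h : ∀ᶠ t in 𝓝[>] (0 : ℝ), q t) :
    ∃ s : ℕ → ℝ, Tendsto s atTop (𝓝[>] 0) ∧ ∀ n, q (s n) :=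
  exists_seq_forall_of_frequently h.frequently

/-- Constant modules lift in complexes whose germs of sections are acyclic. The lift is found at
one of the levels of a sequence `s n → 0`, since every vector lifts at one of them. -/
lemma liftsIn_const (L : Pf N) (X : CochainComplex (Mont N) ℤ)
    (hX : ∀ k x, (germs N).map (X.d (k + 1) (k + 1 + 1)) x = 0 →
      ∃ y, (germs N).map (X.d k (k + 1)) y = x) : LiftsIn ((pfToMont N).obj L) X := by
  intro k f hf
  obtain ⟨s, hs, hq⟩ := exists_radii ((eventually_level_comp (X.d k (k + 1))).and
    ((eventually_level_comp f).and ((eventually_lt (X.X k).as.t₀_pos).and eventually_pos)))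
  obtain ⟨n, g, hg⟩ := HilbMod.exists_lift_of_forall (E := L.obj)
    (fun n => level (X.d k (k + 1)) (s n)) (fun n => level f (s n)) fun x => by
      obtain ⟨a, ha⟩ := exists_germ one_pos (isFlat_const L 1 x)
      obtain ⟨y, hy⟩ := hX k ((germs N).map f a) (by
        rw [← map_comp_apply, hf, map_zero_apply])
      obtain ⟨y', hy'⟩ := exists_represents y
      obtain ⟨n, hn⟩ := (hs.eventually (((hy'.map _).eq_iff (ha.map f)).1 hy)).exists
      exact ⟨n, y' (s n), hn⟩
  obtain ⟨h₁, h₂, h₃, h₄⟩ := hq n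
  refine ⟨ofLevel h₄ h₃.le g, hom_ext_rep ?_⟩
  filter_upwards [eventually_rep_comp (ofLevel h₄ h₃.le g) (X.d k (k + 1)),
    eventually_level_ofLevel h₄ h₃.le g, eventually_lt h₄, eventually_pos] with r e₁ e₂ hr h₀
  rw [e₁]
  refine HilbMod.hom_ext fun x => ?_
  rw [HilbMod.toCLM_comp, e₂, ← h₁ r h₀ hr.le]
  refine Eq.trans ?_ (h₂ r h₀ hr.le x)
  exact congrArg (fun f => HilbMod.toCLM ((X.X (k + 1)).as.ρ (s n) r) (HilbMod.toCLM f x)) hg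

/-! ### Cohomology and germs of sections -/

/-- The restriction of a family to `]0, t[`. -/
def restr {W : Mont N} (t : ℝ) (x : ∀ s, W.as.obj s) : Below W t := fun s => x s

lemma exists_restr {W : Mont N} {t : ℝ} (x : Below W t) : ∃ y, restr t y = x := by
  classical
  exact ⟨fun s => if h : s ∈ Set.Ioo 0 t then x ⟨s, h⟩ else 0, funext fun s => dif_pos s.2⟩

lemma restr_mem_projLim {W : Mont N} {t : ℝ} {x : ∀ s, W.as.obj s} :
    restr t x ∈ projLim W t ↔ W.as.IsFlat t x :=
  ⟨fun h s s' h₁ h₂ h₃ => h ⟨s, h₁.trans_le h₂, h₃⟩ ⟨s', h₁, h₂.trans_lt h₃⟩ h₂,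
    fun h s s' hs => h s s' s'.2.1 hs s.2.2⟩

/-- The image of a family of vectors. -/
def push {V W : Mont N} (φ : V ⟶ W) (x : ∀ s, V.as.obj s) : ∀ s, W.as.obj s :=
  fun s => HilbMod.toCLM (level φ s) (x s)

/-- The family `x` is a cocycle over `]0, t[`. -/
def IsCocycle (F : CochainComplex (Mont N) ℤ) (i : ℤ) (t : ℝ) (x : ∀ s, (F.X i).as.obj s) : Prop :=
  (F.X i).as.IsFlat t x ∧ ∀ s, 0 < s → s < t → push (F.d i (i + 1)) x s = 0

/-- The family `x` is over `]0, t[` the image of a section by the differential. -/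
def IsCoboundary (F : CochainComplex (Mont N) ℤ) (i j : ℤ) (t : ℝ) (x : ∀ s, (F.X j).as.obj s) :
    Prop :=
  ∃ y, (F.X i).as.IsFlat t y ∧ ∀ s, 0 < s → s < t → push (F.d i j) y s = x s

lemma restr_mem_cocycles {F : CochainComplex (Mont N) ℤ} {i : ℤ} {t : ℝ}
    {x : ∀ s, (F.X i).as.obj s} : restr t x ∈ cocycles F i t ↔ IsCocycle F i t x := by
  refine and_congr restr_mem_projLim ⟨fun h s h₁ h₂ => ?_, fun h => ?_⟩
  · exact congrFun (LinearMap.mem_ker.1 h) ⟨s, h₁, h₂⟩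
  · exact LinearMap.mem_ker.2 (funext fun s => h s s.2.1 s.2.2)

lemma restr_mem_coboundaries {F : CochainComplex (Mont N) ℤ} {i : ℤ} {t : ℝ}
    {x : ∀ s, (F.X i).as.obj s} :
    restr t x ∈ coboundaries F i t ↔ IsCoboundary F (i - 1) i t x := by
  constructor
  · rintro ⟨y, hy, h⟩
    obtain ⟨y, rfl⟩ := exists_restr y
    exact ⟨y, restr_mem_projLim.1 hy, fun s h₁ h₂ => congrFun h ⟨s, h₁, h₂⟩⟩
  · rintro ⟨y, hy, h⟩
    exact ⟨restr t y, restr_mem_projLim.2 hy, funext fun s => h s s.2.1 s.2.2⟩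

section CohMap

variable {F G : CochainComplex (Mont N) ℤ} {σ : F ⟶ G} {i : ℤ} {t t' : ℝ} (h : Induces σ i t t')
include h

lemma cohMap_injective_iff : Function.Injective (cohMap σ i t t' h) ↔
    ∀ x, IsCocycle F i t x → IsCoboundary G (i - 1) i t' (push (σ.f i) x) →
      IsCoboundary F (i - 1) i t x := by
  rw [injective_iff_map_eq_zero]
  constructor
  · intro H x hx hb
    have hz := (Submodule.Quotient.mk_eq_zero _).1
      (H (Submodule.Quotient.mk ⟨restr t x, restr_mem_cocycles.2 hx⟩)
        ((Submodule.Quotient.mk_eq_zero _).2 (restr_mem_coboundaries.2 hb)))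
    exact restr_mem_coboundaries.1 hz
  · intro H z hz
    obtain ⟨⟨z, hz'⟩, rfl⟩ := Submodule.Quotient.mk_surjective _ z
    obtain ⟨x, rfl⟩ := exists_restr z
    have hb := (Submodule.Quotient.mk_eq_zero ((coboundaries G i t').submoduleOf _)).1 hz
    exact (Submodule.Quotient.mk_eq_zero _).2 (restr_mem_coboundaries.2
      (H x (restr_mem_cocycles.1 hz') (restr_mem_coboundaries.1 hb)))

lemma cohMap_surjective_iff : Function.Surjective (cohMap σ i t t' h) ↔
    ∀ w, IsCocycle G i t' w → ∃ x, IsCocycle F i t x ∧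
      IsCoboundary G (i - 1) i t' (w - push (σ.f i) x) := by
  constructor
  · intro H w hw
    obtain ⟨z, hz⟩ := H (Submodule.Quotient.mk ⟨restr t' w, restr_mem_cocycles.2 hw⟩)
    obtain ⟨⟨z, hz'⟩, rfl⟩ := Submodule.Quotient.mk_surjective _ z
    obtain ⟨x, rfl⟩ := exists_restr z
    have hb := (Submodule.Quotient.eq ((coboundaries G i t').submoduleOf _)).1 hz.symm
    exact ⟨x, restr_mem_cocycles.1 hz', restr_mem_coboundaries.1 hb⟩
  · intro H z
    obtain ⟨⟨z, hz⟩, rfl⟩ := Submodule.Quotient.mk_surjective _ z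
    obtain ⟨w, rfl⟩ := exists_restr z
    obtain ⟨x, hx, hb⟩ := H w (restr_mem_cocycles.1 hz)
    exact ⟨Submodule.Quotient.mk ⟨restr t x, restr_mem_cocycles.2 hx⟩,
      ((Submodule.Quotient.eq ((coboundaries G i t').submoduleOf _)).2
        (restr_mem_coboundaries.2 hb)).symm⟩

end CohMap

lemma isFlat_push {V W : Mont N} (φ : V ⟶ W) : ∀ᶠ t in 𝓝[>] (0 : ℝ), ∀ t' ≤ t, ∀ x,
    V.as.IsFlat t' x → W.as.IsFlat t' (push φ x) := by
  filter_upwards [eventually_forall_lt (eventually_level_comp φ)] with t h t' ht' x hx s s' h₁ h₂ h₃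
  exact (h s (h₁.trans_le h₂) (h₃.trans_le ht') s' h₁ h₂ (x s)).trans
    (congrArg (HilbMod.toCLM (level φ s')) (hx s s' h₁ h₂ h₃))

lemma push_comm {V V' W W' : Mont N} {f : V ⟶ V'} {g : V' ⟶ W} {f' : V ⟶ W'} {g' : W' ⟶ W}
    (e : f ≫ g = f' ≫ g') : ∀ᶠ s in 𝓝[>] (0 : ℝ), ∀ x : ∀ s, V.as.obj s,
      push g (push f x) s = push g' (push f' x) s := by
  filter_upwards [eventually_rep_comp f g, eventually_rep_comp f' g'] with s h h' x
  rw [e] at h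
  exact congrArg (fun f => HilbMod.toCLM f (x s)) (h.symm.trans h')

lemma eventually_induces {F G : CochainComplex (Mont N) ℤ} (σ : F ⟶ G) (i : ℤ) :
    ForSmall (Induces σ i) := by
  rw [forSmall_iff]
  filter_upwards [isFlat_push (σ.f i), isFlat_push (σ.f (i - 1)),
    eventually_forall_lt (push_comm (σ.comm i (i + 1))),
    eventually_forall_lt (push_comm (σ.comm (i - 1) i))] with t h₁ h₂ h₃ h₄ t' ht' hle
  refine ⟨hle, fun z hz => ?_, fun z hz => ?_⟩
  · obtain ⟨x, rfl⟩ := exists_restr z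
    have hx := restr_mem_cocycles.1 hz
    refine restr_mem_cocycles.2 ⟨h₁ t' hle x (hx.1.mono hle), fun s hs hs' => ?_⟩
    rw [h₃ s hs (hs'.trans_le hle)]
    exact (congrArg (HilbMod.toCLM (level (σ.f (i + 1)) s))
      (hx.2 s hs (hs'.trans_le hle))).trans (map_zero _)
  · obtain ⟨x, rfl⟩ := exists_restr z
    obtain ⟨y, hy, e⟩ := restr_mem_coboundaries.1 hz
    change restr t' (push (σ.f i) x) ∈ coboundaries G i t'
    refine restr_mem_coboundaries.2 ⟨push (σ.f (i - 1)) y, h₂ t' hle y (hy.mono hle),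
      fun s hs hs' => ?_⟩
    rw [h₄ s hs (hs'.trans_le hle)]
    exact congrArg (HilbMod.toCLM (level (σ.f i) s)) (e s hs (hs'.trans_le hle))

lemma isQi_iff {F G : CochainComplex (Mont N) ℤ} {σ : F ⟶ G} :
    IsQi σ ↔ ∀ k, ForSmall fun t t' =>
      ∃ h : Induces σ k t t', Function.Bijective (cohMap σ k t t' h) :=
  ⟨fun h k => (h (k - 1)).1 k (by omega), fun h q => ⟨fun k _ => h k, by
    obtain ⟨ε, hε, h⟩ := h q
    exact ⟨ε, hε, fun t t' h₀ h₁ h₂ => (h t t' h₀ h₁ h₂).imp fun _ hb => hb.2⟩⟩⟩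

/-- A qi-morphism induces isomorphisms in cohomology of the germs of sections. -/
lemma IsQi.isCohIso {F G : CochainComplex (Mont N) ℤ} {σ : F ⟶ G} (hσ : IsQi σ) :
    IsCohIso (germs N) σ where
  inj := by
    intro i j hij x hx y hy
    obtain rfl : i = j - 1 := by omega
    obtain ⟨x', hx'⟩ := exists_represents x
    obtain ⟨y', hy'⟩ := exists_represents y
    obtain ⟨t, h₁, h₂, h₃, h₄, h₅, h₀⟩ := ((forSmall_iff.1 (isQi_iff.1 hσ j)).and
      (hx'.isFlat.and (hy'.isFlat.and ((eventually_forall_lt ((hx'.map _).eq_zero_iff.1 hx)).and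
        ((eventually_forall_lt (((hx'.map _).eq_iff (hy'.map _)).1 hy)).and
          eventually_pos))))).exists
    obtain ⟨hI, hb, -⟩ := h₁ t h₀ le_rfl
    obtain ⟨z, hz, e⟩ := (cohMap_injective_iff hI).1 hb x' ⟨h₂, h₄⟩
      ⟨y', h₃, fun s h h' => (h₅ s h h').symm⟩
    obtain ⟨c, hc⟩ := exists_germ h₀ hz
    refine ⟨c, ((hc.map _).eq_iff hx').2 ?_⟩
    filter_upwards [eventually_lt h₀, eventually_pos] with s h h' using e s h' h
  surj := by
    intro i j hij y hy
    obtain rfl : i = j - 1 := by omega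
    obtain ⟨y', hy'⟩ := exists_represents y
    obtain ⟨t, h₁, h₂, h₃, h₀⟩ := ((forSmall_iff.1 (isQi_iff.1 hσ j)).and
      (hy'.isFlat.and ((eventually_forall_lt ((hy'.map _).eq_zero_iff.1 hy)).and
        eventually_pos))).exists
    obtain ⟨hI, -, hb⟩ := h₁ t h₀ le_rfl
    obtain ⟨x, hx, z, hz, e⟩ := (cohMap_surjective_iff hI).1 hb y' ⟨h₂, h₃⟩
    obtain ⟨a, ha⟩ := exists_germ h₀ hx.1
    obtain ⟨c, hc⟩ := exists_germ h₀ hz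
    refine ⟨a, (ha.map _).eq_zero_iff.2 ?_, c, (hy'.eq_iff ((ha.map _).add (hc.map _))).2 ?_⟩
    · filter_upwards [eventually_lt h₀, eventually_pos] with s h h' using hx.2 s h' h
    · filter_upwards [eventually_lt h₀, eventually_pos] with s h h'
      exact eq_add_of_sub_eq' (e s h' h).symm

lemma eventually_push_id (V : Mont N) : ∀ᶠ s in 𝓝[>] (0 : ℝ), ∀ x : ∀ s, V.as.obj s,
    push (𝟙 V) x s = x s := by
  filter_upwards [eventually_rep_id V] with s h x
  exact congrArg (fun f => HilbMod.toCLM f (x s)) h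

/-- For a qhtf complex the cohomology over `]0, t[` is, for small `t`, that of the germs of
sections. -/
lemma IsQhtf.eventually {F : CochainComplex (Mont N) ℤ} (hF : IsQhtf F) {i j : ℤ}
    (hij : i + 1 = j) :
    ∀ᶠ t in 𝓝[>] (0 : ℝ),
      (∀ x, IsCocycle F j t x → ∀ a, Represents x a → ∀ b, a = (germs N).map (F.d i j) b →
        IsCoboundary F i j t x) ∧
      ∀ a, (germs N).map (F.d j (j + 1)) a = 0 → ∃ x a' b, IsCocycle F j t x ∧ Represents x a' ∧
        a = a' + (germs N).map (F.d i j) b := by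
  obtain rfl : i = j - 1 := by omega
  filter_upwards [forSmall_iff.1 (isQi_iff.1 hF j),
    eventually_forall_lt (eventually_push_id (F.X j)), eventually_pos] with t h hid h₀
  constructor
  · intro x hx a ha b hb
    obtain ⟨b', hb'⟩ := exists_represents b
    obtain ⟨t', h₁, h₂, h₃, h₄⟩ := ((eventually_forall_lt ((ha.eq_iff (hb'.map _)).1 hb)).and
      (hb'.isFlat.and ((eventually_lt h₀).and eventually_pos))).exists
    obtain ⟨hI, hinj, -⟩ := h t' h₄ h₃.le
    refine (cohMap_injective_iff hI).1 hinj x hx ⟨b', h₂, fun s hs hs' => ?_⟩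
    exact (h₁ s hs hs').symm.trans (hid s hs (hs'.trans h₃) x).symm
  · intro a ha
    obtain ⟨a', ha'⟩ := exists_represents a
    obtain ⟨t', h₁, h₂, h₃, h₄⟩ := ((eventually_forall_lt ((ha'.map _).eq_zero_iff.1 ha)).and
      (ha'.isFlat.and ((eventually_lt h₀).and eventually_pos))).exists
    obtain ⟨hI, -, hsurj⟩ := h t' h₄ h₃.le
    obtain ⟨x, hx, z, hz, e⟩ := (cohMap_surjective_iff hI).1 hsurj a' ⟨h₂, h₁⟩
    obtain ⟨b, hb⟩ := exists_germ h₀ hx.1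
    obtain ⟨c, hc⟩ := exists_germ h₄ hz
    refine ⟨x, b, c, hx, hb, (ha'.eq_iff (hb.add (hc.map _))).2 ?_⟩
    filter_upwards [eventually_lt h₄, eventually_pos] with s hs hs'
    have e' : push (F.d (j - 1) j) z s = a' s - push (𝟙 (F.X j)) x s := e s hs' hs
    rw [hid s hs' (hs.trans h₃)] at e'
    exact eq_add_of_sub_eq' e'.symm

/-- A morphism between qhtf complexes that induces isomorphisms in cohomology of the germs of
sections is a qi-morphism. -/
lemma IsCohIso.isQi {F G : CochainComplex (Mont N) ℤ} {σ : F ⟶ G} (h : IsCohIso (germs N) σ)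
    (hF : IsQhtf F) (hG : IsQhtf G) : IsQi σ := by
  refine isQi_iff.2 fun k => ?_
  have hk : k - 1 + 1 = k := by omega
  rw [forSmall_iff]
  filter_upwards [forSmall_iff.1 (eventually_induces σ k), hF.eventually hk,
    eventually_forall_lt (hG.eventually hk), hG.eventually hk] with t hI hFt hGt hGt' t' h₀ hle
  have ht : 0 < t := h₀.trans_le hle
  have hGt'' : ∀ x, IsCocycle G k t' x → ∀ a, Represents x a → ∀ b,
      a = (germs N).map (G.d (k - 1) k) b → IsCoboundary G (k - 1) k t' x := by
    rcases hle.lt_or_eq with hlt | rfl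
    · exact (hGt t' h₀ hlt).1
    · exact hGt'.1
  refine ⟨hI t' h₀ hle, (cohMap_injective_iff _).2 ?_, (cohMap_surjective_iff _).2 ?_⟩
  · rintro x hx ⟨z, hz, e⟩
    obtain ⟨a, ha⟩ := exists_germ ht hx.1
    obtain ⟨c, hc⟩ := exists_germ h₀ hz
    obtain ⟨b, hb⟩ := h.inj (k - 1) k hk a ((ha.map _).eq_zero_iff.2 (by
      filter_upwards [eventually_lt ht, eventually_pos] with s h h' using hx.2 s h' h)) c
      (((ha.map _).eq_iff (hc.map _)).2 (by
        filter_upwards [eventually_lt h₀, eventually_pos] with s h h' using (e s h' h).symm))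
    exact hFt.1 x hx a ha b hb.symm
  · intro w hw
    obtain ⟨a, ha⟩ := exists_germ h₀ hw.1
    obtain ⟨x, hx, z, hz⟩ := h.surj (k - 1) k hk a ((ha.map _).eq_zero_iff.2 (by
      filter_upwards [eventually_lt h₀, eventually_pos] with s h h' using hw.2 s h' h))
    obtain ⟨x', a', b, hx', ha', e⟩ := hFt.2 x hx
    refine ⟨x', hx', hGt'' _ ?_ _ (ha.sub (ha'.map (σ.f k)))
      (z + (germs N).map (σ.f (k - 1)) b) ?_⟩
    · have h₁ : restr t' (push (σ.f k) x') ∈ cocycles G k t' :=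
        (hI t' h₀ hle).cocycles (restr_mem_cocycles.2 hx')
      exact restr_mem_cocycles.1 (sub_mem (restr_mem_cocycles.2 hw) h₁)
    · rw [hz, e, map_add, map_add, ← map_comp_apply, ← map_comp_apply, σ.comm]
      abel

/-! ### Resolutions of qhtf complexes -/

/-- A germ of sections of `F^k` whose differential is the image of a vector `x` of the constant
module `L` is cohomologous to a section over `]0, t[`, with the same differential, where `t` depends
neither on `x` nor on the germ. -/
lemma IsQhtf.eventually_exists_section {F : CochainComplex (Mont N) ℤ} (hF : IsQhtf F) {i k : ℤ}
    (hik : i + 1 = k) {L L' : Pf N} (d : L ⟶ L') (φ : (pfToMont N).obj L ⟶ F.X (k + 1))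
    (w : ∃ φ', φ ≫ F.d (k + 1) (k + 1 + 1) = (pfToMont N).map d ≫ φ') :
    ∀ᶠ t in 𝓝[>] (0 : ℝ), ∀ (x : L.obj) ξ,
      Represents (W := (pfToMont N).obj L) (fun _ => x) ξ → HilbMod.toCLM d.hom x = 0 →
      ∀ y, (germs N).map φ ξ = (germs N).map (F.d k (k + 1)) y →
      ∃ y' b v, (F.X k).as.IsFlat t y' ∧
        (∀ s, 0 < s → s < t → push (F.d k (k + 1)) y' s = HilbMod.toCLM (level φ s) x) ∧
        Represents y' b ∧ y = b + (germs N).map (F.d i k) v := by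
  obtain ⟨φ', hφ'⟩ := w
  filter_upwards [hF.eventually hik, hF.eventually (rfl : k + 1 = k + 1), isFlat_push φ,
    eventually_forall_lt (push_comm hφ'), eventually_forall_lt (eventually_rep_const d),
    isFlat_push (F.d k (k + 1)), eventually_pos] with t h₁ h₂ h₃ h₄ h₅ h₆ h₀ x ξ hξ hx y hy
  have hc : IsCocycle F (k + 1) t (push φ fun _ => x) := by
    refine ⟨h₃ t le_rfl _ (isFlat_const L t x), fun s hs hs' => (h₄ s hs hs' fun _ => x).trans ?_⟩
    have : HilbMod.toCLM (level ((pfToMont N).map d) s) x = 0 :=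
      (congrArg (fun f => HilbMod.toCLM f x) (h₅ s hs hs')).trans hx
    exact (congrArg (HilbMod.toCLM (level φ' s)) this).trans (map_zero _)
  obtain ⟨y₁, hy₁, e₁⟩ := h₂.1 _ hc _ (hξ.map φ) y hy
  obtain ⟨b₁, hb₁⟩ := exists_germ h₀ hy₁
  obtain ⟨y₂, b₂, v, hy₂, hb₂, e₂⟩ := h₁.2 (y - b₁) (by
    rw [map_sub, sub_eq_zero, ← hy]
    refine ((hξ.map φ).eq_iff (hb₁.map _)).2 ?_
    filter_upwards [eventually_lt h₀, eventually_pos] with s h h' using (e₁ s h' h).symm)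
  refine ⟨y₁ + y₂, b₁ + b₂, v, fun s s' hs hs' hst => ?_, fun s hs hst => ?_, hb₁.add hb₂, ?_⟩
  · rw [Pi.add_apply, map_add, hy₁ s s' hs hs' hst, hy₂.1 s s' hs hs' hst]
    rfl
  · have h₇ : push (F.d k (k + 1)) (y₁ + y₂) s =
        push (F.d k (k + 1)) y₁ s + push (F.d k (k + 1)) y₂ s := map_add _ _ _
    rw [h₇, e₁ s hs hst, hy₂.2 s hs hst, add_zero]
    rfl
  · rw [add_assoc, ← e₂, add_sub_cancel]

/-- The differential at the level `s` of the cone, up to signs, of a morphism to `F` given by `φ`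
in degree `k + 1`: the map `(x, y) ↦ (d x, φ x - d y)`. -/
def coneD {F : CochainComplex (Mont N) ℤ} {k : ℤ} {L L' : Pf N} (d : L ⟶ L')
    (φ : (pfToMont N).obj L ⟶ F.X (k + 1)) (s : ℝ) :
    HilbMod.prod L.obj ((F.X k).as.obj s) ⟶ HilbMod.prod L'.obj ((F.X (k + 1)).as.obj s) :=
  HilbMod.pair (HilbMod.fst _ _ ≫ d.hom)
    (HilbMod.fst L.obj _ ≫ level φ s - HilbMod.snd L.obj _ ≫ level (F.d k (k + 1)) s)

lemma coneD_eq_zero_iff {F : CochainComplex (Mont N) ℤ} {k : ℤ} {L L' : Pf N} (d : L ⟶ L')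
    (φ : (pfToMont N).obj L ⟶ F.X (k + 1)) (s : ℝ)
    (z : HilbMod.prod L.obj ((F.X k).as.obj s)) : HilbMod.toCLM (coneD d φ s) z = 0 ↔
      HilbMod.toCLM d.hom (HilbMod.toCLM (HilbMod.fst _ _) z) = 0 ∧
      HilbMod.toCLM (level φ s) (HilbMod.toCLM (HilbMod.fst L.obj _) z) =
        HilbMod.toCLM (level (F.d k (k + 1)) s) (HilbMod.toCLM (HilbMod.snd L.obj _) z) := by
  constructor
  · intro h
    exact ⟨congrArg (HilbMod.toCLM (HilbMod.fst _ _)) h,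
      sub_eq_zero.1 (congrArg (HilbMod.toCLM (HilbMod.snd _ _)) h)⟩
  · rintro ⟨h₁, h₂⟩
    exact HilbMod.prod_ext h₁ (sub_eq_zero.2 h₂)

/-- One step of the resolution of a qhtf complex by modules of finite type. The new term generates
the kernel `Z(s)` of the differential of the cone at some level `s`, modulo the coboundaries at a
smaller level: this is a problem of finite type since all classes come from a level `t₁ > s` and
`Z(t₁) ⟶ Z(s)` is compact. -/
lemma IsQhtf.exists_step {F : CochainComplex (Mont N) ℤ} (hF : IsQhtf F) (k : ℤ) {L L' : Pf N}
    (d : L ⟶ L') (φ : (pfToMont N).obj L ⟶ F.X (k + 1))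
    (w : ∃ φ', φ ≫ F.d (k + 1) (k + 1 + 1) = (pfToMont N).map d ≫ φ') :
    ∃ (L'' : Pf N) (d'' : L'' ⟶ L) (φ'' : (pfToMont N).obj L'' ⟶ F.X k), d'' ≫ d = 0 ∧
      φ'' ≫ F.d k (k + 1) = (pfToMont N).map d'' ≫ φ ∧
      IsGoodStep (pfToMont N) (fun _ : Unit => germs N) F k d'' d φ'' φ := by
  obtain ⟨i, hik⟩ : ∃ i, i + 1 = k := ⟨k - 1, by omega⟩
  obtain ⟨t, hsec, ht₀, hcδ, hcφ, ht⟩ := ((hF.eventually_exists_section hik d φ w).and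
    ((eventually_lt (F.X k).as.t₀_pos).and
      ((eventually_forall_lt (eventually_level_comp (F.d k (k + 1)))).and
        ((eventually_forall_lt (eventually_level_comp φ)).and eventually_pos)))).exists
  let t₁ := t / 2
  let s := t / 4
  have hs : 0 < s := by positivity
  have hst₁ : s < t₁ := by simp only [s, t₁]; linarith
  have ht₁t : t₁ < t := by simp only [t₁]; linarith
  have ht₁ : 0 < t₁ := hs.trans hst₁
  have hst : s < t := hst₁.trans ht₁t
  have hs₀ : s ≤ (F.X k).as.t₀ := (hst.trans ht₀).le
  let Y := (F.X k).as
  let R : HilbMod.prod L.obj (Y.obj t₁) ⟶ HilbMod.prod L.obj (Y.obj s) :=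
    HilbMod.pair (HilbMod.fst _ _) (HilbMod.snd _ _ ≫ Y.ρ t₁ s)
  have hR : (HilbMod.kerι (coneD d φ t₁) ≫ R) ≫ coneD d φ s = 0 := by
    refine HilbMod.hom_ext fun z => (coneD_eq_zero_iff d φ s _).2 ?_
    obtain ⟨h₁, h₂⟩ := (coneD_eq_zero_iff d φ t₁ (HilbMod.toCLM (HilbMod.kerι (coneD d φ t₁)) z)).1
      (congrArg (fun f => HilbMod.toCLM f z) (HilbMod.kerι_comp (coneD d φ t₁)))
    refine ⟨h₁, ?_⟩
    have h₃ := hcφ t₁ ht₁ ht₁t s hs hst₁.le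
      (HilbMod.toCLM (HilbMod.fst L.obj _) (HilbMod.toCLM (HilbMod.kerι (coneD d φ t₁)) z))
    rw [h₂, hcδ t₁ ht₁ ht₁t s hs hst₁.le] at h₃
    exact h₃.symm
  let r := HilbMod.kerLift (coneD d φ s) (HilbMod.kerι (coneD d φ t₁) ≫ R) hR
  have hr : HilbMod.IsApprox r := by
    have h₁ : HilbMod.IsApprox R :=
      (HilbMod.isApprox_of_finiteType L.property (HilbMod.fst L.obj (Y.obj t₁))).pair
        ((Y.ρ_compact t₁ s hs hst₁ (ht₁t.trans ht₀).le).isApprox.precomp _)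
    have h₂ := (h₁.precomp (HilbMod.kerι (coneD d φ t₁))).postcomp
      (HilbMod.adj (HilbMod.kerι (coneD d φ s)))
    have h₃ : r ≫ HilbMod.kerι (coneD d φ s) ≫ HilbMod.adj (HilbMod.kerι (coneD d φ s)) = r := by
      rw [HilbMod.comp_adj_of_isometry _ fun _ => rfl, Category.comp_id]
    rw [← h₃]
    exact h₂
  obtain ⟨q, hq, hq'⟩ := exists_radii ((eventually_lt hs).and (eventually_pos.and
    ((eventually_lt (F.X i).as.t₀_pos).and (eventually_level_comp (F.d i k)))))
  -- congruence modulo the images of the `u n` is cohomology at the levels `q n → 0`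
  let u : ∀ n, (F.X i).as.obj (q n) ⟶ HilbMod.prod L.obj (Y.obj (q n)) := fun n =>
    HilbMod.pair 0 (level (F.d i k) (q n))
  let ψ : ∀ n, HilbMod.ker (coneD d φ s) ⟶ HilbMod.prod L.obj (Y.obj (q n)) := fun n =>
    HilbMod.kerι (coneD d φ s) ≫ HilbMod.pair (HilbMod.fst _ _) (HilbMod.snd _ _ ≫ Y.ρ s (q n))
  obtain ⟨M, κ, n, hM, hκ⟩ := HilbMod.exists_finiteType_generators r hr u ψ fun z => by
    -- the second component `y₀` of `z` is cohomologous to a section over `]0, t[`, whose value at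
    -- `t₁` gives a vector of `Z(t₁)`
    set z₀ := HilbMod.toCLM (HilbMod.kerι (coneD d φ s)) z with hz₀
    obtain ⟨h₁, h₂⟩ := (coneD_eq_zero_iff d φ s z₀).1
      (congrArg (fun f => HilbMod.toCLM f z) (HilbMod.kerι_comp (coneD d φ s)))
    set x := HilbMod.toCLM (HilbMod.fst L.obj (Y.obj s)) z₀
    set y₀ := HilbMod.toCLM (HilbMod.snd L.obj (Y.obj s)) z₀
    obtain ⟨ξ, hξ⟩ := exists_germ one_pos (isFlat_const L 1 x)
    obtain ⟨y, hy⟩ := exists_germ hs (isFlat_transition (F.X k) hs₀ y₀)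
    obtain ⟨y', b, v, hy', e₁, hb, e₂⟩ := hsec x ξ hξ h₁ y (((hξ.map φ).eq_iff (hy.map _)).2 (by
      filter_upwards [eventually_lt hs, eventually_pos] with s' h h'
      have h₃ := hcφ s hs hst s' h' h.le x
      rw [h₂, hcδ s hs hst s' h' h.le] at h₃
      exact h₃.symm))
    obtain ⟨v', hv'⟩ := exists_represents v
    obtain ⟨n, hn⟩ := (hq.eventually ((hy.eq_iff (hb.add (hv'.map _))).1 e₂)).exists
    obtain ⟨p, hp₁, hp₂⟩ := HilbMod.exists_prod (V := L.obj) (W := Y.obj t₁) x (y' t₁)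
    obtain ⟨p, rfl⟩ := HilbMod.exists_kerι (coneD d φ t₁) ((coneD_eq_zero_iff d φ t₁ p).2 (by
      rw [hp₁, hp₂]
      exact ⟨h₁, (e₁ t₁ ht₁ ht₁t).symm⟩))
    refine ⟨n, p, v' (q n), HilbMod.prod_ext ?_ ?_⟩
    · exact hp₁.symm.trans (add_zero _).symm
    · refine Eq.trans hn (congrArg (· + HilbMod.toCLM (level (F.d i k) (q n)) (v' (q n))) ?_)
      change y' (q n) = HilbMod.toCLM (Y.ρ s (q n)) (HilbMod.toCLM (Y.ρ t₁ s)
        (HilbMod.toCLM (HilbMod.snd L.obj (Y.obj t₁))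
          (HilbMod.toCLM (HilbMod.kerι (coneD d φ t₁)) p)))
      rw [hp₂, hy' t₁ s hs hst₁.le ht₁t, hy' s (q n) (hq' n).2.1 (hq' n).1.le hst]
  obtain ⟨hqs, hq₀, hqi, hqc⟩ := hq' n
  let p := κ ≫ HilbMod.kerι (coneD d φ s)
  have hp : ∀ m, HilbMod.toCLM d.hom (HilbMod.toCLM (HilbMod.fst _ _) (HilbMod.toCLM p m)) = 0 ∧
      HilbMod.toCLM (level φ s) (HilbMod.toCLM (HilbMod.fst L.obj _) (HilbMod.toCLM p m)) =
        HilbMod.toCLM (level (F.d k (k + 1)) s)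
          (HilbMod.toCLM (HilbMod.snd L.obj _) (HilbMod.toCLM p m)) := fun m =>
    (coneD_eq_zero_iff d φ s (HilbMod.toCLM p m)).1 (congrArg
      (fun f => HilbMod.toCLM f (HilbMod.toCLM κ m)) (HilbMod.kerι_comp (coneD d φ s)))
  let L'' : Pf N := ⟨M, hM⟩
  let d'' : L'' ⟶ L := ObjectProperty.homMk (p ≫ HilbMod.fst _ _)
  let φ'' : (pfToMont N).obj L'' ⟶ F.X k := ofLevel hs hs₀ (p ≫ HilbMod.snd _ _)
  have hd'' := eventually_rep_const d''
  have hφ'' := eventually_level_ofLevel (L := L'') (W := F.X k) hs hs₀ (p ≫ HilbMod.snd _ _)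
  refine ⟨L'', d'', φ'', ObjectProperty.hom_ext _ (HilbMod.hom_ext fun m => (hp m).1),
    hom_ext_rep ?_, ?_⟩
  · filter_upwards [eventually_rep_comp φ'' (F.d k (k + 1)),
      eventually_rep_comp ((pfToMont N).map d'') φ, hd'', hφ'', eventually_lt hs,
      eventually_pos] with s' h₁ h₂ h₃ h₄ h h'
    rw [h₁, h₂, h₃]
    refine HilbMod.hom_ext fun m => ?_
    rw [HilbMod.toCLM_comp, h₄ m]
    have h₅ := hcφ s hs hst s' h' h.le (HilbMod.toCLM (HilbMod.fst L.obj _) (HilbMod.toCLM p m))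
    rw [(hp m).2, hcδ s hs hst s' h' h.le] at h₅
    exact h₅
  · intro _ i' hi' ξ y hξ hy
    obtain rfl : i' = i := by omega
    obtain ⟨x, hx⟩ := exists_represents_const ξ
    have hdx : HilbMod.toCLM d.hom x = 0 := by
      obtain ⟨s', h₁, h₂⟩ := (((hx.map _).eq_zero_iff.1 hξ).and (eventually_rep_const d)).exists
      exact (congrArg (fun f => HilbMod.toCLM f x) h₂).symm.trans h₁
    -- after a change of `y` by a coboundary, `(x, y)` is defined over `]0, t[` and its value at `s`
    -- is a vector of `Z(s)`
    obtain ⟨y', b, v, hy', e₁, hb, e₂⟩ := hsec x ξ hx hdx y hy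
    obtain ⟨z, hz₁, hz₂⟩ := HilbMod.exists_prod (V := L.obj) (W := Y.obj s) x (y' s)
    obtain ⟨z, rfl⟩ := HilbMod.exists_kerι (coneD d φ s) ((coneD_eq_zero_iff d φ s z).2 (by
      rw [hz₁, hz₂]
      exact ⟨hdx, (e₁ s hs hst).symm⟩))
    obtain ⟨m, c, hmc⟩ := hκ z
    have hm₁ : x = HilbMod.toCLM d''.hom m := by
      have := congrArg (HilbMod.toCLM (HilbMod.fst L.obj (Y.obj (q n)))) hmc
      rw [map_add] at this
      exact hz₁.symm.trans (this.trans (add_zero _))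
    have hm₂ : y' (q n) = HilbMod.toCLM (Y.ρ s (q n))
        (HilbMod.toCLM (HilbMod.snd L.obj (Y.obj s)) (HilbMod.toCLM p m)) +
          HilbMod.toCLM (level (F.d i' k) (q n)) c := by
      have := congrArg (HilbMod.toCLM (HilbMod.snd L.obj (Y.obj (q n)))) hmc
      rw [map_add] at this
      rw [← hy' s (q n) hq₀ hqs.le hst, ← hz₂]
      exact this
    obtain ⟨l, hl⟩ := exists_germ one_pos (isFlat_const L'' 1 m)
    obtain ⟨γ, hγ⟩ := exists_germ hq₀ (isFlat_transition (F.X i') hqi.le c)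
    refine ⟨l, γ + v, ((hl.map _).eq_iff hx).2 ?_, ?_⟩
    · filter_upwards [hd''] with s' h
      exact (congrArg (fun f => HilbMod.toCLM f m) h).trans hm₁.symm
    · rw [e₂, map_add, ← add_assoc]
      refine congrArg (· + (germs N).map (F.d i' k) v)
        ((hb.eq_iff ((hl.map φ'').add (hγ.map (F.d i' k)))).2 ?_)
      filter_upwards [hφ'', eventually_lt hq₀, eventually_pos] with s' h₁ h h'
      have h₂ := congrArg (HilbMod.toCLM (Y.ρ (q n) s')) hm₂
      rw [hy' (q n) s' h' h.le (hqs.trans hst), map_add, hqc s' h' h.le] at h₂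
      refine h₂.trans (congrArg₂ (· + ·) ?_ rfl)
      refine Eq.trans ?_ (h₁ m).symm
      exact congrArg (fun f => HilbMod.toCLM f (HilbMod.toCLM (HilbMod.snd L.obj (Y.obj s))
        (HilbMod.toCLM p m))) (Y.ρ_comp s (q n) s' h' h.le hqs.le hs₀)

/-- A qhtf complex has a resolution by constant modules of finite type. -/
lemma IsQhtf.exists_resolution {F : CochainComplex (Mont N) ℤ} (hF : IsQhtf F) (β : Bound)
    (hb : IsBounded β F) : ∃ L : CochainComplex (Pf N) ℤ, IsBounded β L ∧
      ∃ φ : ((pfToMont N).mapHomologicalComplex (ComplexShape.up ℤ)).obj L ⟶ F, IsQi φ := by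
  obtain ⟨L, hL, φ, hφ⟩ := Montel.exists_resolution (pfToMont N) (fun _ : Unit => germs N)
    (fun {L L'} d => ⟨⟨HilbMod.ker d.hom, L.property.ker d.hom⟩,
      ObjectProperty.homMk (HilbMod.kerι d.hom),
      ⟨fun f g e => ObjectProperty.hom_ext _ (HilbMod.hom_ext fun x =>
        HilbMod.kerι_injective d.hom (congrArg (fun k => HilbMod.toCLM k.hom x) e))⟩,
      ObjectProperty.hom_ext _ (HilbMod.kerι_comp d.hom), fun _ ξ hξ => by
        obtain ⟨x, hx⟩ := exists_represents_const ξ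
        obtain ⟨s, h₁, h₂⟩ := (((hx.map _).eq_zero_iff.1 hξ).and (eventually_rep_const d)).exists
        obtain ⟨z, hz⟩ := HilbMod.exists_kerι d.hom (x := x)
          ((congrArg (fun f => HilbMod.toCLM f x) h₂).symm.trans h₁)
        let K : Pf N := ⟨HilbMod.ker d.hom, L.property.ker d.hom⟩
        obtain ⟨ζ, hζ⟩ := exists_germ one_pos (isFlat_const K 1 z)
        refine ⟨ζ, ((hζ.map _).eq_iff hx).2 ?_⟩
        filter_upwards [eventually_rep_const (L := K) (ObjectProperty.homMk (HilbMod.kerι d.hom))]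
          with s h
        exact (congrArg (fun f => HilbMod.toCLM f z) h).trans hz⟩)
    F β hb fun k {L L'} d φ w => hF.exists_step k d φ w
  exact ⟨L, hL, φ, (hφ ()).isQi (isQhtf_const L) hF⟩

/-! ### The functor `ξν` is an equivalence -/

instance : (pfToMont N).Faithful where
  map_injective {X Y f g} h := by
    have h₁ := eventually_rep_const f
    rw [h] at h₁
    obtain ⟨s, h₁, h₂⟩ := (h₁.and (eventually_rep_const g)).exists
    exact ObjectProperty.hom_ext _ (h₁.symm.trans h₂)

instance : (pfToMont N).Full where
  map_surjective {X Y} f := by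
    obtain ⟨s, h, h₀⟩ := ((eventually_level_comp f).and eventually_pos).exists
    refine ⟨ObjectProperty.homMk (level f s), hom_ext_rep ?_⟩
    filter_upwards [eventually_rep_const (L := X) (L' := Y) (ObjectProperty.homMk (level f s)),
      eventually_lt h₀, eventually_pos] with s' h₁ h₂ h₃
    exact h₁.trans (HilbMod.hom_ext fun x => h s' h₃ h₂.le x)

variable (N) in
instance (i : Bound) : (nu N i).Full where
  map_surjective f := by
    obtain ⟨g, hg⟩ := (mapK (pfToMont N) i).map_surjective f.hom
    exact ⟨g, ObjectProperty.hom_ext _ hg⟩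

variable (N) in
instance (i : Bound) : (nu N i).Faithful where
  map_injective h := (mapK (pfToMont N) i).map_injective (congrArg (fun f => f.hom) h)

lemma isEquivalence_nu_xi (N : FiniteVN A) (i : Bound) : (nu N i ⋙ xi N i).IsEquivalence := by
  refine isEquivalence_comp_Q (nu N i) (qiMorphisms N i) (fun L X Y w hw => ?_) fun X => ?_
  · obtain ⟨σ, hσ, e⟩ := hw
    obtain ⟨n, hn⟩ := L.property.exists_isZero
    have h := comp_quotient_map_bijective
      (M := ((pfToMont N).mapHomologicalComplex (ComplexShape.up ℤ)).obj L.obj.as) σ n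
      (fun k hk => (pfToMont N).map_isZero (hn k hk))
      (fun k => liftsIn_const _ _ fun k x hx => hσ.isCohIso.exact_mappingCone _ k x hx)
    rw [e] at h
    constructor
    · intro f g hfg
      exact ObjectProperty.hom_ext _ (ObjectProperty.hom_ext _
        (h.1 (congrArg (fun f => f.hom.hom) hfg)))
    · intro f
      obtain ⟨g, hg⟩ := h.2 f.hom.hom
      exact ⟨ObjectProperty.homMk (ObjectProperty.homMk g),
        ObjectProperty.hom_ext _ (ObjectProperty.hom_ext _ hg)⟩
  · obtain ⟨L, hL, φ, hφ⟩ := X.property.exists_resolution i X.obj.property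
    exact ⟨⟨(HomotopyCategory.quotient (Pf N) (ComplexShape.up ℤ)).obj L, hL⟩,
      ObjectProperty.homMk (ObjectProperty.homMk
        ((HomotopyCategory.quotient (Mont N) (ComplexShape.up ℤ)).map φ)), φ, hφ, rfl⟩

end Montel

end

theorem mainTheorem3 {A : Type u} [Ring A] [Algebra ℂ A] [StarRing A] [StarModule ℂ A]
    (N : Montel.FiniteVN A) :
    ∃ _ : Montel.IsAbelian (Montel.Ef N), ∀ i : Montel.Bound,
      ∃ _ : (Montel.mu N i).IsEquivalence, (Montel.eta N i).IsEquivalence := by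
  refine ⟨Montel.isAbelian_ef, fun i => ?_⟩
  have := Montel.isAbelian_ef (N := N)
  have h := Montel.isEquivalence_mu (N := N) i
  have := Montel.isEquivalence_nu_xi N i
  refine ⟨h, ?_⟩
  unfold Montel.eta
  infer_instance
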